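/- Let $n\ge 2$ and let $\Omega,\Omega_1\subset\mathbb R^n$ be bounded connected open sets with smooth boundaries $\Gamma=\partial\Omega$ and $S=\partial\Omega_1$, such that $\Omega_1\subset\Omega$, $S\cap\Gamma=\emptyset$, and $\Omega_2=\Omega\setminus\overline{\Omega}_1$ is connected. Let $c_1,c_2>0$ be constants. All functions are complex-valued. Let $H=L^2(\Omega_1,c_1^{-1}dx)\times L^2(\Omega_2,c_2^{-1}dx)$ and $$X=\{(u_1,u_2)\in H^2(\Omega_1)\times H^2(\Omega_2)\;:\; u_2|_\Gamma=0,\ u_1|_S=u_2|_S,\ \partial_\nu u_1|_S=\partial_\nu u_2|_S\},$$ where the boundary values are taken in the sense of traces and $\nu$ is the unit normal on $S$ pointing out of $\Omega_1$. For $(u_1,u_2)\in X$ put $G(u_1,u_2)=(-c_1\Delta u_1,-c_2\Delta u_2)\in H$ and $$\|(u_1,u_2)\|_2^2=\|u_1\|_{H^2(\Omega_1)}^2+\|u_2\|_{H^2(\Omega_2)}^2,\qquad \|(u_1,u_2)\|_X=\|G(u_1,u_2)\|_H.$$ Then $\|\cdot\|_2$ and $\|\cdot\|_X$ are both norms on $X$,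 coming from the inner products $\langle u_1,v_1\rangle_{H^2(\Omega_1)}+\langle u_2,v_2\rangle_{H^2(\Omega_2)}$ and $\langle G(u_1,u_2),G(v_1,v_2)\rangle_H$ respectively; $X$ is a Hilbert space for each of them; and the two norms are equivalent: there are constants $m,M>0$ (which may depend on $\Omega,\Omega_1,c_1,c_2$) such that $$m\,\|u\|_2\le\|u\|_X\le M\,\|u\|_2\qquad\text{for all }u\in X.$$ In particular the two norms define the same topology on $X$. -/

import Mathlib

open MeasureTheory Filter Topology
open scoped ContDiff ENNReal

noncomputable section

namespace Plate

/-- `ℝⁿ` with its Euclidean structure. -/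
abbrev E (n : ℕ) : Type := EuclideanSpace ℝ (Fin n)

/-- The `i`-th vector of the standard basis of `ℝⁿ`. -/
abbrev e {n : ℕ} (i : Fin n) : E n := EuclideanSpace.single i (1 : ℝ)

/-- The complex Hilbert space `L²(Ω)` for Lebesgue measure. -/
abbrev L2 {n : ℕ} (Ω : Set (E n)) : Type := Lp ℂ 2 (volume.restrict Ω)

/-! ### Smooth boundaries and the outward normal -/

/-- `ρ` is a smooth defining function of `Ω` near the boundary point `x`:
near `x` the set `Ω` is `{ρ < 0}`, with `ρ x = 0` and `∇ρ(x) ≠ 0`. -/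
def IsLocalDefiningFunction {n : ℕ} (Ω : Set (E n)) (x : E n) (ρ : E n → ℝ) : Prop :=
  ContDiff ℝ ∞ ρ ∧ ρ x = 0 ∧ gradient ρ x ≠ 0 ∧ ∀ᶠ y in 𝓝 x, (y ∈ Ω ↔ ρ y < 0)

/-- `Ω` has a smooth (`C^∞`) boundary and lies locally on one side of it. -/
def HasSmoothBoundary {n : ℕ} (Ω : Set (E n)) : Prop :=
  ∀ x ∈ frontier Ω, ∃ ρ : E n → ℝ, IsLocalDefiningFunction Ω x ρ

open Classical in
/-- The unit outward normal `∇ρ / |∇ρ|` of `Ω` at a boundary point, which does not depend on the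
local defining function `ρ` (and `0` at points where there is none). -/
def outerNormal {n : ℕ} (Ω : Set (E n)) (x : E n) : E n :=
  if h : ∃ ρ : E n → ℝ, IsLocalDefiningFunction Ω x ρ then
    ‖gradient h.choose x‖⁻¹ • gradient h.choose x
  else 0

/-- Surface measure on a hypersurface `B` of `ℝⁿ`: the `(n-1)`-dimensional Hausdorff measure
in its Euclidean normalization. -/
def surface {n : ℕ} (B : Set (E n)) : Measure (E n) := (μHE[n - 1] : Measure (E n)).restrict B

/-- The space `L²(B)` for the surface measure. -/
abbrev L2Surface {n : ℕ} (B : Set (E n)) : Type := Lp ℂ 2 (surface B)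

/-! ### Weak derivatives and the Sobolev space `H²` -/

/-- `v = ∂ᵢ u` in `Ω` in the sense of distributions. -/
def IsWeakPartial {n : ℕ} (Ω : Set (E n)) (i : Fin n) (u v : L2 Ω) : Prop :=
  ∀ φ : E n → ℝ, ContDiff ℝ ∞ φ → HasCompactSupport φ → tsupport φ ⊆ Ω →
    ∫ x in Ω, ((fderiv ℝ φ x (e i) : ℝ) : ℂ) * u x = - ∫ x in Ω, ((φ x : ℝ) : ℂ) * v x

/-- `u ∈ H²(Ω)`: all weak derivatives of order at most two exist and are in `L²(Ω)`. -/
def MemH2 {n : ℕ} (Ω : Set (E n)) (u : L2 Ω) : Prop :=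
  ∀ i, ∃ v : L2 Ω, IsWeakPartial Ω i u v ∧ ∀ j, ∃ w : L2 Ω, IsWeakPartial Ω j v w

open Classical in
/-- The weak derivative `∂ᵢ u ∈ L²(Ω)` (and `0` where it does not exist). -/
def weakPartial {n : ℕ} (Ω : Set (E n)) (i : Fin n) (u : L2 Ω) : L2 Ω :=
  if h : ∃ v : L2 Ω, IsWeakPartial Ω i u v then h.choose else 0

/-- The Laplacian `Δu = ∑ᵢ ∂ᵢ∂ᵢ u` for `u ∈ H²(Ω)`. -/
def laplacian {n : ℕ} (Ω : Set (E n)) (u : L2 Ω) : L2 Ω :=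
  ∑ i, weakPartial Ω i (weakPartial Ω i u)

/-- The inner product of `H²(Ω)`, conjugate-linear in the first argument. -/
def h2Inner {n : ℕ} (Ω : Set (E n)) (u v : L2 Ω) : ℂ :=
  inner ℂ u v + ∑ i, inner ℂ (weakPartial Ω i u) (weakPartial Ω i v)
    + ∑ i, ∑ j, inner ℂ (weakPartial Ω j (weakPartial Ω i u))
        (weakPartial Ω j (weakPartial Ω i v))

/-- The norm of `H²(Ω)`. -/
def h2Norm {n : ℕ} (Ω : Set (E n)) (u : L2 Ω) : ℝ :=
  Real.sqrt (‖u‖ ^ 2 + ∑ i, ‖weakPartial Ω i u‖ ^ 2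
    + ∑ i, ∑ j, ‖weakPartial Ω j (weakPartial Ω i u)‖ ^ 2)

/-! ### Traces -/

/-- `g ∈ L²(B)` is the trace on the boundary part `B` of a function `u ∈ H¹(Ω)`: there are smooth
functions on `ℝⁿ` which converge to `u` in `H¹(Ω)` and whose restrictions to `B` converge to `g` in
`L²(B)`. -/
def HasTrace {n : ℕ} (Ω B : Set (E n)) (u : L2 Ω) (g : L2Surface B) : Prop :=
  ∃ (v : Fin n → L2 Ω) (φ : ℕ → E n → ℂ),
    (∀ i, IsWeakPartial Ω i u (v i)) ∧
    (∀ k, ContDiff ℝ ∞ (φ k) ∧ HasCompactSupport (φ k)) ∧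
    Tendsto (fun k => eLpNorm (fun x => φ k x - u x) 2 (volume.restrict Ω)) atTop (𝓝 0) ∧
    (∀ i, Tendsto (fun k => eLpNorm (fun x => fderiv ℝ (φ k) x (e i) - v i x) 2
      (volume.restrict Ω)) atTop (𝓝 0)) ∧
    Tendsto (fun k => eLpNorm (fun x => φ k x - g x) 2 (surface B)) atTop (𝓝 0)

/-- `g ∈ L²(B)` is the normal derivative `∑ᵢ νᵢ (∂ᵢ u)|_B` on the boundary part `B` of a function
`u ∈ H²(Ω)`, for the unit normal field `ν` on `B`. -/
def HasNormalDerivative {n : ℕ} (Ω B : Set (E n)) (ν : E n → E n) (u : L2 Ω)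
    (g : L2Surface B) : Prop :=
  ∃ (v : Fin n → L2 Ω) (t : Fin n → L2Surface B),
    (∀ i, IsWeakPartial Ω i u (v i)) ∧ (∀ i, HasTrace Ω B (v i) (t i)) ∧
    ∀ᵐ x ∂(surface B), g x = ∑ i, ((ν x i : ℝ) : ℂ) * t i x

/-! ### Linearity of these notions -/

section Linearity

variable {n : ℕ} {Ω B : Set (E n)}

lemma integrable_test {φ : E n → ℝ} (hφ : Continuous φ) (hc : HasCompactSupport φ) (u : L2 Ω) :
    Integrable (fun x => ((φ x : ℝ) : ℂ) * u x) (volume.restrict Ω) := by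
  have h1 : MemLp (fun x => ((φ x : ℝ) : ℂ)) 2 (volume.restrict Ω) := by
    refine Continuous.memLp_of_hasCompactSupport (by fun_prop) ?_
    exact hc.comp_left (g := fun r : ℝ => (r : ℂ)) (by simp)
  exact MemLp.integrable_mul h1 (Lp.memLp u)

lemma IsWeakPartial.add {i : Fin n} {u u' v v' : L2 Ω} (h : IsWeakPartial Ω i u v)
    (h' : IsWeakPartial Ω i u' v') : IsWeakPartial Ω i (u + u') (v + v') := by
  intro φ hφ hc hs
  have hd : Continuous (fun x => fderiv ℝ φ x (e i)) :=
    (hφ.continuous_fderiv (by simp)).clm_apply continuous_const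
  have hdc : HasCompactSupport (fun x => fderiv ℝ φ x (e i)) := hc.fderiv_apply (𝕜 := ℝ) (e i)
  have a1 : ∫ x in Ω, ((fderiv ℝ φ x (e i) : ℝ) : ℂ) * (u + u' : L2 Ω) x
      = ∫ x in Ω, (((fderiv ℝ φ x (e i) : ℝ) : ℂ) * u x
        + ((fderiv ℝ φ x (e i) : ℝ) : ℂ) * u' x) := by
    refine integral_congr_ae ?_
    filter_upwards [Lp.coeFn_add u u'] with x hx
    rw [hx, Pi.add_apply, mul_add]
  have a2 : ∫ x in Ω, ((φ x : ℝ) : ℂ) * (v + v' : L2 Ω) x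
      = ∫ x in Ω, (((φ x : ℝ) : ℂ) * v x + ((φ x : ℝ) : ℂ) * v' x) := by
    refine integral_congr_ae ?_
    filter_upwards [Lp.coeFn_add v v'] with x hx
    rw [hx, Pi.add_apply, mul_add]
  rw [a1, a2, integral_add (integrable_test hd hdc u) (integrable_test hd hdc u'),
    integral_add (integrable_test hφ.continuous hc v) (integrable_test hφ.continuous hc v'),
    h φ hφ hc hs, h' φ hφ hc hs, neg_add]

lemma IsWeakPartial.smul {i : Fin n} {u v : L2 Ω} (c : ℂ) (h : IsWeakPartial Ω i u v) :
    IsWeakPartial Ω i (c • u) (c • v) := by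
  intro φ hφ hc hs
  have a1 : ∫ x in Ω, ((fderiv ℝ φ x (e i) : ℝ) : ℂ) * (c • u : L2 Ω) x
      = ∫ x in Ω, c * (((fderiv ℝ φ x (e i) : ℝ) : ℂ) * u x) := by
    refine integral_congr_ae ?_
    filter_upwards [Lp.coeFn_smul c u] with x hx
    rw [hx, Pi.smul_apply, smul_eq_mul]; ring
  have a2 : ∫ x in Ω, ((φ x : ℝ) : ℂ) * (c • v : L2 Ω) x
      = ∫ x in Ω, c * (((φ x : ℝ) : ℂ) * v x) := by
    refine integral_congr_ae ?_
    filter_upwards [Lp.coeFn_smul c v] with x hx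
    rw [hx, Pi.smul_apply, smul_eq_mul]; ring
  rw [a1, a2, integral_const_mul, integral_const_mul, h φ hφ hc hs, mul_neg]

lemma IsWeakPartial.zero (i : Fin n) : IsWeakPartial Ω i (0 : L2 Ω) 0 := by
  have h : IsWeakPartial Ω i ((0 : ℂ) • (0 : L2 Ω)) ((0 : ℂ) • (0 : L2 Ω)) := by
    intro φ hφ hc hs
    have h0 : ∀ f : E n → ℂ, ∫ x in Ω, f x * ((0 : ℂ) • (0 : L2 Ω) : L2 Ω) x = 0 := by
      intro f
      rw [smul_zero]
      refine integral_eq_zero_of_ae ?_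
      filter_upwards [Lp.coeFn_zero ℂ 2 (volume.restrict Ω)] with x hx
      rw [hx]; simp
    rw [h0, h0, neg_zero]
  simpa using h

lemma MemH2.add {u u' : L2 Ω} (h : MemH2 Ω u) (h' : MemH2 Ω u') : MemH2 Ω (u + u') := by
  intro i
  obtain ⟨v, hv, hw⟩ := h i
  obtain ⟨v', hv', hw'⟩ := h' i
  refine ⟨v + v', hv.add hv', fun j => ?_⟩
  obtain ⟨w, hw⟩ := hw j
  obtain ⟨w', hw'⟩ := hw' j
  exact ⟨w + w', hw.add hw'⟩

lemma MemH2.smul {u : L2 Ω} (c : ℂ) (h : MemH2 Ω u) : MemH2 Ω (c • u) := by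
  intro i
  obtain ⟨v, hv, hw⟩ := h i
  refine ⟨c • v, hv.smul c, fun j => ?_⟩
  obtain ⟨w, hw⟩ := hw j
  exact ⟨c • w, hw.smul c⟩

lemma MemH2.zero : MemH2 Ω (0 : L2 Ω) :=
  fun i => ⟨0, IsWeakPartial.zero i, fun j => ⟨0, IsWeakPartial.zero j⟩⟩

lemma tendsto_sub_add {μ : Measure (E n)} {f f' : ℕ → E n → ℂ} {g g' : Lp ℂ 2 μ}
    (hf : ∀ k, Continuous (f k)) (hf' : ∀ k, Continuous (f' k))
    (h : Tendsto (fun k => eLpNorm (fun x => f k x - g x) 2 μ) atTop (𝓝 0))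
    (h' : Tendsto (fun k => eLpNorm (fun x => f' k x - g' x) 2 μ) atTop (𝓝 0)) :
    Tendsto (fun k => eLpNorm (fun x => (f k x + f' k x) - (g + g' : Lp ℂ 2 μ) x) 2 μ)
      atTop (𝓝 0) := by
  have hsum := h.add h'
  rw [add_zero] at hsum
  refine tendsto_of_tendsto_of_tendsto_of_le_of_le tendsto_const_nhds hsum (fun k => zero_le)
    (fun k => ?_)
  have e1 : eLpNorm (fun x => (f k x + f' k x) - (g + g' : Lp ℂ 2 μ) x) 2 μ
      = eLpNorm ((fun x => f k x - g x) + (fun x => f' k x - g' x)) 2 μ := by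
    refine eLpNorm_congr_ae ?_
    filter_upwards [Lp.coeFn_add g g'] with x hx
    simp only [hx, Pi.add_apply]; ring
  simp only [e1]
  exact eLpNorm_add_le ((hf k).aestronglyMeasurable.sub (Lp.aestronglyMeasurable g))
    ((hf' k).aestronglyMeasurable.sub (Lp.aestronglyMeasurable g')) (by norm_num)

lemma tendsto_sub_smul {μ : Measure (E n)} {f : ℕ → E n → ℂ} {g : Lp ℂ 2 μ} (c : ℂ)
    (h : Tendsto (fun k => eLpNorm (fun x => f k x - g x) 2 μ) atTop (𝓝 0)) :
    Tendsto (fun k => eLpNorm (fun x => c * f k x - (c • g : Lp ℂ 2 μ) x) 2 μ)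
      atTop (𝓝 0) := by
  have h1 : Tendsto (fun k => ‖c‖ₑ * eLpNorm (fun x => f k x - g x) 2 μ) atTop (𝓝 0) := by
    have := ENNReal.Tendsto.const_mul (a := ‖c‖ₑ) h (Or.inr enorm_ne_top)
    rwa [mul_zero] at this
  refine h1.congr (fun k => ?_)
  rw [← eLpNorm_const_smul]
  refine eLpNorm_congr_ae ?_
  filter_upwards [Lp.coeFn_smul c g] with x hx
  simp only [hx, Pi.smul_apply, smul_eq_mul]; ring

lemma HasTrace.add {u u' : L2 Ω} {g g' : L2Surface B} (h : HasTrace Ω B u g)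
    (h' : HasTrace Ω B u' g') : HasTrace Ω B (u + u') (g + g') := by
  obtain ⟨v, φ, hv, hφ, hu, hd, hg⟩ := h
  obtain ⟨v', φ', hv', hφ', hu', hd', hg'⟩ := h'
  have hc := fun k => (hφ k).1.continuous
  have hc' := fun k => (hφ' k).1.continuous
  have hdc : ∀ i k, Continuous (fun x => fderiv ℝ (φ k) x (e i)) := fun i k =>
    ((hφ k).1.continuous_fderiv (by simp)).clm_apply continuous_const
  have hdc' : ∀ i k, Continuous (fun x => fderiv ℝ (φ' k) x (e i)) := fun i k =>
    ((hφ' k).1.continuous_fderiv (by simp)).clm_apply continuous_const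
  refine ⟨fun i => v i + v' i, fun k x => φ k x + φ' k x, fun i => (hv i).add (hv' i),
    fun k => ⟨(hφ k).1.add (hφ' k).1, (hφ k).2.add (hφ' k).2⟩,
    tendsto_sub_add hc hc' hu hu', fun i => ?_, tendsto_sub_add hc hc' hg hg'⟩
  refine (tendsto_sub_add (hdc i) (hdc' i) (hd i) (hd' i)).congr (fun k => ?_)
  congr 1
  funext x
  have h1 : fderiv ℝ (fun x => φ k x + φ' k x) x = fderiv ℝ (φ k) x + fderiv ℝ (φ' k) x :=
    fderiv_fun_add ((hφ k).1.differentiable (by simp) x) ((hφ' k).1.differentiable (by simp) x)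
  rw [h1]; rfl

lemma HasTrace.smul {u : L2 Ω} {g : L2Surface B} (c : ℂ) (h : HasTrace Ω B u g) :
    HasTrace Ω B (c • u) (c • g) := by
  obtain ⟨v, φ, hv, hφ, hu, hd, hg⟩ := h
  refine ⟨fun i => c • v i, fun k x => c * φ k x, fun i => (hv i).smul c,
    fun k => ⟨contDiff_const.mul (hφ k).1, (hφ k).2.mul_left⟩,
    tendsto_sub_smul c hu, fun i => ?_, tendsto_sub_smul c hg⟩
  refine (tendsto_sub_smul c (hd i)).congr (fun k => ?_)
  congr 1
  funext x
  have h1 : fderiv ℝ (fun x => c * φ k x) x = c • fderiv ℝ (φ k) x :=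
    fderiv_const_mul ((hφ k).1.differentiable (by simp) x) c
  rw [h1]; rfl

lemma HasTrace.zero : HasTrace Ω B (0 : L2 Ω) (0 : L2Surface B) := by
  have hz : ∀ μ : Measure (E n), eLpNorm (fun x => (0 : ℂ) - (0 : Lp ℂ 2 μ) x) 2 μ = 0 := by
    intro μ
    have : (fun x => (0 : ℂ) - (0 : Lp ℂ 2 μ) x) =ᵐ[μ] (fun _ => (0 : ℂ)) := by
      filter_upwards [Lp.coeFn_zero ℂ 2 μ] with x hx
      rw [hx]; simp
    rw [eLpNorm_congr_ae this]
    exact eLpNorm_zero'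
  refine ⟨fun _ => 0, fun _ _ => 0, fun i => IsWeakPartial.zero i,
    fun k => ⟨contDiff_const, HasCompactSupport.zero⟩, ?_, fun i => ?_, ?_⟩
  · simp only [hz]; exact tendsto_const_nhds
  · simp only [fderiv_const_apply, zero_apply, hz]
    exact tendsto_const_nhds
  · simp only [hz]; exact tendsto_const_nhds

lemma HasNormalDerivative.add {ν : E n → E n} {u u' : L2 Ω} {g g' : L2Surface B}
    (h : HasNormalDerivative Ω B ν u g) (h' : HasNormalDerivative Ω B ν u' g') :
    HasNormalDerivative Ω B ν (u + u') (g + g') := by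
  obtain ⟨v, t, hv, ht, hg⟩ := h
  obtain ⟨v', t', hv', ht', hg'⟩ := h'
  refine ⟨fun i => v i + v' i, fun i => t i + t' i, fun i => (hv i).add (hv' i),
    fun i => (ht i).add (ht' i), ?_⟩
  have hall := ae_all_iff.2 fun i => Lp.coeFn_add (t i) (t' i)
  filter_upwards [hg, hg', Lp.coeFn_add g g', hall] with x h1 h2 h3 h4
  simp only [h3, Pi.add_apply, h1, h2, h4, mul_add, Finset.sum_add_distrib]

lemma HasNormalDerivative.smul {ν : E n → E n} {u : L2 Ω} {g : L2Surface B} (c : ℂ)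
    (h : HasNormalDerivative Ω B ν u g) : HasNormalDerivative Ω B ν (c • u) (c • g) := by
  obtain ⟨v, t, hv, ht, hg⟩ := h
  refine ⟨fun i => c • v i, fun i => c • t i, fun i => (hv i).smul c,
    fun i => (ht i).smul c, ?_⟩
  have hall := ae_all_iff.2 fun i => Lp.coeFn_smul c (t i)
  filter_upwards [hg, Lp.coeFn_smul c g, hall] with x h1 h3 h4
  simp only [h3, Pi.smul_apply, h1, h4, smul_eq_mul, Finset.mul_sum]
  exact Finset.sum_congr rfl fun i _ => by ring

lemma HasNormalDerivative.zero {ν : E n → E n} :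
    HasNormalDerivative Ω B ν (0 : L2 Ω) (0 : L2Surface B) := by
  refine ⟨fun _ => 0, fun _ => 0, fun i => IsWeakPartial.zero i, fun _ => HasTrace.zero, ?_⟩
  filter_upwards [Lp.coeFn_zero ℂ 2 (surface B)] with x hx
  have hr : ∑ i, ((ν x i : ℝ) : ℂ) * (0 : L2Surface B) x = 0 := by
    simp only [hx, Pi.zero_apply, mul_zero, Finset.sum_const_zero]
  rw [hr, hx]; rfl

end Linearity

/-! ### The transmission space -/

/-- `Ω₂ = Ω \ closure Ω₁`. -/
abbrev outerDomain {n : ℕ} (Ω Ω₁ : Set (E n)) : Set (E n) := Ω \ closure Ω₁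

/-- The space `X` of all `(u₁, u₂) ∈ H²(Ω₁) × H²(Ω₂)` such that `u₂ = 0` on `Γ = ∂Ω`, and
`u₁ = u₂`, `∂_ν u₁ = ∂_ν u₂` on `S = ∂Ω₁`, with `ν` the unit normal on `S` pointing out of `Ω₁`. -/
def X {n : ℕ} (Ω Ω₁ : Set (E n)) : Submodule ℂ (L2 Ω₁ × L2 (outerDomain Ω Ω₁)) where
  carrier := {u | MemH2 Ω₁ u.1 ∧ MemH2 (outerDomain Ω Ω₁) u.2 ∧
    HasTrace (outerDomain Ω Ω₁) (frontier Ω) u.2 0 ∧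
    (∃ g : L2Surface (frontier Ω₁),
      HasTrace Ω₁ (frontier Ω₁) u.1 g ∧ HasTrace (outerDomain Ω Ω₁) (frontier Ω₁) u.2 g) ∧
    (∃ g : L2Surface (frontier Ω₁),
      HasNormalDerivative Ω₁ (frontier Ω₁) (outerNormal Ω₁) u.1 g ∧
      HasNormalDerivative (outerDomain Ω Ω₁) (frontier Ω₁) (outerNormal Ω₁) u.2 g)}
  add_mem' := by
    rintro u v ⟨h1, h2, h3, ⟨g, h4, h5⟩, ⟨k, h6, h7⟩⟩ ⟨h1', h2', h3', ⟨g', h4', h5'⟩,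
      ⟨k', h6', h7'⟩⟩
    have h0 := h3.add h3'
    rw [add_zero] at h0
    exact ⟨h1.add h1', h2.add h2', h0, ⟨g + g', h4.add h4', h5.add h5'⟩,
      ⟨k + k', h6.add h6', h7.add h7'⟩⟩
  zero_mem' := ⟨MemH2.zero, MemH2.zero, HasTrace.zero, ⟨0, HasTrace.zero, HasTrace.zero⟩,
    ⟨0, HasNormalDerivative.zero, HasNormalDerivative.zero⟩⟩
  smul_mem' := by
    rintro c u ⟨h1, h2, h3, ⟨g, h4, h5⟩, ⟨k, h6, h7⟩⟩
    have h0 := h3.smul c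
    rw [smul_zero] at h0
    exact ⟨h1.smul c, h2.smul c, h0, ⟨c • g, h4.smul c, h5.smul c⟩,
      ⟨c • k, h6.smul c, h7.smul c⟩⟩

/-- The operator `G (u₁, u₂) = (-c₁ Δu₁, -c₂ Δu₂)`. -/
def G {n : ℕ} (Ω Ω₁ : Set (E n)) (c₁ c₂ : ℝ) (u : X Ω Ω₁) : L2 Ω₁ × L2 (outerDomain Ω Ω₁) :=
  (-((c₁ : ℂ) • laplacian Ω₁ u.1.1), -((c₂ : ℂ) • laplacian (outerDomain Ω Ω₁) u.1.2))

/-- The inner product of `H = L²(Ω₁, c₁⁻¹ dx) × L²(Ω₂, c₂⁻¹ dx)`, conjugate-linear in the first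
argument. -/
def hInner {n : ℕ} {Ω₁ Ω₂ : Set (E n)} (c₁ c₂ : ℝ) (f g : L2 Ω₁ × L2 Ω₂) : ℂ :=
  ((c₁⁻¹ : ℝ) : ℂ) * inner ℂ f.1 g.1 + ((c₂⁻¹ : ℝ) : ℂ) * inner ℂ f.2 g.2

/-- The norm of `H = L²(Ω₁, c₁⁻¹ dx) × L²(Ω₂, c₂⁻¹ dx)`. -/
def hNorm {n : ℕ} {Ω₁ Ω₂ : Set (E n)} (c₁ c₂ : ℝ) (f : L2 Ω₁ × L2 Ω₂) : ℝ :=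
  Real.sqrt (c₁⁻¹ * ‖f.1‖ ^ 2 + c₂⁻¹ * ‖f.2‖ ^ 2)

/-- The inner product `⟨u₁, v₁⟩_{H²(Ω₁)} + ⟨u₂, v₂⟩_{H²(Ω₂)}` on `X`. -/
def innerTwo {n : ℕ} (Ω Ω₁ : Set (E n)) (u v : X Ω Ω₁) : ℂ :=
  h2Inner Ω₁ u.1.1 v.1.1 + h2Inner (outerDomain Ω Ω₁) u.1.2 v.1.2

/-- The norm `‖(u₁, u₂)‖₂ = (‖u₁‖²_{H²(Ω₁)} + ‖u₂‖²_{H²(Ω₂)})^{1/2}` on `X`. -/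
def normTwo {n : ℕ} (Ω Ω₁ : Set (E n)) (u : X Ω Ω₁) : ℝ :=
  Real.sqrt (h2Norm Ω₁ u.1.1 ^ 2 + h2Norm (outerDomain Ω Ω₁) u.1.2 ^ 2)

/-- The inner product `⟨G u, G v⟩_H` on `X`. -/
def innerX {n : ℕ} (Ω Ω₁ : Set (E n)) (c₁ c₂ : ℝ) (u v : X Ω Ω₁) : ℂ :=
  hInner c₁ c₂ (G Ω Ω₁ c₁ c₂ u) (G Ω Ω₁ c₁ c₂ v)

/-- The norm `‖u‖_X = ‖G u‖_H` on `X`. -/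
def normX {n : ℕ} (Ω Ω₁ : Set (E n)) (c₁ c₂ : ℝ) (u : X Ω Ω₁) : ℝ :=
  hNorm c₁ c₂ (G Ω Ω₁ c₁ c₂ u)

/-! ### Inner products on a bare vector space -/

/-- The norm of a vector for an inner product. -/
def normOf {V : Type*} [AddCommGroup V] [Module ℂ V] (I : InnerProductSpace.Core ℂ V) (u : V) :
    ℝ :=
  @norm V I.toNormedAddCommGroup.toNorm u

/-- The topology which an inner product defines. -/
@[reducible] def topologyOf {V : Type*} [AddCommGroup V] [Module ℂ V] (I : InnerProductSpace.Core ℂ V) :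
    TopologicalSpace V :=
  I.toNormedAddCommGroup.toPseudoMetricSpace.toUniformSpace.toTopologicalSpace

/-- The space is complete for the inner product, that is, a Hilbert space. -/
def IsHilbert {V : Type*} [AddCommGroup V] [Module ℂ V] (I : InnerProductSpace.Core ℂ V) : Prop :=
  @CompleteSpace V I.toNormedAddCommGroup.toPseudoMetricSpace.toUniformSpace

end Plate

end

/-!
# Equivalence of the `H²` norm and the graph norm in a transmission problem

The only analytic content is the estimate `‖u‖₂ ≤ C ‖G u‖`; the converse inequality is trivial, and
the constants `c₁`, `c₂` only enter through the constants of the estimates.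

**Gluing.** The two parts of an element of `X` fit together to one function in `H²(Ω) ∩ H¹₀(Ω)`
(`IsTransmissionDomain.isDirichletH2_glue`). Since the traces agree on the interface and vanish on
the outer boundary, there is no singular first derivative. Since second derivatives commute, the jump
of the gradient across the interface is normal to it (`jump_normal`); since the normal derivatives
agree, it vanishes (`traces_eq`), so there is no singular second derivative either. Thus the
interface disappears, and what is left is the estimate of the `H²` norm by the Laplacian in
`H²(Ω) ∩ H¹₀(Ω)` (`exists_apriori_bound`).

**The a priori estimate.** The function and its gradient are controlled by the Poincaré inequality
and the energy identity. For the second derivatives there is no need to flatten the boundary or to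
prove regularity, because the function is already known to be in `H²`. The commutator of a smooth
vector field `a` with the Laplacian gives a weak equation for `a · ∇u` with right-hand side of lower
order (`tangential_identity`). If `a` is tangential to the boundary, then `a · ∇u` is in `H¹₀` again
(`exists_tangential_extension`: the boundary terms of a cut-off argument are integrals of `u` over
strips of width `1/m`, which are `o(1/m)` by `tendsto_strip`), so that it may be used as a test
function in its own equation (`integral_eq_zero_of_test`, `exists_tangential_bound`). The second
derivatives which are not tangential are an algebraic combination of the tangential ones and the
Laplacian (`sq_le_of_tangential`).

**Traces.** The gluing needs the divergence theorem near the boundary for the surface measure. The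
boundary is locally a Lipschitz graph (`exists_graph`). In the direction of the graph the theorem is
Fubini and the fundamental theorem of calculus; the other directions follow since tangential fields
have no flux (`setIntegral_tangential`). Here the image of Lebesgue measure under the graph map takes
the place of the surface measure, with which it is comparable (`exists_graph_measure`); the surface
area element itself is never computed. Applied to squares, the divergence theorem also gives the trace
inequality (`exists_trace_bound`).

**Completeness.** Both inner products are pulled back along injective linear maps (`pullbackCore`),
the first one along the map which takes `u` to all its derivatives of order at most two. The range of
this map is closed, because the trace inequality preserves the boundary and transmission conditions in
the limit (`isClosed_range_transmissionJet`). Equivalent norms define the same uniform structure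
(`uniformityOf_eq`), so the second inner product is complete as well and has the same topology.
-/

namespace Plate

/-! ### Test functions -/

/-- The `i`-th partial derivative of a function on `ℝⁿ`. -/
noncomputable abbrev pd {n : ℕ} {F : Type*} [NormedAddCommGroup F] [NormedSpace ℝ F] (i : Fin n) (φ : E n → F) :
    E n → F :=
  fun x => fderiv ℝ φ x (e i)

/-- Real test functions: smooth, with compact support contained in `U`. -/
structure IsTest {n : ℕ} (U : Set (E n)) (φ : E n → ℝ) : Prop where
  smooth : ContDiff ℝ ∞ φ
  compact : HasCompactSupport φ
  subset : tsupport φ ⊆ U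

section Test

variable {n : ℕ} {U V : Set (E n)} {F : Type*} [NormedAddCommGroup F] [NormedSpace ℝ F]

lemma contDiff_pd {φ : E n → F} (h : ContDiff ℝ ∞ φ) (i : Fin n) : ContDiff ℝ ∞ (pd i φ) :=
  (h.fderiv_right (m := ∞) (by simp)).clm_apply contDiff_const

lemma pd_mul {a φ : E n → ℝ} (ha : ContDiff ℝ ∞ a) (hφ : ContDiff ℝ ∞ φ) (i : Fin n) (x : E n) :
    pd i (fun y => a y * φ y) x = pd i a x * φ x + a x * pd i φ x := by
  have := fderiv_fun_mul (ha.differentiable (by simp) x) (hφ.differentiable (by simp) x)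
  simp only [pd, this]
  simp
  ring

lemma pd_sum {ι : Type*} {s : Finset ι} {a : ι → E n → F}
    (ha : ∀ k ∈ s, ContDiff ℝ ∞ (a k)) (i : Fin n) (x : E n) :
    pd i (fun y => ∑ k ∈ s, a k y) x = ∑ k ∈ s, pd i (a k) x := by
  have := fderiv_fun_sum (u := s) (A := a) (x := x) (𝕜 := ℝ)
    (fun k hk => (ha k hk).differentiable (by simp) x)
  simp only [pd, this]
  simp

lemma pd_comm {φ : E n → F} (h : ContDiff ℝ ∞ φ) (i j : Fin n) (x : E n) :
    pd i (pd j φ) x = pd j (pd i φ) x := by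
  have hd : ∀ y, HasFDerivAt φ (fderiv ℝ φ y) y := fun y =>
    (h.differentiable (by simp) y).hasFDerivAt
  have h2 : HasFDerivAt (fderiv ℝ φ) (fderiv ℝ (fderiv ℝ φ) x) x :=
    ((h.fderiv_right (m := ∞) (by simp)).differentiable (by simp) x).hasFDerivAt
  have hs := second_derivative_symmetric hd h2 (e i) (e j)
  have key : ∀ k l : Fin n, pd k (pd l φ) x = fderiv ℝ (fderiv ℝ φ) x (e k) (e l) := by
    intro k l
    have : HasFDerivAt (pd l φ) ((fderiv ℝ (fderiv ℝ φ) x).flip (e l)) x := by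
      have := h2.clm_apply (hasFDerivAt_const (e l) x)
      simpa using this
    simp only [pd] at this ⊢
    rw [this.fderiv]; rfl
  rw [key, key, hs]

namespace IsTest

variable {φ ψ : E n → ℝ}

lemma continuous (h : IsTest U φ) : Continuous φ := h.smooth.continuous

lemma mono (h : IsTest U φ) (hUV : U ⊆ V) : IsTest V φ := ⟨h.smooth, h.compact, h.subset.trans hUV⟩

lemma pd (h : IsTest U φ) (i : Fin n) : IsTest U (Plate.pd i φ) :=
  ⟨contDiff_pd h.smooth i, h.compact.fderiv_apply (𝕜 := ℝ) (e i),
    (tsupport_fderiv_apply_subset ℝ (e i)).trans h.subset⟩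

lemma mul_left {a : E n → ℝ} (ha : ContDiff ℝ ∞ a) (h : IsTest U φ) :
    IsTest U (fun x => a x * φ x) :=
  ⟨ha.mul h.smooth, h.compact.mul_left, tsupport_mul_subset_right.trans h.subset⟩

lemma mul_right {a : E n → ℝ} (ha : ContDiff ℝ ∞ a) (h : IsTest U φ) :
    IsTest U (fun x => φ x * a x) :=
  ⟨h.smooth.mul ha, h.compact.mul_right, tsupport_mul_subset_left.trans h.subset⟩

lemma add (h : IsTest U φ) (h' : IsTest U ψ) : IsTest U (fun x => φ x + ψ x) :=
  ⟨h.smooth.add h'.smooth, h.compact.add h'.compact,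
    (tsupport_add φ ψ).trans (Set.union_subset h.subset h'.subset)⟩

lemma zero_off (h : IsTest U φ) {x : E n} (hx : x ∉ U) : φ x = 0 :=
  image_eq_zero_of_notMem_tsupport fun h' => hx (h.subset h')

lemma integrable (h : IsTest U φ) {f : E n → F} {μ : Measure (E n)} (hf : LocallyIntegrable f μ) :
    Integrable (fun x => φ x • f x) μ :=
  hf.integrable_smul_left_of_hasCompactSupport h.continuous h.compact

lemma memLp_smul (h : IsTest U φ) {f : E n → F} {μ : Measure (E n)} {p : ℝ≥0∞}
    (hf : MemLp f p μ) : MemLp (fun x => φ x • f x) p μ :=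
  MemLp.smul (p := ∞) (q := p) (r := p) hf
    (h.continuous.memLp_top_of_hasCompactSupport h.compact μ)

end IsTest

/-- Smooth functions with compact support which form a finite partition of unity on a compact set,
subordinate to a given family of neighbourhoods. -/
lemma exists_cutoffs {K : Set (E n)} (hK : IsCompact K) {W : E n → Set (E n)}
    (hW : ∀ x ∈ K, W x ∈ 𝓝 x) :
    ∃ (s : Finset (E n)) (ζ : E n → E n → ℝ), (∀ x ∈ s, x ∈ K ∧ IsTest (W x) (ζ x)) ∧
      ∀ y ∈ K, ∑ x ∈ s, ζ x y = 1 := by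
  classical
  set W' : E n → Set (E n) := fun x => interior (W x) ∩ Metric.ball x 1
  have hW' : ∀ x ∈ K, W' x ∈ 𝓝 x := fun x hx =>
    inter_mem (interior_mem_nhds.2 (hW x hx)) (Metric.ball_mem_nhds x one_pos)
  obtain ⟨s, hsK, hs⟩ := hK.elim_nhds_subcover W' hW'
  obtain ⟨f, hf⟩ := SmoothPartitionOfUnity.exists_isSubordinate (modelWithCornersSelf ℝ (E n))
    hK.isClosed (fun x : s => W' x) (fun x => isOpen_interior.inter Metric.isOpen_ball)
    (fun y hy => by
      obtain ⟨x, hx, hy'⟩ := Set.mem_iUnion₂.1 (hs hy)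
      exact Set.mem_iUnion.2 ⟨⟨x, hx⟩, hy'⟩)
  refine ⟨s, fun x => if hx : x ∈ s then f ⟨x, hx⟩ else 0, fun x hx => ⟨hsK x hx, ?_⟩,
    fun y hy => ?_⟩
  · have h1 := hf ⟨x, hx⟩
    simp only [hx, dif_pos]
    refine ⟨(f ⟨x, hx⟩).contMDiff.contDiff, ?_, fun y hy => interior_subset (h1 hy).1⟩
    exact HasCompactSupport.of_support_subset_isCompact (isCompact_closedBall x 1)
      ((subset_tsupport _).trans (h1.trans (Set.inter_subset_right.trans Metric.ball_subset_closedBall)))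
  · have h1 := f.sum_eq_one hy
    rw [finsum_eq_sum_of_fintype] at h1
    rw [← h1, ← Finset.sum_coe_sort s]
    refine Finset.sum_congr rfl fun x _ => ?_
    simp [x.2]

/-- A test function which is `1` near a compact set. -/
lemma exists_isTest_eq_one {K : Set (E n)} (hK : IsCompact K) (hU : IsOpen U) (hKU : K ⊆ U) :
    ∃ χ : E n → ℝ, IsTest U χ ∧ (∀ x ∈ K, χ x = 1) := by
  obtain ⟨s, ζ, h1, h2⟩ := exists_cutoffs hK (W := fun _ => U) fun x hx => hU.mem_nhds (hKU hx)
  refine ⟨fun y => ∑ x ∈ s, ζ x y, ?_, h2⟩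
  clear h2
  induction s using Finset.induction_on with
  | empty =>
    simp only [Finset.sum_empty]
    exact ⟨contDiff_const, HasCompactSupport.zero, by simp [tsupport]⟩
  | insert a s ha ih =>
    simp only [Finset.sum_insert ha]
    exact (h1 a (by simp)).2.add (ih fun x hx => h1 x (by simp [hx]))

/-- A test function which is `1` near a point. -/
lemma exists_isTest_eventually_one {x : E n} (hU : U ∈ 𝓝 x) :
    ∃ χ : E n → ℝ, IsTest U χ ∧ ∃ V, IsOpen V ∧ x ∈ V ∧ V ⊆ U ∧ ∀ y ∈ V, χ y = 1 := by
  obtain ⟨r, hr, hrU⟩ := Metric.nhds_basis_closedBall.mem_iff.1 (interior_mem_nhds.2 hU)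
  obtain ⟨χ, h1, h2⟩ := exists_isTest_eq_one (isCompact_closedBall x r) isOpen_interior hrU
  exact ⟨χ, h1.mono interior_subset, Metric.ball x r, Metric.isOpen_ball, Metric.mem_ball_self hr,
    (Metric.ball_subset_closedBall.trans hrU).trans interior_subset,
    fun y hy => h2 y (Metric.ball_subset_closedBall hy)⟩

end Test

/-! ### Weak partial derivatives of functions on `ℝⁿ` -/

/-- `g = ∂ᵢ f` in the open set `U` in the sense of distributions, for functions on all of `ℝⁿ` with
values in a real normed space. -/
def WeakPartialOn {n : ℕ} {F : Type*} [NormedAddCommGroup F] [NormedSpace ℝ F] (U : Set (E n))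
    (i : Fin n) (f g : E n → F) : Prop :=
  ∀ φ, IsTest U φ → ∫ x, pd i φ x • f x = -∫ x, φ x • g x

namespace WeakPartialOn

variable {n : ℕ} {U V : Set (E n)} {F : Type*} [NormedAddCommGroup F] [NormedSpace ℝ F]
  {i j : Fin n} {f g : E n → F}

lemma mono (h : WeakPartialOn U i f g) (hVU : V ⊆ U) : WeakPartialOn V i f g :=
  fun φ hφ => h φ (hφ.mono hVU)

/-- Leibniz rule for the product with a smooth function. -/
lemma smul (hf : LocallyIntegrable f) (hg : LocallyIntegrable g) {a : E n → ℝ}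
    (ha : ContDiff ℝ ∞ a) (h : WeakPartialOn U i f g) (hV : V ∩ tsupport a ⊆ U) :
    WeakPartialOn V i (fun x => a x • f x) (fun x => pd i a x • f x + a x • g x) := by
  intro φ hφ
  have ht : IsTest U (fun x => φ x * a x) :=
    ⟨hφ.smooth.mul ha, hφ.compact.mul_right, fun x hx =>
      hV ⟨hφ.subset (tsupport_mul_subset_left hx), tsupport_mul_subset_right hx⟩⟩
  have h1 := h _ ht
  have e1 : ∀ x, pd i (fun y => φ y * a y) x • f x
      = pd i φ x • a x • f x + φ x • pd i a x • f x := by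
    intro x
    rw [pd_mul hφ.smooth ha]; module
  have i1 : Integrable (fun x => pd i φ x • a x • f x) := by
    simpa only [smul_smul] using ((hφ.pd i).mul_right ha).integrable hf
  have i2 : Integrable (fun x => φ x • pd i a x • f x) := by
    simpa only [smul_smul] using (hφ.mul_right (contDiff_pd ha i)).integrable hf
  have i3 : Integrable (fun x => φ x • a x • g x) := by
    simpa only [smul_smul] using (hφ.mul_right ha).integrable hg
  simp only [e1] at h1
  rw [integral_add i1 i2] at h1
  simp only [smul_add]
  rw [integral_add i2 i3, neg_add, eq_neg_add_iff_add_eq, add_comm, h1]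
  simp only [smul_smul]

lemma sum {ι : Type*} {s : Finset ι} {f g : ι → E n → F} (hf : ∀ k ∈ s, LocallyIntegrable (f k))
    (hg : ∀ k ∈ s, LocallyIntegrable (g k)) (h : ∀ k ∈ s, WeakPartialOn U i (f k) (g k)) :
    WeakPartialOn U i (fun x => ∑ k ∈ s, f k x) (fun x => ∑ k ∈ s, g k x) := by
  intro φ hφ
  simp only [Finset.smul_sum]
  rw [integral_finsetSum _ fun k hk => (hφ.pd i).integrable (hf k hk),
    integral_finsetSum _ fun k hk => hφ.integrable (hg k hk), ← Finset.sum_neg_distrib]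
  exact Finset.sum_congr rfl fun k hk => h k hk φ hφ

/-- Being a weak partial derivative is a local property. -/
lemma of_local (hf : LocallyIntegrable f) (hg : LocallyIntegrable g)
    (h : ∀ x ∈ U, ∃ V ∈ 𝓝 x, WeakPartialOn V i f g) : WeakPartialOn U i f g := by
  intro φ hφ
  choose! V hV hw using h
  obtain ⟨s, ζ, h1, h2⟩ := exists_cutoffs hφ.compact (W := V) fun x hx => hV x (hφ.subset hx)
  have hs : ∀ x ∈ s, ContDiff ℝ ∞ (fun y => ζ x y * φ y) := fun x hx =>
    (h1 x hx).2.smooth.mul hφ.smooth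
  have e1 : φ = fun y => ∑ x ∈ s, ζ x y * φ y := by
    funext y
    rw [← Finset.sum_mul]
    by_cases hy : y ∈ tsupport φ
    · rw [h2 y hy, one_mul]
    · rw [image_eq_zero_of_notMem_tsupport hy, mul_zero]
  have ht : ∀ x ∈ s, IsTest (V x) (fun y => ζ x y * φ y) := fun x hx =>
    (h1 x hx).2.mul_right hφ.smooth
  rw [e1]
  simp only [pd_sum hs, Finset.sum_smul]
  rw [integral_finsetSum _ fun x hx => ((ht x hx).pd i).integrable hf,
    integral_finsetSum _ fun x hx => (ht x hx).integrable hg, ← Finset.sum_neg_distrib]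
  exact Finset.sum_congr rfl fun x hx => hw x (hφ.subset (h1 x hx).1) _ (ht x hx)

lemma ae_unique [CompleteSpace F] (hU : IsOpen U) {g' : E n → F} (hg : LocallyIntegrable g)
    (hg' : LocallyIntegrable g') (h : WeakPartialOn U i f g) (h' : WeakPartialOn U i f g') :
    ∀ᵐ x, x ∈ U → g x = g' x := by
  have := hU.ae_eq_zero_of_integral_contDiff_smul_eq_zero (μ := volume) (f := fun x => g x - g' x)
    ((hg.sub hg').locallyIntegrableOn U) fun φ h1 h2 h3 => by
      have hφ : IsTest U φ := ⟨h1, h2, h3⟩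
      simp only [smul_sub]
      rw [integral_sub (hφ.integrable hg) (hφ.integrable hg'), sub_eq_zero]
      exact neg_injective ((h φ hφ).symm.trans (h' φ hφ))
  filter_upwards [this] with x hx hxU
  exact sub_eq_zero.1 (hx hxU)

/-- Weak second derivatives commute. -/
lemma symm [CompleteSpace F] (hU : IsOpen U) {fi fj fij fji : E n → F}
    (hij : LocallyIntegrable fij) (hji : LocallyIntegrable fji) (hi : WeakPartialOn U i f fi)
    (hj : WeakPartialOn U j f fj) (h1 : WeakPartialOn U j fi fij) (h2 : WeakPartialOn U i fj fji) :
    ∀ᵐ x, x ∈ U → fij x = fji x := by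
  refine ae_unique hU hij hji h1 (f := fi) fun φ hφ => ?_
  have e1 := hi _ (hφ.pd j)
  have e2 := hj _ (hφ.pd i)
  have e3 := h2 _ hφ
  simp only [pd_comm hφ.smooth i j] at e1
  rw [← e3]
  exact neg_injective (e1.symm.trans e2)

end WeakPartialOn


/-! ### Translations of square-integrable functions -/

section Translation

variable {n : ℕ}

/-- The Cauchy-Schwarz inequality for square-integrable real functions. -/
lemma abs_integral_mul_le {α : Type*} [MeasurableSpace α] {μ : Measure α} {f g : α → ℝ}
    (hf : MemLp f 2 μ) (hg : MemLp g 2 μ) :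
    |∫ x, f x * g x ∂μ| ≤ √(∫ x, f x ^ 2 ∂μ) * √(∫ x, g x ^ 2 ∂μ) := by
  have key : ∀ {u v : α → ℝ} (hu : MemLp u 2 μ) (hv : MemLp v 2 μ),
      inner ℝ (hu.toLp u) (hv.toLp v) = ∫ x, u x * v x ∂μ := by
    intro u v hu hv
    rw [L2.inner_def]
    refine integral_congr_ae ?_
    filter_upwards [hu.coeFn_toLp, hv.coeFn_toLp] with x h1 h2
    rw [h1, h2]
    simp [mul_comm]
  have hn : ∀ {u : α → ℝ} (hu : MemLp u 2 μ), ‖hu.toLp u‖ = √(∫ x, u x ^ 2 ∂μ) := by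
    intro u hu
    rw [← Real.sqrt_sq (norm_nonneg _), ← real_inner_self_eq_norm_sq, key]
    simp only [sq]
  rw [← key hf hg, ← hn hf, ← hn hg]
  exact abs_real_inner_le_norm _ _

lemma integrable_mul_of_memLp {α : Type*} [MeasurableSpace α] {μ : Measure α} {f g : α → ℝ}
    (hf : MemLp f 2 μ) (hg : MemLp g 2 μ) : Integrable (fun x => f x * g x) μ :=
  MemLp.integrable_mul hf hg

lemma memLp_comp_add {f : E n → ℝ} (hf : MemLp f 2) (h : E n) :
    MemLp (fun x => f (x + h)) 2 :=
  hf.comp_measurePreserving (measurePreserving_add_right volume h)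

/-- A square-integrable function is bounded in `L²` by its pairings with test functions. -/
lemma integral_sq_le_of_dual {D : E n → ℝ} (hD : MemLp D 2) {C : ℝ} (hC : 0 ≤ C)
    (h : ∀ ψ, IsTest Set.univ ψ → |∫ x, D x * ψ x| ≤ C * √(∫ x, ψ x ^ 2)) :
    ∫ x, D x ^ 2 ≤ C ^ 2 := by
  -- the inequality is a closed condition on `ψ ∈ L²`, so it passes from test functions to `ψ = D`
  have hcl : IsClosed {g : Lp ℝ 2 (volume : Measure (E n)) | |inner ℝ (hD.toLp D) g| ≤ C * ‖g‖} :=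
    isClosed_le (by fun_prop) (by fun_prop)
  have hsub : {f : Lp ℝ 2 (volume : Measure (E n)) |
      ∃ g, f =ᵐ[volume] g ∧ HasCompactSupport g ∧ ContDiff ℝ ∞ g}
      ⊆ {g : Lp ℝ 2 (volume : Measure (E n)) | |inner ℝ (hD.toLp D) g| ≤ C * ‖g‖} := by
    rintro f ⟨g, hfg, hgc, hgs⟩
    have := h g ⟨hgs, hgc, Set.subset_univ _⟩
    have e1 : inner ℝ (hD.toLp D) f = ∫ x, D x * g x := by
      rw [L2.inner_def]
      refine integral_congr_ae ?_
      filter_upwards [hD.coeFn_toLp, hfg] with x h1 h2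
      rw [h1, h2]
      simp [mul_comm]
    have e2 : ‖f‖ = √(∫ x, g x ^ 2) := by
      rw [← Real.sqrt_sq (norm_nonneg f), ← real_inner_self_eq_norm_sq, L2.inner_def]
      congr 1
      refine integral_congr_ae ?_
      filter_upwards [hfg] with x h2
      rw [h2]
      simp [sq]
    simpa only [Set.mem_ofPred_eq, e1, e2] using this
  have hall := hcl.closure_subset_iff.2 hsub
  rw [(Lp.dense_hasCompactSupport_contDiff (by simp)).closure_eq] at hall
  have h1 : |inner ℝ (hD.toLp D) (hD.toLp D)| ≤ C * ‖hD.toLp D‖ := hall (Set.mem_univ _)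
  rw [abs_of_nonneg real_inner_self_nonneg, real_inner_self_eq_norm_sq] at h1
  have h2 : ‖hD.toLp D‖ ≤ C := by
    by_contra! hlt
    nlinarith [norm_nonneg (hD.toLp D)]
  have h3 : ∫ x, D x ^ 2 = ‖hD.toLp D‖ ^ 2 := by
    rw [← real_inner_self_eq_norm_sq, L2.inner_def]
    refine integral_congr_ae ?_
    filter_upwards [hD.coeFn_toLp] with x h1
    rw [h1]
    simp [sq]
  rw [h3]
  exact pow_le_pow_left₀ (norm_nonneg _) h2 2

/-- The reflected translate of a test function. -/
lemma isTest_comp_sub {ψ : E n → ℝ} (h : IsTest Set.univ ψ) (a : E n) :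
    IsTest Set.univ (fun x => ψ (a - x)) := by
  refine ⟨h.smooth.comp (contDiff_const.sub contDiff_id), ?_, Set.subset_univ _⟩
  exact h.compact.comp_homeomorph (Homeomorph.subLeft a)

lemma pd_comp_sub {ψ : E n → ℝ} (h : ContDiff ℝ ∞ ψ) (a : E n) (i : Fin n) (x : E n) :
    pd i (fun x => ψ (a - x)) x = -pd i ψ (a - x) := by
  have h1 : HasFDerivAt (fun x => ψ (a - x)) ((fderiv ℝ ψ (a - x)).comp (-ContinuousLinearMap.id ℝ (E n))) x := by
    have h2 : HasFDerivAt (fun x : E n => a - x) (-ContinuousLinearMap.id ℝ (E n)) x := by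
      simpa using (hasFDerivAt_id x).const_sub a
    exact ((h.differentiable (by simp) (a - x)).hasFDerivAt).comp x h2
  simp only [pd, h1.fderiv]
  simp

/-- Mollification `∫ η(x - y) z(y) dy` by a test function: it is smooth, and its partial derivatives
are the mollifications of the weak ones. -/
lemma mollify {η z zi : E n → ℝ} {i : Fin n} (hη : IsTest Set.univ η) (hz : LocallyIntegrable z)
    (hw : WeakPartialOn Set.univ i z zi) :
    ContDiff ℝ ∞ (fun x => ∫ y, η (x - y) * z y) ∧
      ∀ x, HasFDerivAt (fun x => ∫ y, η (x - y) * z y)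
        (fderiv ℝ (fun x => ∫ y, η (x - y) * z y) x) x ∧
        pd i (fun x => ∫ y, η (x - y) * z y) x = ∫ y, η (x - y) * zi y := by
  have hconv : (fun x => ∫ y, η (x - y) * z y)
      = convolution z η (ContinuousLinearMap.lsmul ℝ ℝ) volume := by
    funext x
    simp [convolution_def, mul_comm]
  have hs : ContDiff ℝ ∞ (fun x => ∫ y, η (x - y) * z y) := by
    rw [hconv]
    exact hη.compact.contDiff_convolution_right _ hz hη.smooth
  refine ⟨hs, fun x => ⟨(hs.differentiable (by simp) x).hasFDerivAt, ?_⟩⟩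
  have h1 := hη.compact.hasFDerivAt_convolution_right (ContinuousLinearMap.lsmul ℝ ℝ) hz
    (hη.smooth.of_le (by simp)) x
  rw [← hconv] at h1
  simp only [pd]
  rw [h1.fderiv, convolution_precompR_apply (ContinuousLinearMap.lsmul ℝ ℝ) hz
    (hη.compact.fderiv (𝕜 := ℝ)) (hη.smooth.continuous_fderiv (by simp))]
  have h2 := hw _ (isTest_comp_sub hη x)
  simp only [pd_comp_sub hη.smooth, smul_eq_mul, neg_mul, integral_neg, neg_inj] at h2
  rw [← h2, convolution_def]
  simp [mul_comm]

/-- Difference quotients in a coordinate direction are bounded in `L²` by the weak derivative. -/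
lemma integral_translate_sub_sq_le {f g : E n → ℝ} (hf : MemLp f 2) (hg : MemLp g 2) {i : Fin n}
    (h : WeakPartialOn Set.univ i f g) (t : ℝ) :
    ∫ x, (f (x + t • e i) - f x) ^ 2 ≤ t ^ 2 * ∫ x, g x ^ 2 := by
  have hfl := hf.locallyIntegrable (by norm_num)
  have hD := (memLp_comp_add hf (t • e i)).sub hf
  have hg0 : 0 ≤ ∫ x, g x ^ 2 := integral_nonneg fun x => sq_nonneg _
  have := integral_sq_le_of_dual hD (C := |t| * √(∫ x, g x ^ 2)) (by positivity) fun ψ hψ => ?_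
  · rw [mul_pow, sq_abs, Real.sq_sqrt hg0] at this
    exact this
  -- write the pairing of a translate of `f` with `ψ` as a value of the mollification `Φ` of `f`
  set η : E n → ℝ := fun x => ψ (-x) with hη_def
  have hη : IsTest Set.univ η := by simpa using isTest_comp_sub hψ 0
  obtain ⟨h1, h2⟩ := mollify hη hfl h
  set Φ := fun x => ∫ y, η (x - y) * f y with hΦ
  have hder : ∀ s : ℝ, HasDerivAt (fun s : ℝ => Φ (s • e i)) (∫ y, η (s • e i - y) * g y) s := by
    intro s
    have h3 : HasDerivAt (fun s : ℝ => s • (e i : E n)) (e i) s := by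
      simpa using (hasDerivAt_id s).smul_const (e i : E n)
    have := ((h2 (s • e i)).1).comp_hasDerivAt s h3
    rw [← (h2 (s • e i)).2]
    exact this
  have hb : ∀ s : ℝ, ‖∫ y, η (s • e i - y) * g y‖ ≤ √(∫ x, g x ^ 2) * √(∫ x, ψ x ^ 2) := by
    intro s
    have h4 : MemLp (fun y => η (s • e i - y)) 2 :=
      (isTest_comp_sub hη _).continuous.memLp_of_hasCompactSupport (isTest_comp_sub hη _).compact
    have h5 := abs_integral_mul_le h4 hg
    have h6 : ∫ x, η (s • e i - x) ^ 2 = ∫ x, ψ x ^ 2 := by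
      rw [← integral_sub_right_eq_self (fun x => ψ x ^ 2) (s • (e i : E n))]
      simp [hη_def]
    rw [h6, mul_comm] at h5
    exact h5
  -- `s ↦ Φ(s eᵢ)` is the pairing of `ψ` with the translates of `f`: apply the mean value inequality
  have hmv := Convex.norm_image_sub_le_of_norm_hasDerivWithin_le
    (f := fun s : ℝ => Φ (s • e i)) (s := Set.univ) (x := 0) (y := t)
    (fun s _ => (hder s).hasDerivWithinAt) (fun s _ => hb s) convex_univ trivial trivial
  have hval : ∀ a : E n, Φ a = ∫ x, f (x + a) * ψ x := by
    intro a
    rw [← integral_sub_right_eq_self (fun x => f (x + a) * ψ x) a]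
    simp [hΦ, hη_def, mul_comm]
  have hi : ∀ {u : E n → ℝ}, MemLp u 2 → Integrable fun x => u x * ψ x := fun hu => by
    simpa [mul_comm] using hψ.integrable (hu.locallyIntegrable (by norm_num))
  have e1 : ∫ x, ((fun x => f (x + t • e i)) - f) x * ψ x = Φ (t • e i) - Φ ((0 : ℝ) • e i) := by
    rw [hval, hval, ← integral_sub (hi (memLp_comp_add hf _)) (hi (memLp_comp_add hf _))]
    refine integral_congr_ae (Eventually.of_forall fun x => ?_)
    simp [sub_mul]
  rw [e1]
  refine hmv.trans (le_of_eq ?_)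
  simp only [sub_zero, Real.norm_eq_abs]
  ring

/-- The Poincaré inequality for functions on `ℝⁿ` which vanish off a ball: a translate by twice the
radius has disjoint support. -/
lemma poincare {R : ℝ} (hR : 0 < R) {f g : E n → ℝ} (hf : MemLp f 2) (hg : MemLp g 2) {i : Fin n}
    (h : WeakPartialOn Set.univ i f g) (h0 : ∀ x, R < ‖x‖ → f x = 0) :
    ∫ x, f x ^ 2 ≤ (3 * R) ^ 2 * ∫ x, g x ^ 2 := by
  refine le_trans ?_ (integral_translate_sub_sq_le hf hg h (3 * R))
  refine integral_mono hf.integrable_sq ((memLp_comp_add hf _).sub hf).integrable_sq fun x => ?_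
  by_cases hx : f x = 0
  · simp only [hx]
    exact (zero_pow two_ne_zero).trans_le (sq_nonneg _)
  · have hxR : ‖x‖ ≤ R := by
      by_contra! hc
      exact hx (h0 x hc)
    have : f (x + (3 * R) • e i) = 0 := by
      refine h0 _ ?_
      have h1 : ‖(3 * R) • (e i : E n)‖ = 3 * R := by
        rw [norm_smul, PiLp.norm_single]
        simp [abs_of_pos hR]
      have h2 := norm_sub_le (x + (3 * R) • (e i : E n)) x
      rw [add_sub_cancel_left, h1] at h2
      linarith
    simp [this]

/-- The correlation of two square-integrable functions is a continuous function of the shift. -/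
lemma continuous_correlation {q z : E n → ℝ} (hq : MemLp q 2) (hz : MemLp z 2) :
    Continuous fun y : E n => ∫ x, q x * z (x - y) := by
  let τ : C(E n, C(E n, E n)) :=
    ContinuousMap.curry ⟨fun p : E n × E n => p.2 - p.1, by fun_prop⟩
  have hm : ∀ y, MeasurePreserving (τ y) (volume : Measure (E n)) volume := fun y =>
    measurePreserving_sub_right volume y
  have h1 : Continuous fun y => Lp.compMeasurePreserving (τ y) (hm y) (hz.toLp z) :=
    continuous_const.compMeasurePreservingLp τ.continuous hm (by simp)
  have h2 : Continuous fun y =>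
      inner ℝ (hq.toLp q) (Lp.compMeasurePreserving (τ y) (hm y) (hz.toLp z)) :=
    continuous_const.inner h1
  refine h2.congr fun y => ?_
  rw [L2.inner_def]
  refine integral_congr_ae ?_
  filter_upwards [hq.coeFn_toLp, Lp.coeFn_compMeasurePreserving (hz.toLp z) (hm y),
    (hm y).quasiMeasurePreserving.ae hz.coeFn_toLp] with x h1 h2 h3
  rw [h1, h2, Function.comp_apply, h3]
  simp [τ, mul_comm]

/-- Pairing with a mollification is the mean, weighted by the kernel, of the pairings with the
translates. -/
lemma integral_mul_mollify {q z η : E n → ℝ} (hq : MemLp q 2) (hz : MemLp z 2)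
    (hη : IsTest Set.univ η) :
    ∫ x, q x * ∫ y, η (x - y) * z y = ∫ y, η y * ∫ x, q x * z (x - y) := by
  have e1 : ∀ x, ∫ y, η (x - y) * z y = ∫ y, η y * z (x - y) := by
    intro x
    rw [← integral_sub_left_eq_self (fun y => η y * z (x - y)) volume x]
    simp
  simp only [e1, ← integral_const_mul]
  rw [integral_integral_swap]
  · refine integral_congr_ae (Eventually.of_forall fun y => ?_)
    refine integral_congr_ae (Eventually.of_forall fun x => ?_)
    simp only
    ring
  · have hzs : AEStronglyMeasurable (fun p : E n × E n => z (p.1 - p.2)) (volume.prod volume) :=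
      hz.1.comp_quasiMeasurePreserving (quasiMeasurePreserving_sub volume volume)
    have hms : AEStronglyMeasurable (fun p : E n × E n => q p.1 * (η p.2 * z (p.1 - p.2)))
        (volume.prod volume) :=
      hq.1.comp_fst.mul ((hη.continuous.aestronglyMeasurable (μ := volume)).comp_snd.mul hzs)
    have hy : ∀ y, MemLp (fun x => z (x - y)) 2 := fun y => by
      simpa [sub_eq_add_neg] using memLp_comp_add hz (-y)
    refine (integrable_prod_iff' hms).2 ⟨Eventually.of_forall fun y => ?_, ?_⟩
    · have := ((hy y).integrable_mul hq).const_mul (η y)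
      refine this.congr (Eventually.of_forall fun x => ?_)
      simp only [Pi.mul_apply]
      ring
    · have hηi : Integrable η := hη.continuous.integrable_of_hasCompactSupport hη.compact
      refine (hηi.norm.mul_const (√(∫ x, q x ^ 2) * √(∫ x, z x ^ 2))).mono'
        (hms.norm.prod_swap.integral_prod_right') (Eventually.of_forall fun y => ?_)
      have h1 := abs_integral_mul_le hq.norm (hy y).norm
      simp only [Real.norm_eq_abs, sq_abs] at h1
      rw [integral_sub_right_eq_self (fun x => z x ^ 2) y] at h1
      have h2 : ∫ x, ‖q x * (η y * z (x - y))‖ = |η y| * ∫ x, |q x| * |z (x - y)| := by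
        rw [← integral_const_mul]
        refine integral_congr_ae (Eventually.of_forall fun x => ?_)
        simp only [norm_mul, Real.norm_eq_abs]
        ring
      rw [h2, norm_mul, Real.norm_eq_abs, Real.norm_eq_abs, abs_abs]
      exact mul_le_mul_of_nonneg_left h1 (abs_nonneg _)

end Translation

/-! ### Testing with functions that vanish outside a domain -/

section TestExtension

variable {n : ℕ}

open scoped Pointwise in
/-- If the support of `z ∈ H¹(ℝⁿ)` can be moved into `Ω` by arbitrarily small shifts, then `z` may
be used as a test function in `Ω`: mollify with a kernel supported off centre. -/
lemma integral_eq_zero_of_push {Ω K : Set (E n)} (hK : IsCompact K)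
    (hpush : ∀ ε > 0, ∃ (p : E n) (δ : ℝ), 0 < δ ∧ Metric.closedBall p δ ⊆ Metric.ball 0 ε ∧
      ∀ x ∈ K, ∀ y ∈ Metric.closedBall p δ, x + y ∈ Ω)
    {q₀ : E n → ℝ} {q : Fin n → E n → ℝ} (hq₀ : MemLp q₀ 2) (hq : ∀ i, MemLp (q i) 2)
    (h : ∀ φ, IsTest Ω φ → ∫ x, (q₀ x * φ x + ∑ i, q i x * pd i φ x) = 0)
    {z : E n → ℝ} {zi : Fin n → E n → ℝ} (hz : MemLp z 2) (hzi : ∀ i, MemLp (zi i) 2)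
    (hw : ∀ i, WeakPartialOn Set.univ i z (zi i)) (h0 : ∀ x ∉ K, z x = 0) :
    ∫ x, (q₀ x * z x + ∑ i, q i x * zi i x) = 0 := by
  -- `c y` is the functional evaluated at the translate of `z` by `y`; the claim is `c 0 = 0`
  set c : E n → ℝ := fun y => (∫ x, q₀ x * z (x - y)) + ∑ i, ∫ x, q i x * zi i (x - y) with hc
  have hcc : Continuous c := (continuous_correlation hq₀ hz).add
    (continuous_finsetSum _ fun i _ => continuous_correlation (hq i) (hzi i))
  have hgoal : ∫ x, (q₀ x * z x + ∑ i, q i x * zi i x) = c 0 := by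
    rw [integral_add (integrable_mul_of_memLp hq₀ hz)
      (integrable_finsetSum _ fun i _ => integrable_mul_of_memLp (hq i) (hzi i)),
      integral_finsetSum _ fun i _ => integrable_mul_of_memLp (hq i) (hzi i)]
    simp [hc]
  rw [hgoal]
  have hsmall : ∀ α > 0, |c 0| ≤ α := by
    intro α hα
    obtain ⟨ε, hε, hcε⟩ := Metric.continuous_iff.1 hcc 0 α hα
    obtain ⟨p, δ, hδ, hball, hKΩ⟩ := hpush ε hε
    -- the kernel `η` has mass one and lives near the small shift `p`
    let b : ContDiffBump p := ⟨δ / 2, δ, by positivity, by linarith⟩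
    set η : E n → ℝ := b.normed volume with hη_def
    have hη : IsTest Set.univ η := ⟨b.contDiff_normed, b.hasCompactSupport_normed, Set.subset_univ _⟩
    have hηs : ∀ y, η y ≠ 0 → y ∈ Metric.closedBall p δ := by
      intro y hy
      have : y ∈ Function.support (b.normed volume) := hy
      rw [b.support_normed_eq] at this
      exact Metric.ball_subset_closedBall this
    have hη1 : ∫ y, η y = 1 := b.integral_normed
    have hη0 : ∀ y, 0 ≤ η y := b.nonneg_normed
    set φ : E n → ℝ := fun x => ∫ y, η (x - y) * z y with hφ_def
    have hzl := hz.locallyIntegrable (μ := volume) (by norm_num)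
    have hcont : ContDiff ℝ ∞ φ := by
      have hconv : φ = convolution z η (ContinuousLinearMap.lsmul ℝ ℝ) volume := by
        funext x
        simp [hφ_def, convolution_def, mul_comm]
      rw [hconv]
      exact hη.compact.contDiff_convolution_right _ hzl hη.smooth
    have hpd : ∀ i x, pd i φ x = ∫ y, η (x - y) * zi i y := fun i x =>
      ((mollify hη hzl (hw i)).2 x).2
    have hKc : IsCompact (K + Metric.closedBall p δ) := hK.add (isCompact_closedBall p δ)
    have hsupp : Function.support φ ⊆ K + Metric.closedBall p δ := by
      intro x hx
      by_contra hcon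
      refine hx (integral_eq_zero_of_ae (Eventually.of_forall fun y => ?_))
      by_cases hy : y ∈ K
      · have : η (x - y) = 0 := by
          by_contra hne
          exact hcon ⟨y, hy, x - y, hηs _ hne, by simp⟩
        simp [this]
      · simp [h0 y hy]
    -- the mollification of `z` is admissible since its support lies in `Ω`
    have htest : IsTest Ω φ := by
      refine ⟨hcont, HasCompactSupport.of_support_subset_isCompact hKc hsupp, ?_⟩
      refine (closure_minimal hsupp hKc.isClosed).trans ?_
      rintro _ ⟨x, hx, y, hy, rfl⟩
      exact hKΩ x hx y hy
    have hφ2 : MemLp φ 2 := htest.continuous.memLp_of_hasCompactSupport htest.compact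
    have hφi2 : ∀ i, MemLp (pd i φ) 2 := fun i =>
      (htest.pd i).continuous.memLp_of_hasCompactSupport (htest.pd i).compact
    have h1 := h φ htest
    rw [integral_add (integrable_mul_of_memLp hq₀ hφ2)
      (integrable_finsetSum _ fun i _ => integrable_mul_of_memLp (hq i) (hφi2 i)),
      integral_finsetSum _ fun i _ => integrable_mul_of_memLp (hq i) (hφi2 i)] at h1
    simp only [hpd] at h1
    rw [hφ_def, integral_mul_mollify hq₀ hz hη,
      Finset.sum_congr rfl fun i _ => integral_mul_mollify (hq i) (hzi i) hη] at h1
    have hηi : ∀ {u : E n → ℝ}, Continuous u → Integrable fun y => η y * u y := fun hu =>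
      hη.integrable hu.locallyIntegrable
    have h2 : ∫ y, η y * c y = 0 := by
      simp only [hc, mul_add, Finset.mul_sum]
      rw [integral_add (hηi (continuous_correlation hq₀ hz)) (integrable_finsetSum _ fun i _ =>
        hηi (continuous_correlation (hq i) (hzi i))), integral_finsetSum _ fun i _ =>
        hηi (continuous_correlation (hq i) (hzi i)), h1]
    -- hence the `η`-mean of `c` vanishes, while `c` is close to `c 0` on the support of `η`
    have h3 : c 0 = ∫ y, η y * (c 0 - c y) := by
      simp only [mul_sub]
      rw [integral_sub (hηi continuous_const) (hηi hcc), h2, integral_mul_const, hη1]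
      ring
    have h4 : ∀ y, ‖η y * (c 0 - c y)‖ ≤ η y * α := by
      intro y
      rw [norm_mul, Real.norm_of_nonneg (hη0 y)]
      by_cases hy : η y = 0
      · simp [hy]
      · refine mul_le_mul_of_nonneg_left ?_ (hη0 y)
        have := hcε y (by simpa using hball (hηs y hy))
        rw [dist_comm, dist_eq_norm] at this
        exact this.le
    rw [h3, ← Real.norm_eq_abs]
    refine (norm_integral_le_of_norm_le (hηi continuous_const) (Eventually.of_forall h4)).trans ?_
    rw [integral_mul_const, hη1, one_mul]
  exact abs_eq_zero.1 (le_antisymm (le_of_forall_pos_le_add fun α hα => by simpa using hsmall α hα)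
    (abs_nonneg _))

lemma gradient_inner_eq {ρ : E n → ℝ} (x v : E n) :
    inner ℝ (gradient ρ x) v = fderiv ℝ ρ x v := by
  simp [gradient]

/-- Near every point of its closure a domain with smooth boundary can be moved into itself by
arbitrarily small shifts. -/
lemma exists_push {Ω : Set (E n)} (hΩ : IsOpen Ω) (hs : HasSmoothBoundary Ω) {x₀ : E n}
    (hx₀ : x₀ ∈ closure Ω) :
    ∃ V ∈ 𝓝 x₀, ∀ ε > 0, ∃ (p : E n) (δ : ℝ), 0 < δ ∧ Metric.closedBall p δ ⊆ Metric.ball 0 ε ∧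
      ∀ x ∈ closure Ω ∩ V, ∀ y ∈ Metric.closedBall p δ, x + y ∈ Ω := by
  by_cases hin : x₀ ∈ Ω
  · obtain ⟨r, hr, hrΩ⟩ := Metric.isOpen_iff.1 hΩ x₀ hin
    refine ⟨Metric.ball x₀ (r / 2), Metric.ball_mem_nhds _ (by positivity), fun ε hε =>
      ⟨0, min (r / 4) (ε / 2), by positivity, ?_, fun x hx y hy => hrΩ ?_⟩⟩
    · exact Metric.closedBall_subset_ball (by have := min_le_right (r / 4) (ε / 2); linarith)
    · rw [mem_closedBall_zero_iff] at hy
      have h1 := hx.2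
      rw [mem_ball_iff_norm] at h1 ⊢
      have h2 : x + y - x₀ = (x - x₀) + y := by abel
      have := norm_add_le (x - x₀) y
      have := min_le_left (r / 4) (ε / 2)
      rw [h2]; linarith
  · obtain ⟨ρ, hρ, hρ0, hgrad, hev⟩ := hs x₀ (by rw [hΩ.frontier_eq]; exact ⟨hx₀, hin⟩)
    -- `ρ` decreases in all directions close to `-∇ρ(x₀)`, at all points close to `x₀`
    set p : E n := -gradient ρ x₀ with hp
    have hcont : Continuous fun w : E n × E n => fderiv ℝ ρ w.1 w.2 :=
      ((hρ.continuous_fderiv (by simp)).comp continuous_fst).clm_apply continuous_snd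
    have hneg : fderiv ℝ ρ x₀ p < 0 := by
      rw [← gradient_inner_eq, hp, inner_neg_right, real_inner_self_eq_norm_sq]
      have := norm_pos_iff.2 hgrad
      simp only [Left.neg_neg_iff]; positivity
    have hnear : ∀ᶠ w : E n × E n in 𝓝 (x₀, p), fderiv ℝ ρ w.1 w.2 < 0 :=
      hcont.continuousAt.eventually_lt continuousAt_const hneg
    rw [nhds_prod_eq] at hnear
    obtain ⟨r₁, hr₁, r₂, hr₂, hr⟩ : ∃ r₁ > 0, ∃ r₂ > 0, ∀ x ∈ Metric.ball x₀ r₁,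
        ∀ v ∈ Metric.ball p r₂, fderiv ℝ ρ x v < 0 := by
      obtain ⟨pa, hpa, pb, hpb, hab⟩ := eventually_prod_iff.1 hnear
      obtain ⟨r₁, hr₁, h1⟩ := Metric.eventually_nhds_iff_ball.1 hpa
      obtain ⟨r₂, hr₂, h2⟩ := Metric.eventually_nhds_iff_ball.1 hpb
      exact ⟨r₁, hr₁, r₂, hr₂, fun x hx v hv => hab (h1 x hx) (h2 v hv)⟩
    obtain ⟨r₃, hr₃, hr₃Ω⟩ := Metric.eventually_nhds_iff_ball.1 hev
    set r := min r₁ r₃ with hr_def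
    have hrpos : 0 < r := lt_min hr₁ hr₃
    refine ⟨Metric.ball x₀ (r / 2), Metric.ball_mem_nhds _ (by positivity), fun ε hε => ?_⟩
    set L := ‖p‖ + r₂ with hL
    have hLpos : 0 < L := by positivity
    -- `s` is so small that shifts by `s v`, `|v| < L`, are shorter than `ε` and stay in the ball
    set s := min (r / 2) ε / (2 * L) with hs_def
    have hspos : 0 < s := by positivity
    have hsL : s * L < min (r / 2) ε := by
      have h5 : 0 < min (r / 2) ε := by positivity
      have : s * L = min (r / 2) ε / 2 := by rw [hs_def]; field_simp
      linarith
    have hv : ∀ y ∈ Metric.closedBall (s • p) (s * (r₂ / 2)),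
        s⁻¹ • y ∈ Metric.ball p r₂ ∧ ‖y‖ < min (r / 2) ε := by
      intro y hy
      rw [mem_closedBall_iff_norm] at hy
      constructor
      · rw [mem_ball_iff_norm]
        have h6 : s⁻¹ • y - p = s⁻¹ • (y - s • p) := by
          rw [smul_sub, smul_smul, inv_mul_cancel₀ hspos.ne', one_smul]
        rw [h6, norm_smul, norm_inv, Real.norm_of_nonneg hspos.le]
        calc s⁻¹ * ‖y - s • p‖ ≤ s⁻¹ * (s * (r₂ / 2)) := by gcongr
          _ = r₂ / 2 := by field_simp
          _ < r₂ := by linarith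
      · have h7 : ‖y‖ ≤ ‖y - s • p‖ + ‖s • p‖ := by
          simpa using norm_add_le (y - s • p) (s • p)
        rw [norm_smul, Real.norm_of_nonneg hspos.le] at h7
        have : s * (r₂ / 2) ≤ s * r₂ := by gcongr; linarith
        have h8 : s * L = s * ‖p‖ + s * r₂ := by rw [hL]; ring
        linarith
    refine ⟨s • p, s * (r₂ / 2), by positivity, fun y hy => ?_, fun x hx y hy => ?_⟩
    · rw [mem_ball_zero_iff]
      exact (hv y hy).2.trans_le (min_le_right _ _)
    obtain ⟨hv1, hv2⟩ := hv y hy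
    have hyr : ‖y‖ < r / 2 := hv2.trans_le (min_le_left _ _)
    have hseg : ∀ t ∈ Set.Icc (0 : ℝ) 1, x + t • y ∈ Metric.ball x₀ r := by
      intro t ht
      have h9 := hx.2
      rw [mem_ball_iff_norm] at h9 ⊢
      have h10 : x + t • y - x₀ = (x - x₀) + t • y := by abel
      have h11 := norm_add_le (x - x₀) (t • y)
      rw [norm_smul, Real.norm_of_nonneg ht.1] at h11
      have h12 : t * ‖y‖ ≤ ‖y‖ := mul_le_of_le_one_left (norm_nonneg _) ht.2
      rw [h10]; linarith
    have hx1 : x + y ∈ Metric.ball x₀ r := by simpa using hseg 1 (by simp)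
    have hx0 : x ∈ Metric.ball x₀ r := by simpa using hseg 0 (by simp)
    rw [hr₃Ω _ (Metric.ball_subset_ball (min_le_right _ _) hx1)]
    -- now `ρ ≤ 0` at the start of the segment from `x` to `x + y`, and `ρ` decreases along it
    have hle : ρ x ≤ 0 := by
      have hxc : x ∈ closure (Ω ∩ Metric.ball x₀ r) :=
        Set.inter_comm Ω _ ▸ Metric.isOpen_ball.inter_closure ⟨hx0, hx.1⟩
      refine closure_minimal (fun w hw => ?_) (isClosed_le hρ.continuous continuous_const) hxc
      exact ((hr₃Ω w (Metric.ball_subset_ball (min_le_right _ _) hw.2)).1 hw.1).le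
    refine lt_of_lt_of_le ?_ hle
    have hderiv : ∀ t : ℝ, HasDerivAt (fun t : ℝ => ρ (x + t • y)) (fderiv ℝ ρ (x + t • y) y) t := by
      intro t
      have h13 : HasDerivAt (fun t : ℝ => x + t • y) y t := by
        simpa using ((hasDerivAt_id t).smul_const y).const_add x
      exact ((hρ.differentiable (by simp) _).hasFDerivAt).comp_hasDerivAt t h13
    have hanti : StrictAntiOn (fun t : ℝ => ρ (x + t • y)) (Set.Icc 0 1) := by
      refine strictAntiOn_of_deriv_neg (convex_Icc 0 1)
        (fun t _ => (hderiv t).continuousAt.continuousWithinAt) fun t ht => ?_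
      rw [interior_Icc] at ht
      rw [(hderiv t).deriv]
      have h14 := hr _ (Metric.ball_subset_ball (min_le_left _ _) (hseg t ⟨ht.1.le, ht.2.le⟩)) _ hv1
      rw [map_smul, smul_eq_mul] at h14
      exact (pos_iff_neg_of_mul_neg h14).1 (by positivity)
    simpa using hanti (by simp : (0 : ℝ) ∈ Set.Icc 0 1) (by simp : (1 : ℝ) ∈ Set.Icc 0 1) one_pos

/-- Functions of `H¹(ℝⁿ)` which vanish outside a bounded domain with smooth boundary may be used as
test functions in the domain. -/
lemma integral_eq_zero_of_test {Ω : Set (E n)} (hΩ : IsOpen Ω) (hb : Bornology.IsBounded Ω)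
    (hs : HasSmoothBoundary Ω) {q₀ : E n → ℝ} {q : Fin n → E n → ℝ} (hq₀ : MemLp q₀ 2)
    (hq : ∀ i, MemLp (q i) 2)
    (h : ∀ φ, IsTest Ω φ → ∫ x, (q₀ x * φ x + ∑ i, q i x * pd i φ x) = 0)
    {z : E n → ℝ} {zi : Fin n → E n → ℝ} (hz : MemLp z 2) (hzi : ∀ i, MemLp (zi i) 2)
    (hw : ∀ i, WeakPartialOn Set.univ i z (zi i)) (h0 : ∀ x ∉ Ω, z x = 0) :
    ∫ x, (q₀ x * z x + ∑ i, q i x * zi i x) = 0 := by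
  have hΩc : IsCompact (closure Ω) := hb.isCompact_closure
  have hzl := hz.locallyIntegrable (μ := volume) (by norm_num)
  have hzil := fun i => (hzi i).locallyIntegrable (μ := volume) (by norm_num)
  have hpush := fun x₀ (hx₀ : x₀ ∈ closure Ω) => exists_push hΩ hs hx₀
  choose! V hV hVp using hpush
  obtain ⟨s, ζ, h1, h2⟩ := exists_cutoffs hΩc hV
  -- each localized piece `ζ z` can be pushed into `Ω`
  have hpart : ∀ x ∈ s, ∫ y, (q₀ y * (ζ x y * z y)
      + ∑ i, q i y * (pd i (ζ x) y * z y + ζ x y * zi i y)) = 0 := by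
    intro x hx
    obtain ⟨hxΩ, hζ⟩ := h1 x hx
    refine integral_eq_zero_of_push (K := closure Ω ∩ tsupport (ζ x)) (hΩc.inter_right
      (isClosed_tsupport _)) (fun ε hε => ?_) hq₀ hq h (hζ.memLp_smul hz)
      (fun i => ((hζ.pd i).memLp_smul hz).add (hζ.memLp_smul (hzi i)))
      (fun i => (hw i).smul hzl (hzil i) hζ.smooth (Set.subset_univ _)) (fun y hy => ?_)
    · obtain ⟨p, δ, h3, h4, h5⟩ := hVp x hxΩ ε hε
      exact ⟨p, δ, h3, h4, fun y hy => h5 y ⟨hy.1, hζ.subset hy.2⟩⟩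
    · by_cases hyt : y ∈ tsupport (ζ x)
      · have : y ∉ Ω := fun hyΩ => hy ⟨subset_closure hyΩ, hyt⟩
        simp [h0 y this]
      · simp [image_eq_zero_of_notMem_tsupport hyt]
  -- summing over the partition of unity gives `Z ∈ H¹(ℝⁿ)` equal to `z`
  have hsumz : ∀ y, ∑ x ∈ s, ζ x y * z y = z y := by
    intro y
    rw [← Finset.sum_mul]
    by_cases hy : y ∈ Ω
    · rw [h2 y (subset_closure hy), one_mul]
    · rw [h0 y hy, mul_zero]
  have hloc1 : ∀ x ∈ s, LocallyIntegrable (fun y => ζ x y • z y) := fun x hx =>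
    ((h1 x hx).2.memLp_smul hz).locallyIntegrable (by norm_num)
  have hmem2 : ∀ x ∈ s, ∀ i, MemLp (fun y => pd i (ζ x) y • z y + ζ x y • zi i y) 2 :=
    fun x hx i => (((h1 x hx).2.pd i).memLp_smul hz).add ((h1 x hx).2.memLp_smul (hzi i))
  have hsumw : ∀ i, WeakPartialOn Set.univ i (fun y => ∑ x ∈ s, ζ x y • z y)
      (fun y => ∑ x ∈ s, (pd i (ζ x) y • z y + ζ x y • zi i y)) := fun i =>
    WeakPartialOn.sum hloc1 (fun x hx => (hmem2 x hx i).locallyIntegrable (by norm_num))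
      fun x hx => (hw i).smul hzl (hzil i) (h1 x hx).2.smooth (Set.subset_univ _)
  have hae : ∀ i, ∀ᵐ y, zi i y = ∑ x ∈ s, (pd i (ζ x) y * z y + ζ x y * zi i y) := by
    intro i
    have h3 := hsumw i
    simp only [smul_eq_mul, hsumz] at h3
    filter_upwards [(hw i).ae_unique isOpen_univ (hzil i) ((memLp_finsetSum s fun x hx =>
      hmem2 x hx i).locallyIntegrable (by norm_num)) h3] with y hy
    exact hy trivial
  have hfin : ∫ y, ∑ x ∈ s, (q₀ y * (ζ x y * z y)
      + ∑ i, q i y * (pd i (ζ x) y * z y + ζ x y * zi i y)) = 0 := by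
    rw [integral_finsetSum, Finset.sum_eq_zero hpart]
    exact fun x hx => (hq₀.integrable_mul ((h1 x hx).2.memLp_smul hz)).add
      (integrable_finsetSum _ fun i _ => (hq i).integrable_mul (hmem2 x hx i))
  rw [← hfin]
  refine integral_congr_ae ?_
  filter_upwards [ae_all_iff.2 hae] with y hy
  rw [Finset.sum_add_distrib, ← Finset.mul_sum, hsumz, Finset.sum_comm]
  simp only [← Finset.mul_sum, ← hy]

end TestExtension


/-! ### Tangential estimates -/

/-- Real functions `u`, `v i = ∂ᵢ u`, `w i j = ∂ⱼ ∂ᵢ u` in `L²(ℝⁿ)`, all zero outside `Ω`, such that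
`u ∈ H²(Ω)` and the extension of `u` by zero is in `H¹(ℝⁿ)`: a function of `H²(Ω) ∩ H¹₀(Ω)`. -/
structure IsDirichletH2 {n : ℕ} (Ω : Set (E n)) (u : E n → ℝ) (v : Fin n → E n → ℝ)
    (w : Fin n → Fin n → E n → ℝ) : Prop where
  memU : MemLp u 2
  memV : ∀ i, MemLp (v i) 2
  memW : ∀ i j, MemLp (w i j) 2
  zeroU : ∀ x ∉ Ω, u x = 0
  zeroV : ∀ i, ∀ x ∉ Ω, v i x = 0
  zeroW : ∀ i j, ∀ x ∉ Ω, w i j x = 0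
  partialU : ∀ i, WeakPartialOn Set.univ i u (v i)
  partialV : ∀ i j, WeakPartialOn Ω j (v i) (w i j)

section Tangential

variable {n : ℕ} {Ω : Set (E n)} {u : E n → ℝ} {v : Fin n → E n → ℝ}
  {w : Fin n → Fin n → E n → ℝ}

namespace IsDirichletH2

lemma locU (h : IsDirichletH2 Ω u v w) : LocallyIntegrable u :=
  h.memU.locallyIntegrable (by norm_num)

lemma locV (h : IsDirichletH2 Ω u v w) (i : Fin n) : LocallyIntegrable (v i) :=
  (h.memV i).locallyIntegrable (by norm_num)

lemma locW (h : IsDirichletH2 Ω u v w) (i j : Fin n) : LocallyIntegrable (w i j) :=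
  (h.memW i j).locallyIntegrable (by norm_num)

lemma symm (h : IsDirichletH2 Ω u v w) (hΩ : IsOpen Ω) (i j : Fin n) :
    ∀ᵐ x, w i j x = w j i x := by
  filter_upwards [WeakPartialOn.symm hΩ (h.locW i j) (h.locW j i)
    ((h.partialU i).mono (Set.subset_univ _)) ((h.partialU j).mono (Set.subset_univ _))
    (h.partialV i j) (h.partialV j i)] with x hx
  by_cases hxΩ : x ∈ Ω
  · exact hx hxΩ
  · rw [h.zeroW i j x hxΩ, h.zeroW j i x hxΩ]

lemma memLap (h : IsDirichletH2 Ω u v w) : MemLp (fun x => ∑ k, w k k x) 2 :=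
  memLp_finsetSum _ fun k _ => h.memW k k

lemma integrable_lower (h : IsDirichletH2 Ω u v w) :
    Integrable (fun x => ∑ k, v k x ^ 2 + (∑ k, w k k x) ^ 2) :=
  (integrable_finsetSum _ fun k _ => (h.memV k).integrable_sq).add h.memLap.integrable_sq

end IsDirichletH2

/-- The commutator of a vector field with the Laplacian, in weak form: for `z = a · ∇u` the
functional `φ ↦ ∫ ∇z · ∇φ` only involves first derivatives of `u`, the Laplacian of `u` and first
derivatives of `φ`. -/
lemma tangential_identity (h : IsDirichletH2 Ω u v w) (hΩ : IsOpen Ω) {a : Fin n → E n → ℝ}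
    (ha : ∀ l, ContDiff ℝ ∞ (a l)) {φ : E n → ℝ} (hφ : IsTest Ω φ) :
    ∫ x, ∑ i, ((∑ l, (pd i (a l) x * v l x + a l x * w l i x))
      - ((∑ l, (pd i (a l) x * v l x - pd l (a l) x * v i x + pd l (a i) x * v l x))
        + a i x * ∑ k, w k k x)) * pd i φ x = 0 := by
  have ht1 : ∀ i j, IsTest Ω (fun x => a j x * pd i φ x) := fun i j => (hφ.pd i).mul_left (ha j)
  have hA : ∀ i j, Integrable (fun x => pd j (fun y => a j y * pd i φ y) x • v i x
      + (a j x * pd i φ x) • w i j x) := fun i j =>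
    (((ht1 i j).pd j).integrable (h.locV i)).add ((ht1 i j).integrable (h.locW i j))
  have hB : ∀ i j, Integrable (fun x => pd i (fun y => a j y * pd j φ y) x • v i x
      + (a j x * pd j φ x) • w i i x) := fun i j =>
    (((ht1 j j).pd i).integrable (h.locV i)).add ((ht1 j j).integrable (h.locW i i))
  -- test `∂ⱼ(∂ᵢu)` with `aⱼ ∂ᵢφ`, and below `∂ᵢ(∂ᵢu)` with `aⱼ ∂ⱼφ`; in the difference the second
  -- derivatives of `φ` cancel
  have hA0 : ∀ i j, ∫ x, (pd j (fun y => a j y * pd i φ y) x • v i x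
      + (a j x * pd i φ x) • w i j x) = 0 := fun i j => by
    rw [integral_add (((ht1 i j).pd j).integrable (h.locV i))
      ((ht1 i j).integrable (h.locW i j)), h.partialV i j _ (ht1 i j), neg_add_cancel]
  have hB0 : ∀ i j, ∫ x, (pd i (fun y => a j y * pd j φ y) x • v i x
      + (a j x * pd j φ x) • w i i x) = 0 := fun i j => by
    rw [integral_add (((ht1 j j).pd i).integrable (h.locV i))
      ((ht1 j j).integrable (h.locW i i)), h.partialV i i _ (ht1 j j), neg_add_cancel]
  have hAB : ∫ x, ((∑ i, ∑ j, (pd j (fun y => a j y * pd i φ y) x • v i x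
      + (a j x * pd i φ x) • w i j x)) - ∑ i, ∑ j, (pd i (fun y => a j y * pd j φ y) x • v i x
      + (a j x * pd j φ x) • w i i x)) = 0 := by
    rw [integral_sub (integrable_finsetSum _ fun i _ => integrable_finsetSum _ fun j _ => hA i j)
      (integrable_finsetSum _ fun i _ => integrable_finsetSum _ fun j _ => hB i j),
      integral_finsetSum _ fun i _ => integrable_finsetSum _ fun j _ => hA i j,
      integral_finsetSum _ fun i _ => integrable_finsetSum _ fun j _ => hB i j]
    simp only [integral_finsetSum _ fun j _ => hA _ j, integral_finsetSum _ fun j _ => hB _ j, hA0,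
      hB0, Finset.sum_const_zero, sub_zero]
  rw [← hAB]
  refine integral_congr_ae ?_
  filter_upwards [ae_all_iff.2 fun i => ae_all_iff.2 fun j => h.symm hΩ i j] with x hx
  simp only [pd_mul (ha _) (contDiff_pd hφ.smooth _), smul_eq_mul]
  have e1 : ∑ i, ∑ j, (pd i (a j) x * pd j φ x * v i x)
      = ∑ i, ∑ j, (pd j (a i) x * pd i φ x * v j x) := Finset.sum_comm
  have e2 : ∑ i, ∑ j, a j x * pd j φ x * w i i x = ∑ i, ∑ j, a i x * pd i φ x * w j j x :=
    Finset.sum_comm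
  have e3 : ∑ i, ∑ j, ((pd i (a j) x * pd j φ x + a j x * pd i (pd j φ) x) * v i x
      + a j x * pd j φ x * w i i x) = ∑ i, ∑ j, (pd j (a i) x * pd i φ x * v j x
      + a j x * pd j (pd i φ) x * v i x + a i x * pd i φ x * w j j x) := by
    simp only [Finset.sum_add_distrib, add_mul, e1, e2]
    simp only [pd_comm hφ.smooth]
  rw [e3, ← Finset.sum_sub_distrib]
  refine Finset.sum_congr rfl fun i _ => ?_
  rw [← Finset.sum_sub_distrib, Finset.mul_sum, ← Finset.sum_add_distrib, ← Finset.sum_sub_distrib,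
    Finset.sum_mul]
  refine Finset.sum_congr rfl fun j _ => ?_
  rw [hx j i]
  ring

/-- If the tangential derivative `a · ∇u` is again in `H¹₀(Ω)`, then its gradient is bounded by the
gradient and the Laplacian of `u`. -/
lemma exists_tangential_bound (hΩ : IsOpen Ω) (hb : Bornology.IsBounded Ω)
    (hs : HasSmoothBoundary Ω) {a : Fin n → E n → ℝ} (ha : ∀ l, IsTest Set.univ (a l)) :
    ∃ C, 0 ≤ C ∧ ∀ (u : E n → ℝ) (v : Fin n → E n → ℝ) (w : Fin n → Fin n → E n → ℝ),
      IsDirichletH2 Ω u v w →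
      (∀ i, WeakPartialOn Set.univ i (fun x => ∑ l, a l x * v l x)
        (fun x => ∑ l, (pd i (a l) x * v l x + a l x * w l i x))) →
      ∀ i, ∫ x, (∑ l, a l x * w l i x) ^ 2 ≤ C * ∫ x, (∑ k, v k x ^ 2 + (∑ k, w k k x) ^ 2) := by
  have hbd : ∀ l, ∃ M, ∀ x, ‖a l x‖ ≤ M := fun l =>
    (ha l).continuous.bounded_above_of_compact_support (ha l).compact
  have hbd' : ∀ i l, ∃ M, ∀ x, ‖pd i (a l) x‖ ≤ M := fun i l =>
    ((ha l).pd i).continuous.bounded_above_of_compact_support ((ha l).pd i).compact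
  choose M₁ hM₁ using hbd
  choose M₂ hM₂ using hbd'
  set M := ∑ l, |M₁ l| + ∑ i, ∑ l, |M₂ i l| with hM
  have hM0 : 0 ≤ M := by positivity
  have ba : ∀ l x, |a l x| ≤ M := fun l x => by
    refine ((hM₁ l x).trans (le_abs_self _)).trans ?_
    have h1 := Finset.single_le_sum (f := fun l => |M₁ l|) (fun _ _ => abs_nonneg _)
      (Finset.mem_univ l)
    have h2 : 0 ≤ ∑ i, ∑ l, |M₂ i l| := by positivity
    linarith
  have bd : ∀ i l x, |pd i (a l) x| ≤ M := fun i l x => by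
    refine ((hM₂ i l x).trans (le_abs_self _)).trans ?_
    have h1 := Finset.single_le_sum (f := fun l => |M₂ i l|) (fun _ _ => abs_nonneg _)
      (Finset.mem_univ l)
    have h3 := Finset.single_le_sum (f := fun i => ∑ l, |M₂ i l|) (fun _ _ => by positivity)
      (Finset.mem_univ i)
    have h2 : 0 ≤ ∑ l, |M₁ l| := by positivity
    linarith
  refine ⟨2 * (n * ((3 * n + 1) * M) ^ 2) + 2 * (n * M) ^ 2, by positivity,
    fun u v w h hw i₀ => ?_⟩
  set f : E n → ℝ := fun x => ∑ k, w k k x with hf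
  set L : E n → ℝ := fun x => ∑ k, v k x ^ 2 + f x ^ 2 with hL
  have hLi : Integrable L := h.integrable_lower
  have hL0 : ∀ x, 0 ≤ L x := fun x => by simp only [hL]; positivity
  have hvL : ∀ k x, |v k x| ≤ √(L x) := fun k x => Real.abs_le_sqrt (by
    have := Finset.single_le_sum (f := fun k => v k x ^ 2) (fun _ _ => sq_nonneg _)
      (Finset.mem_univ k)
    simp only [hL]; nlinarith [sq_nonneg (f x)])
  have hfL : ∀ x, |f x| ≤ √(L x) := fun x => Real.abs_le_sqrt (by
    have : 0 ≤ ∑ k, v k x ^ 2 := by positivity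
    simp only [hL]; linarith)
  -- `zᵢ = ∂ᵢ(a · ∇u)`, and `Q` collects the lower order terms of the commutator identity
  set z : Fin n → E n → ℝ := fun i x => ∑ l, (pd i (a l) x * v l x + a l x * w l i x) with hz
  set Q : Fin n → E n → ℝ := fun i x =>
    (∑ l, (pd i (a l) x * v l x - pd l (a l) x * v i x + pd l (a i) x * v l x)) + a i x * f x
    with hQ
  have hm : ∀ {b g : E n → ℝ}, IsTest Set.univ b → MemLp g 2 → MemLp (fun x => b x * g x) 2 :=
    fun hb hg => hb.memLp_smul hg
  have hz2 : ∀ i, MemLp (z i) 2 := fun i => memLp_finsetSum _ fun l _ =>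
    (hm ((ha l).pd i) (h.memV l)).add (hm (ha l) (h.memW l i))
  have hQ2 : ∀ i, MemLp (Q i) 2 := fun i => (memLp_finsetSum _ fun l _ =>
    ((hm ((ha l).pd i) (h.memV l)).sub (hm ((ha l).pd l) (h.memV i))).add
      (hm ((ha i).pd l) (h.memV l))).add (hm (ha i) h.memLap)
  have hbv : ∀ {b : ℝ} k x, |b| ≤ M → |b * v k x| ≤ M * √(L x) := fun k x hb => by
    rw [abs_mul]; exact mul_le_mul hb (hvL k x) (abs_nonneg _) hM0
  have hQb : ∀ i x, Q i x ^ 2 ≤ ((3 * n + 1) * M) ^ 2 * L x := by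
    intro i x
    have h1 : |Q i x| ≤ (3 * n + 1) * M * √(L x) := by
      have h2 : |∑ l, (pd i (a l) x * v l x - pd l (a l) x * v i x + pd l (a i) x * v l x)|
          ≤ ∑ _l : Fin n, 3 * (M * √(L x)) := by
        refine (Finset.abs_sum_le_sum_abs _ _).trans (Finset.sum_le_sum fun l _ => ?_)
        have b1 := hbv l x (bd i l x)
        have b2 := hbv i x (bd l l x)
        have b3 := hbv l x (bd l i x)
        rw [abs_le] at *
        constructor <;> linarith
      have h3 : |a i x * f x| ≤ M * √(L x) := by
        rw [abs_mul]; exact mul_le_mul (ba i x) (hfL x) (abs_nonneg _) hM0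
      have h4 := abs_add_le
        (∑ l, (pd i (a l) x * v l x - pd l (a l) x * v i x + pd l (a i) x * v l x)) (a i x * f x)
      simp only [Finset.sum_const, Finset.card_univ, Fintype.card_fin, nsmul_eq_mul] at h2
      refine h4.trans ?_
      linarith
    rw [← sq_abs, ← Real.sq_sqrt (hL0 x), ← mul_pow]
    exact pow_le_pow_left₀ (abs_nonneg _) h1 2
  -- test the commutator identity with `a · ∇u` itself: `∫ ∑ (zᵢ - Qᵢ) zᵢ = 0`
  have hid := integral_eq_zero_of_test hΩ hb hs (q₀ := fun _ => 0) (q := fun i x => z i x - Q i x)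
    MemLp.zero (fun i => (hz2 i).sub (hQ2 i)) (fun φ hφ => by
      simp only [zero_mul, zero_add]
      exact tangential_identity h hΩ (fun l => (ha l).smooth) hφ)
    (z := fun x => ∑ l, a l x * v l x) (memLp_finsetSum _ fun l _ => hm (ha l) (h.memV l)) hz2 hw
    (fun x hx => Finset.sum_eq_zero fun l _ => by rw [h.zeroV l x hx, mul_zero])
  simp only [zero_mul, zero_add] at hid
  have hD : ∀ i, Integrable fun x => (z i x - Q i x) * z i x := fun i =>
    integrable_mul_of_memLp ((hz2 i).sub (hQ2 i)) (hz2 i)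
  -- pointwise `z² - 2 (z - Q) z ≤ Q²`, because the difference is `(z - Q)²`
  have hmain : ∫ x, ∑ i, z i x ^ 2 ≤ n * ((3 * n + 1) * M) ^ 2 * ∫ x, L x := by
    have h1 : ∫ x, (∑ i, z i x ^ 2 - 2 * ∑ i, (z i x - Q i x) * z i x) = ∫ x, ∑ i, z i x ^ 2 := by
      rw [integral_sub (integrable_finsetSum _ fun i _ => (hz2 i).integrable_sq)
        ((integrable_finsetSum _ fun i _ => hD i).const_mul 2), integral_const_mul]
      rw [hid, mul_zero, sub_zero]
    rw [← h1, ← integral_const_mul]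
    refine integral_mono ((integrable_finsetSum _ fun i _ => (hz2 i).integrable_sq).sub
        ((integrable_finsetSum _ fun i _ => hD i).const_mul 2)) (hLi.const_mul _) fun x => ?_
    simp only [Finset.mul_sum, ← Finset.sum_sub_distrib]
    calc ∑ i, (z i x ^ 2 - 2 * ((z i x - Q i x) * z i x)) ≤ ∑ i, Q i x ^ 2 :=
          Finset.sum_le_sum fun i _ => by nlinarith [sq_nonneg (z i x - Q i x)]
      _ ≤ ∑ _i : Fin n, ((3 * n + 1) * M) ^ 2 * L x := Finset.sum_le_sum fun i _ => hQb i x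
      _ = _ := by
        simp only [Finset.sum_const, Finset.card_univ, Fintype.card_fin, nsmul_eq_mul]; ring
  have hzi : ∫ x, z i₀ x ^ 2 ≤ ∫ x, ∑ i, z i x ^ 2 :=
    integral_mono (hz2 i₀).integrable_sq (integrable_finsetSum _ fun i _ => (hz2 i).integrable_sq)
      fun x => Finset.single_le_sum (f := fun i => z i x ^ 2) (fun _ _ => sq_nonneg _)
        (Finset.mem_univ i₀)
  calc ∫ x, (∑ l, a l x * w l i₀ x) ^ 2
      ≤ ∫ x, (2 * z i₀ x ^ 2 + 2 * (n * M) ^ 2 * L x) := by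
        refine integral_mono (memLp_finsetSum _ fun l _ => hm (ha l) (h.memW l i₀)).integrable_sq
          (((hz2 i₀).integrable_sq.const_mul 2).add (hLi.const_mul _)) fun x => ?_
        have h1 : ∑ l, a l x * w l i₀ x = z i₀ x - ∑ l, pd i₀ (a l) x * v l x := by
          simp only [hz, Finset.sum_add_distrib]; ring
        have h2 : |∑ l, pd i₀ (a l) x * v l x| ≤ n * M * √(L x) := by
          refine (Finset.abs_sum_le_sum_abs _ _).trans ((Finset.sum_le_sum fun l _ =>
            hbv l x (bd i₀ l x)).trans (le_of_eq ?_))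
          simp only [Finset.sum_const, Finset.card_univ, Fintype.card_fin, nsmul_eq_mul]; ring
        have h3 := pow_le_pow_left₀ (abs_nonneg _) h2 2
        rw [sq_abs, mul_pow, Real.sq_sqrt (hL0 x)] at h3
        simp only [h1]
        nlinarith [sq_nonneg (z i₀ x + ∑ l, pd i₀ (a l) x * v l x)]
    _ = 2 * (∫ x, z i₀ x ^ 2) + 2 * (n * M) ^ 2 * ∫ x, L x := by
        rw [integral_add ((hz2 i₀).integrable_sq.const_mul 2) (hLi.const_mul _),
          integral_const_mul, integral_const_mul, ← integral_const_mul, integral_const_mul]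
    _ ≤ _ := by linarith

end Tangential


/-! ### Cutting off near a hypersurface -/

section Cutoff

variable {n : ℕ} {U : Set (E n)} {ρ : E n → ℝ}

/-- A smooth function of `ρ` which, for `m > 0`, is `1` where `ρ ≤ -2/m` and `0` where
`ρ ≥ -1/m`. -/
noncomputable def cutoff (ρ : E n → ℝ) (m : ℕ) (x : E n) : ℝ := Real.smoothTransition (-(m * ρ x) - 1)

lemma contDiff_cutoff (hρ : ContDiff ℝ ∞ ρ) (m : ℕ) : ContDiff ℝ ∞ (cutoff ρ m) :=
  Real.smoothTransition.contDiff.comp ((contDiff_const.mul hρ).neg.sub contDiff_const)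

lemma abs_cutoff_le (m : ℕ) (x : E n) : |cutoff ρ m x| ≤ 1 := by
  rw [cutoff, abs_of_nonneg (Real.smoothTransition.nonneg _)]
  exact Real.smoothTransition.le_one _

lemma tsupport_cutoff_subset (hρ : Continuous ρ) {m : ℕ} (hm : 0 < m) :
    tsupport (cutoff ρ m) ⊆ {x | ρ x < 0} := by
  have h1 : tsupport (cutoff ρ m) ⊆ {x | m * ρ x ≤ -1} := by
    refine closure_minimal (fun x hx => ?_) (isClosed_le (by fun_prop) continuous_const)
    by_contra hc
    refine hx (Real.smoothTransition.zero_of_nonpos ?_)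
    simp only [Set.mem_ofPred_eq, not_le] at hc
    linarith
  intro x hx
  have h2 : (m : ℝ) * ρ x ≤ -1 := h1 hx
  have h3 : (0 : ℝ) < m := by exact_mod_cast hm
  simp only [Set.mem_ofPred_eq]
  by_contra hc
  nlinarith

lemma tendsto_cutoff_of_neg {x : E n} (hx : ρ x < 0) :
    Tendsto (fun m => cutoff ρ m x) atTop (𝓝 1) := by
  refine tendsto_const_nhds.congr' ?_
  obtain ⟨M, hM⟩ := exists_nat_ge (2 / (-ρ x))
  filter_upwards [eventually_ge_atTop M] with m hm
  refine (Real.smoothTransition.one_of_one_le ?_).symm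
  have h1 : 2 / (-ρ x) ≤ m := hM.trans (by exact_mod_cast hm)
  rw [div_le_iff₀ (by linarith)] at h1
  linarith

lemma cutoff_eq_zero {x : E n} (hx : 0 ≤ ρ x) (m : ℕ) : cutoff ρ m x = 0 := by
  refine Real.smoothTransition.zero_of_nonpos ?_
  have : 0 ≤ (m : ℝ) * ρ x := by positivity
  linarith

/-- The gradient of the cut-off is parallel to that of `ρ`, and lives in the strip
`-2/m ≤ ρ ≤ -1/m`. -/
lemma exists_pd_cutoff (hρ : ContDiff ℝ ∞ ρ) :
    ∃ (B : ℝ) (D : ℕ → E n → ℝ), 0 ≤ B ∧ (∀ m x, |D m x| ≤ m * B) ∧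
      (∀ m x, D m x ≠ 0 → -2 ≤ m * ρ x ∧ m * ρ x ≤ -1) ∧
      ∀ m i x, pd i (cutoff ρ m) x = D m x * pd i ρ x := by
  have hst : ContDiff ℝ ∞ Real.smoothTransition := Real.smoothTransition.contDiff
  have h0 : ∀ s, s ∉ Set.Icc (0 : ℝ) 1 → deriv Real.smoothTransition s = 0 := by
    intro s hs
    rw [Set.mem_Icc, not_and_or, not_le, not_le] at hs
    rcases hs with hs | hs
    · have : Real.smoothTransition =ᶠ[𝓝 s] fun _ => 0 := by
        filter_upwards [Iio_mem_nhds hs] with t ht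
        exact Real.smoothTransition.zero_of_nonpos (le_of_lt ht)
      rw [this.deriv_eq]; simp
    · have : Real.smoothTransition =ᶠ[𝓝 s] fun _ => 1 := by
        filter_upwards [Ioi_mem_nhds hs] with t ht
        exact Real.smoothTransition.one_of_one_le (le_of_lt ht)
      rw [this.deriv_eq]; simp
  have hc : HasCompactSupport (deriv Real.smoothTransition) :=
    HasCompactSupport.intro isCompact_Icc h0
  obtain ⟨B, hB⟩ := (hst.continuous_deriv (by simp)).bounded_above_of_compact_support hc
  refine ⟨|B|, fun m x => -m * deriv Real.smoothTransition (-(m * ρ x) - 1), abs_nonneg _,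
    fun m x => ?_, fun m x hx => ?_, fun m i x => ?_⟩
  · rw [abs_mul, abs_neg, Nat.abs_cast]
    exact mul_le_mul_of_nonneg_left ((hB _).trans (le_abs_self _)) (Nat.cast_nonneg m)
  · have : -(m * ρ x) - 1 ∈ Set.Icc (0 : ℝ) 1 := by
      by_contra hcon
      exact hx (by simp [h0 _ hcon])
    constructor <;> linarith [this.1, this.2]
  · have h1 : HasFDerivAt (fun y => -(m * ρ y) - 1) (-((m : ℝ) • fderiv ℝ ρ x)) x :=
      (((hρ.differentiable (by simp) x).hasFDerivAt.const_mul (m : ℝ)).neg).sub_const 1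
    have h2 := ((hst.differentiable (by simp) (-(m * ρ x) - 1)).hasDerivAt).comp_hasFDerivAt x h1
    have h3 : HasFDerivAt (cutoff ρ m) (deriv Real.smoothTransition (-(m * ρ x) - 1) •
      -((m : ℝ) • fderiv ℝ ρ x)) x := h2
    simp only [pd, h3.fderiv]
    simp
    ring

end Cutoff

/-! ### Tangential derivatives at the boundary -/

section BoundaryTangential

variable {n : ℕ} {Ω : Set (E n)}

lemma exists_pd_ne_zero {ρ : E n → ℝ} {x : E n} (h : gradient ρ x ≠ 0) : ∃ l, pd l ρ x ≠ 0 := by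
  by_contra! hc
  refine h ?_
  ext l
  have h1 := gradient_inner_eq (ρ := ρ) x (e l)
  have h2 : fderiv ℝ ρ x (e l) = 0 := hc l
  rw [h2, EuclideanSpace.inner_single_right] at h1
  simpa using h1

/-- A boundary point has a ball around it in which the domain is `{ρ < 0}` and `ρ` is strictly
monotone in some coordinate direction. -/
lemma exists_good_ball {x₀ : E n} {ρ : E n → ℝ} (h : IsLocalDefiningFunction Ω x₀ ρ) :
    ∃ (r : ℝ) (l : Fin n) (s c : ℝ), 0 < r ∧ 0 < c ∧ (s = 1 ∨ s = -1) ∧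
      (∀ x ∈ Metric.ball x₀ r, x ∈ Ω ↔ ρ x < 0) ∧ ∀ x ∈ Metric.ball x₀ r, c ≤ s * pd l ρ x := by
  obtain ⟨hρ, h0, hg, hev⟩ := h
  obtain ⟨l, hl⟩ := exists_pd_ne_zero hg
  have hcont : Continuous (pd l ρ) := (contDiff_pd hρ l).continuous
  obtain ⟨s, hs, hsl⟩ : ∃ s : ℝ, (s = 1 ∨ s = -1) ∧ 0 < s * pd l ρ x₀ := by
    rcases lt_or_gt_of_ne hl with h | h
    · exact ⟨-1, Or.inr rfl, by linarith⟩
    · exact ⟨1, Or.inl rfl, by linarith⟩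
  have hnear : ∀ᶠ x in 𝓝 x₀, s * pd l ρ x₀ / 2 < s * pd l ρ x :=
    (continuous_const.mul hcont).continuousAt.eventually_const_lt
      (show s * pd l ρ x₀ / 2 < s * pd l ρ x₀ by linarith)
  obtain ⟨r, hr, hball⟩ := Metric.eventually_nhds_iff_ball.1 (hev.and hnear)
  exact ⟨r, l, s, s * pd l ρ x₀ / 2, hr, by linarith, hs, fun x hx => (hball x hx).1,
    fun x hx => (hball x hx).2.le⟩

/-- A lower bound for the increment of `ρ` along a segment in a coordinate direction. -/
lemma le_increment {ρ : E n → ℝ} (hρ : ContDiff ℝ ∞ ρ) {x₀ x : E n} {r s c τ : ℝ} {l : Fin n}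
    (hτ : 0 ≤ τ) (hc : ∀ x ∈ Metric.ball x₀ r, c ≤ s * pd l ρ x)
    (hx : x ∈ Metric.ball x₀ r) (hx' : x + (s * τ) • e l ∈ Metric.ball x₀ r) :
    ρ x + c * τ ≤ ρ (x + (s * τ) • e l) := by
  have hderiv : ∀ t : ℝ, HasDerivAt (fun t : ℝ => ρ (x + (s * t) • e l))
      (s * pd l ρ (x + (s * t) • e l)) t := by
    intro t
    have h1 : HasDerivAt (fun t : ℝ => x + (s * t) • (e l : E n)) (s • e l) t := by
      have h2 : HasDerivAt (fun t : ℝ => s * t) s t := by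
        simpa using (hasDerivAt_id t).const_mul s
      exact (h2.smul_const (e l : E n)).const_add x
    have := ((hρ.differentiable (by simp) (x + (s * t) • e l)).hasFDerivAt).comp_hasDerivAt t h1
    rw [map_smul, smul_eq_mul] at this
    exact this
  have hseg : ∀ t ∈ Set.Icc 0 τ, x + (s * t) • e l ∈ Metric.ball x₀ r := by
    intro t ht
    rcases hτ.eq_or_lt with h0 | h0
    · have : t = 0 := le_antisymm (h0 ▸ ht.2) ht.1
      simpa [this] using hx
    have := (convex_ball x₀ r).add_smul_mem hx hx' (t := t / τ)
      ⟨div_nonneg ht.1 hτ, (div_le_one h0).2 ht.2⟩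
    rwa [smul_smul, show t / τ * (s * τ) = s * t by field_simp] at this
  have := (convex_Icc 0 τ).mul_sub_le_image_sub_of_le_deriv (f := fun t : ℝ => ρ (x + (s * t) • e l))
    (fun t _ => (hderiv t).continuousAt.continuousWithinAt)
    (fun t _ => (hderiv t).differentiableAt.differentiableWithinAt) (C := c)
    (fun t ht => by
      rw [(hderiv t).deriv]
      exact hc _ (hseg t (interior_subset ht))) 0 (by simp [hτ]) τ (by simp [hτ]) hτ
  simp only [mul_zero, zero_smul, add_zero, sub_zero] at this
  linarith

/-- The `L¹` norm of a function with zero boundary values in the strip `-2/m ≤ ρ ≤ -1/m` along the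
boundary is `o(1/m)`: shifting the strip by a distance of order `1/m` moves it out of the domain. -/
lemma tendsto_strip {x₀ : E n} {ρ : E n → ℝ} (hρ : ContDiff ℝ ∞ ρ) {r s c : ℝ} {l : Fin n}
    (hc0 : 0 < c) (hs : s = 1 ∨ s = -1) (hdef : ∀ x ∈ Metric.ball x₀ r, x ∈ Ω ↔ ρ x < 0)
    (hc : ∀ x ∈ Metric.ball x₀ r, c ≤ s * pd l ρ x) {K : Set (E n)} (hK : IsCompact K)
    (hKr : K ⊆ Metric.ball x₀ r) {u g : E n → ℝ} (hu : MemLp u 2) (hg : MemLp g 2)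
    (hw : WeakPartialOn Set.univ l u g) (hu0 : ∀ x ∉ Ω, u x = 0) :
    Tendsto (fun m : ℕ => m * ∫ x in K ∩ {x | -2 ≤ m * ρ x ∧ m * ρ x ≤ -1}, |u x|) atTop (𝓝 0) := by
  set A : ℕ → Set (E n) := fun m => K ∩ {x | -2 ≤ m * ρ x ∧ m * ρ x ≤ -1} with hA
  have hAm : ∀ m, MeasurableSet (A m) := fun m => by
    refine hK.measurableSet.inter (IsClosed.measurableSet ?_)
    exact (isClosed_le continuous_const (continuous_const.mul hρ.continuous)).inter
      (isClosed_le (continuous_const.mul hρ.continuous) continuous_const)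
  have hind : ∀ m, MemLp ((A m).indicator fun _ => (1 : ℝ)) 2 volume := fun m =>
    memLp_indicator_const 2 (hAm m) 1 (Or.inr ((measure_mono Set.inter_subset_left).trans_lt
      hK.measure_lt_top).ne)
  -- the measure of the strips tends to zero
  have hvol : Tendsto (fun m => ∫ x, ((A m).indicator fun _ => (1 : ℝ)) x ^ 2) atTop (𝓝 0) := by
    have := tendsto_integral_of_dominated_convergence
      (F := fun m x => ((A m).indicator fun _ => (1 : ℝ)) x ^ 2) (f := fun _ => (0 : ℝ))
      (μ := volume) (K.indicator fun _ => (1 : ℝ)) (fun m => ((hind m).1.pow 2))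
      ((integrable_indicator_iff hK.measurableSet).2 (by
        simpa using integrableOn_const (C := (1 : ℝ)) hK.measure_lt_top.ne))
      (fun m => Eventually.of_forall fun x => ?_) (Eventually.of_forall fun x => ?_)
    · simpa using this
    · by_cases hx : x ∈ A m
      · simp [hx, hx.1]
      · by_cases hxK : x ∈ K <;> simp [hx, hxK]
    · refine tendsto_const_nhds.congr' ?_
      have hev : ∀ᶠ m : ℕ in atTop, x ∉ A m := by
        rcases le_or_gt 0 (ρ x) with h | h
        · refine Eventually.of_forall fun m hm => ?_
          have : 0 ≤ (m : ℝ) * ρ x := by positivity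
          linarith [hm.2.2]
        · obtain ⟨M, hM⟩ := exists_nat_gt (2 / (-ρ x))
          filter_upwards [eventually_ge_atTop M] with m hm hmA
          have h1 : 2 / (-ρ x) < m := hM.trans_le (by exact_mod_cast hm)
          rw [div_lt_iff₀ (by linarith)] at h1
          linarith [hmA.2.1]
      filter_upwards [hev] with m hm
      simp [hm]
  obtain ⟨δ, hδ, hKδ⟩ := hK.exists_thickening_subset_open Metric.isOpen_ball hKr
  obtain ⟨M, hM⟩ := exists_nat_gt (2 / c / δ)
  have hbound : ∀ᶠ m : ℕ in atTop, m * ∫ x in A m, |u x|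
      ≤ √(∫ x, ((A m).indicator fun _ => (1 : ℝ)) x ^ 2) * (2 / c * √(∫ x, g x ^ 2)) := by
    filter_upwards [eventually_ge_atTop M, eventually_gt_atTop 0] with m hm hm0
    have hmpos : (0 : ℝ) < m := by exact_mod_cast hm0
    -- a shift by `τ = 2/(cm)` raises `ρ` by at least `2/m`
    set τ : ℝ := 2 / c / m with hτ
    have hτ0 : 0 < τ := by positivity
    have hτδ : τ < δ := by
      have : 2 / c / δ < m := hM.trans_le (by exact_mod_cast hm)
      rw [hτ, div_lt_iff₀ hmpos]
      rwa [div_lt_iff₀ hδ, mul_comm] at this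
    have hshift : ∀ x ∈ A m, u (x + (s * τ) • e l) = 0 := by
      intro x hx
      have hmem : x + (s * τ) • e l ∈ Metric.ball x₀ r := by
        refine hKδ (Metric.mem_thickening_iff.2 ⟨x, hx.1, ?_⟩)
        have hs1 : |s| = 1 := by rcases hs with h | h <;> simp [h]
        rw [dist_eq_norm, add_sub_cancel_left, norm_smul, PiLp.norm_single, Real.norm_eq_abs,
          abs_mul, hs1, abs_of_pos hτ0]
        simpa using hτδ
      refine hu0 _ ?_
      rw [hdef _ hmem, not_lt]
      have h1 := le_increment hρ hτ0.le hc (hKr hx.1) hmem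
      have h2 : c * τ * m = 2 := by rw [hτ]; field_simp
      nlinarith [hx.2.1]
    have hDm := (memLp_comp_add hu ((s * τ) • e l)).sub hu
    have h3 : ∫ x in A m, |u x|
        = ∫ x, ((A m).indicator fun _ => (1 : ℝ)) x * |u (x + (s * τ) • e l) - u x| := by
      rw [← integral_indicator (hAm m)]
      refine integral_congr_ae (Eventually.of_forall fun x => ?_)
      by_cases hx : x ∈ A m
      · simp [hx, hshift x hx]
      · simp [hx]
    have h4 := (le_abs_self _).trans (abs_integral_mul_le (hind m) hDm.abs)
    have h5 := integral_translate_sub_sq_le hu hg hw (s * τ)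
    have hs2 : (s * τ) ^ 2 = τ ^ 2 := by rcases hs with h | h <;> simp [h]
    rw [hs2] at h5
    have h6 : √(∫ x, |u (x + (s * τ) • e l) - u x| ^ 2) ≤ τ * √(∫ x, g x ^ 2) := by
      simp only [sq_abs]
      refine (Real.sqrt_le_sqrt h5).trans (le_of_eq ?_)
      rw [Real.sqrt_mul (sq_nonneg _), Real.sqrt_sq hτ0.le]
    calc (m : ℝ) * ∫ x in A m, |u x|
        ≤ m * (√(∫ x, ((A m).indicator fun _ => (1 : ℝ)) x ^ 2) * (τ * √(∫ x, g x ^ 2))) := by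
          rw [h3]
          refine mul_le_mul_of_nonneg_left (h4.trans ?_) hmpos.le
          exact mul_le_mul_of_nonneg_left h6 (Real.sqrt_nonneg _)
      _ = _ := by rw [hτ]; field_simp
  have hlim : Tendsto (fun m => √(∫ x, ((A m).indicator fun _ => (1 : ℝ)) x ^ 2)
      * (2 / c * √(∫ x, g x ^ 2))) atTop (𝓝 0) := by
    have := ((Real.continuous_sqrt.tendsto 0).comp hvol).mul_const (2 / c * √(∫ x, g x ^ 2))
    simpa using this
  exact squeeze_zero' (Eventually.of_forall fun m => mul_nonneg (Nat.cast_nonneg m)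
    (integral_nonneg fun x => abs_nonneg _)) hbound hlim

/-- Tangential derivatives of a function with zero boundary values have zero boundary values: their
extension by zero has no jump across the boundary. -/
lemma exists_tangential_extension {x₀ : E n} {ρ : E n → ℝ} (hloc : IsLocalDefiningFunction Ω x₀ ρ) :
    ∃ U ∈ 𝓝 x₀, IsOpen U ∧ ∀ (u : E n → ℝ) (v : Fin n → E n → ℝ) (w : Fin n → Fin n → E n → ℝ),
      IsDirichletH2 Ω u v w → ∀ p q k,
      WeakPartialOn U k (fun x => pd q ρ x * v p x - pd p ρ x * v q x)
        (fun x => pd k (pd q ρ) x * v p x + pd q ρ x * w p k x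
          - (pd k (pd p ρ) x * v q x + pd p ρ x * w q k x)) := by
  have hρ := hloc.1
  obtain ⟨r, l, s, c, hr, hc0, hs, hdef, hc⟩ := exists_good_ball hloc
  refine ⟨Metric.ball x₀ r, Metric.ball_mem_nhds _ hr, Metric.isOpen_ball,
    fun u v w h p q k => ?_⟩
  set U := Metric.ball x₀ r with hU
  intro ψ hψ
  set W : E n → ℝ := fun x => pd q ρ x * v p x - pd p ρ x * v q x with hW
  set Wk : E n → ℝ := fun x => pd k (pd q ρ) x * v p x + pd q ρ x * w p k x
          - (pd k (pd p ρ) x * v q x + pd p ρ x * w q k x) with hWk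
  have lsm : ∀ {b f : E n → ℝ}, ContDiff ℝ ∞ b → LocallyIntegrable f →
      LocallyIntegrable fun x => b x * f x := fun hb hf => by
    rw [← locallyIntegrableOn_univ] at hf ⊢
    exact hf.continuousOn_smul isOpen_univ.isLocallyClosed hb.continuous.continuousOn
  have hWl : LocallyIntegrable W :=
    (lsm (contDiff_pd hρ q) (h.locV p)).sub (lsm (contDiff_pd hρ p) (h.locV q))
  have hWkl : LocallyIntegrable Wk :=
    ((lsm (contDiff_pd (contDiff_pd hρ q) k) (h.locV p)).add
      (lsm (contDiff_pd hρ q) (h.locW p k))).sub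
    ((lsm (contDiff_pd (contDiff_pd hρ p) k) (h.locV q)).add
      (lsm (contDiff_pd hρ p) (h.locW q k)))
  have hW0 : ∀ x ∉ Ω, W x = 0 := fun x hx => by
    simp [hW, h.zeroV p x hx, h.zeroV q x hx]
  have hWk0 : ∀ x ∉ Ω, Wk x = 0 := fun x hx => by
    simp [hWk, h.zeroV p x hx, h.zeroV q x hx, h.zeroW p k x hx, h.zeroW q k x hx]
  -- inside `Ω` the claim is the product rule; the point is that test functions in `U` need not
  -- vanish near the boundary, so they are cut off
  have hΩW : WeakPartialOn Ω k W Wk := by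
    intro φ hφ
    have h1 := (h.partialV p k).smul (h.locV p) (h.locW p k) (contDiff_pd hρ q)
      (Set.inter_subset_left (s := Ω)) φ hφ
    have h2 := (h.partialV q k).smul (h.locV q) (h.locW q k) (contDiff_pd hρ p)
      (Set.inter_subset_left (s := Ω)) φ hφ
    simp only [smul_eq_mul] at h1 h2
    simp only [hW, hWk, smul_eq_mul, mul_sub]
    have i1 := (hφ.pd k).integrable (lsm (contDiff_pd hρ q) (h.locV p))
    have i2 := (hφ.pd k).integrable (lsm (contDiff_pd hρ p) (h.locV q))
    have i3 := hφ.integrable ((lsm (contDiff_pd (contDiff_pd hρ q) k) (h.locV p)).add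
      (lsm (contDiff_pd hρ q) (h.locW p k)))
    have i4 := hφ.integrable ((lsm (contDiff_pd (contDiff_pd hρ p) k) (h.locV q)).add
      (lsm (contDiff_pd hρ p) (h.locW q k)))
    simp only [smul_eq_mul, Pi.add_apply] at i1 i2 i3 i4
    rw [integral_sub i1 i2, integral_sub i3 i4, h1, h2]
    ring
  obtain ⟨B, D, hB0, hDb, hDs, hDp⟩ := exists_pd_cutoff hρ
  have hψρ : IsTest U (fun x => ψ x * pd k ρ x) := hψ.mul_right (contDiff_pd hρ k)
  set ψ' : E n → ℝ := fun x => ψ x * pd k ρ x with hψ'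
  set J : ℕ → ℝ := fun m => ∫ x, cutoff ρ m x * (pd k ψ x * W x + ψ x * Wk x) with hJ
  -- the main term
  have hJlim : Tendsto J atTop (𝓝 (∫ x, (pd k ψ x * W x + ψ x * Wk x))) := by
    have hi : Integrable fun x => pd k ψ x * W x + ψ x * Wk x :=
      ((hψ.pd k).integrable hWl).add (hψ.integrable hWkl)
    refine tendsto_integral_of_dominated_convergence _ (fun m =>
      (contDiff_cutoff hρ m).continuous.aestronglyMeasurable.mul hi.1) hi.norm
      (fun m => Eventually.of_forall fun x => ?_) (Eventually.of_forall fun x => ?_)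
    · rw [norm_mul]
      exact mul_le_of_le_one_left (norm_nonneg _) (abs_cutoff_le m x)
    · by_cases hx : x ∈ Ω ∩ U
      · have := (tendsto_cutoff_of_neg ((hdef x hx.2).1 hx.1)).mul_const
          (pd k ψ x * W x + ψ x * Wk x)
        rwa [one_mul] at this
      · have : pd k ψ x * W x + ψ x * Wk x = 0 := by
          by_cases hxΩ : x ∈ Ω
          · have hxU : x ∉ U := fun hxU => hx ⟨hxΩ, hxU⟩
            rw [hψ.zero_off hxU, (hψ.pd k).zero_off hxU]; ring
          · rw [hW0 x hxΩ, hWk0 x hxΩ]; ring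
        simp only [this, mul_zero]
        exact tendsto_const_nhds
  obtain ⟨C₁, hC₁⟩ : ∃ C, ∀ x, ‖pd p ψ' x * pd q ρ x - pd q ψ' x * pd p ρ x‖ ≤ C :=
    Continuous.bounded_above_of_compact_support
      (((hψρ.pd p).continuous.mul (contDiff_pd hρ q).continuous).sub
        ((hψρ.pd q).continuous.mul (contDiff_pd hρ p).continuous))
      ((((hψρ.pd p).mul_right (contDiff_pd hρ q)).compact).sub
        (((hψρ.pd q).mul_right (contDiff_pd hρ p)).compact))
  -- the boundary term is an integral of `u` over a thin strip
  have hJb : ∀ᶠ m : ℕ in atTop, |J m| ≤ B * C₁ * (m * ∫ x in tsupport ψ ∩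
      {x | -2 ≤ m * ρ x ∧ m * ρ x ≤ -1}, |u x|) := by
    filter_upwards [eventually_gt_atTop 0] with m hm
    have hη := contDiff_cutoff hρ m
    have ht : IsTest Ω (fun x => ψ x * cutoff ρ m x) := by
      refine ⟨hψ.smooth.mul hη, hψ.compact.mul_right, fun x hx => ?_⟩
      exact (hdef x (hψ.subset (tsupport_mul_subset_left hx))).2
        (tsupport_cutoff_subset hρ.continuous hm (tsupport_mul_subset_right hx))
    have h1 := hΩW _ ht
    simp only [pd_mul hψ.smooth hη, hDp, smul_eq_mul] at h1
    have htp : ∀ j, IsTest U (fun x => ψ' x * pd j (cutoff ρ m) x) := fun j =>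
      hψρ.mul_right (contDiff_pd hη j)
    have h2 := h.partialU p _ ((htp q).mono (Set.subset_univ _))
    have h3 := h.partialU q _ ((htp p).mono (Set.subset_univ _))
    simp only [pd_mul hψρ.smooth (contDiff_pd hη _), smul_eq_mul] at h2 h3
    have i1 := ((htp q).pd p).integrable h.locU
    have i2 := ((htp p).pd q).integrable h.locU
    have i3 := (htp q).integrable (h.locV p)
    have i4 := (htp p).integrable (h.locV q)
    simp only [pd_mul hψρ.smooth (contDiff_pd hη _), smul_eq_mul] at i1 i2 i3 i4
    have hJm : J m = ∫ x, (pd p ψ' x * pd q (cutoff ρ m) x - pd q ψ' x * pd p (cutoff ρ m) x)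
        * u x := by
      have e1 : J m = -∫ x, ψ x * (D m x * pd k ρ x) * W x := by
        have i5 : Integrable fun x => cutoff ρ m x * (pd k ψ x * W x) := by
          have := ((hψ.pd k).mul_right hη).integrable hWl
          refine this.congr (Eventually.of_forall fun x => ?_)
          simp only [smul_eq_mul]; ring
        have i6 : Integrable fun x => ψ x * cutoff ρ m x * Wk x := ht.integrable hWkl
        have i7 : Integrable fun x => ψ x * (D m x * pd k ρ x) * W x := by
          have := (hψ.mul_right (contDiff_pd hη k)).integrable hWl
          simpa only [hDp, smul_eq_mul] using this
        have e2 : ∫ x, (pd k ψ x * cutoff ρ m x + ψ x * (D m x * pd k ρ x)) * W x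
            = (∫ x, cutoff ρ m x * (pd k ψ x * W x)) + ∫ x, ψ x * (D m x * pd k ρ x) * W x := by
          rw [← integral_add i5 i7]
          refine integral_congr_ae (Eventually.of_forall fun x => ?_)
          simp only; ring
        have e3 : J m = (∫ x, cutoff ρ m x * (pd k ψ x * W x)) + ∫ x, ψ x * cutoff ρ m x * Wk x := by
          rw [← integral_add i5 i6]
          refine integral_congr_ae (Eventually.of_forall fun x => ?_)
          simp only; ring
        rw [e2] at h1
        rw [e3]; linarith
      have e4 : ∫ x, ψ x * (D m x * pd k ρ x) * W x
          = (∫ x, ψ' x * pd q (cutoff ρ m) x * v p x) - ∫ x, ψ' x * pd p (cutoff ρ m) x * v q x := by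
        rw [← integral_sub i3 i4]
        refine integral_congr_ae (Eventually.of_forall fun x => ?_)
        simp only [hW, hψ', hDp]; ring
      -- integrating by parts once more, the second derivatives of the cut-off cancel: only a factor
      -- `m` is lost, not `m²`
      have e5 : ∫ x, (pd p ψ' x * pd q (cutoff ρ m) x - pd q ψ' x * pd p (cutoff ρ m) x) * u x
          = (∫ x, (pd p ψ' x * pd q (cutoff ρ m) x + ψ' x * pd p (pd q (cutoff ρ m)) x) * u x)
            - ∫ x, (pd q ψ' x * pd p (cutoff ρ m) x + ψ' x * pd q (pd p (cutoff ρ m)) x) * u x := by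
        rw [← integral_sub i1 i2]
        refine integral_congr_ae (Eventually.of_forall fun x => ?_)
        simp only [pd_comm hη p q]; ring
      rw [e1, e4, e5, h2, h3]; ring
    have hKm : MeasurableSet (tsupport ψ ∩ {x | -2 ≤ m * ρ x ∧ m * ρ x ≤ -1}) :=
      hψ.compact.measurableSet.inter (IsClosed.measurableSet
        ((isClosed_le continuous_const (continuous_const.mul hρ.continuous)).inter
        (isClosed_le (continuous_const.mul hρ.continuous) continuous_const)))
    rw [hJm, ← integral_indicator hKm, ← integral_const_mul, ← integral_const_mul,
      ← Real.norm_eq_abs]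
    have huK : IntegrableOn (fun x => |u x|) (tsupport ψ ∩ {x | -2 ≤ m * ρ x ∧ m * ρ x ≤ -1}) :=
      ((h.locU.integrableOn_isCompact hψ.compact).mono_set Set.inter_subset_left).norm
    refine norm_integral_le_of_norm_le
      (((integrable_indicator_iff hKm).2 huK).const_mul _ |>.const_mul _)
      (Eventually.of_forall fun x => ?_)
    rw [norm_mul, hDp, hDp, show pd p ψ' x * (D m x * pd q ρ x) - pd q ψ' x * (D m x * pd p ρ x)
      = D m x * (pd p ψ' x * pd q ρ x - pd q ψ' x * pd p ρ x) by ring, norm_mul]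
    by_cases hx : x ∈ tsupport ψ ∩ {x | -2 ≤ m * ρ x ∧ m * ρ x ≤ -1}
    · rw [Set.indicator_of_mem hx]
      have := mul_le_mul (hDb m x) (hC₁ x) (norm_nonneg _) (by positivity)
      simp only [Real.norm_eq_abs] at this ⊢
      nlinarith [mul_le_mul_of_nonneg_right this (abs_nonneg (u x))]
    · rw [Set.indicator_of_notMem hx, mul_zero, mul_zero]
      refine le_of_eq ?_
      by_cases hxD : D m x = 0
      · simp [hxD]
      · have hxψ : x ∉ tsupport ψ := fun hx' => hx ⟨hx', hDs m x hxD⟩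
        have h7 : ∀ j, pd j ψ' x = 0 := fun j => by
          refine image_eq_zero_of_notMem_tsupport fun hx' => hxψ ?_
          exact tsupport_mul_subset_left (tsupport_fderiv_apply_subset ℝ (e j) hx')
        simp [h7]
  have hstrip := (tendsto_strip hρ hc0 hs hdef hc hψ.compact hψ.subset h.memU (h.memV l)
    (h.partialU l) h.zeroU).const_mul (B * C₁)
  rw [mul_zero] at hstrip
  have hJ0 : Tendsto J atTop (𝓝 0) := squeeze_zero_norm' hJb hstrip
  have hfin := tendsto_nhds_unique hJlim hJ0
  have hadd := integral_add ((hψ.pd k).integrable hWl) (hψ.integrable hWkl)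
  simp only [smul_eq_mul] at hadd ⊢
  rw [hadd] at hfin
  exact eq_neg_of_add_eq_zero_left hfin

end BoundaryTangential


/-! ### The a priori estimate in `H² ∩ H¹₀` -/

section APriori

variable {n : ℕ} {Ω : Set (E n)}

lemma pd_mul_const {a : E n → ℝ} (ha : ContDiff ℝ ∞ a) (b : ℝ) (i : Fin n) (x : E n) :
    pd i (fun y => a y * b) x = pd i a x * b := by
  have := (((ha.differentiable (by simp) x).hasFDerivAt).mul_const b).fderiv
  simp only [pd, this]
  simp [mul_comm]

lemma pd_sub {a b : E n → ℝ} (ha : ContDiff ℝ ∞ a) (hb : ContDiff ℝ ∞ b) (i : Fin n) (x : E n) :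
    pd i (fun y => a y - b y) x = pd i a x - pd i b x := by
  have := ((ha.differentiable (by simp) x).hasFDerivAt.sub
    (hb.differentiable (by simp) x).hasFDerivAt).fderiv
  simp only [pd]
  erw [this]
  rfl

/-- Near an interior point all second derivatives are tangential. -/
lemma exists_interior_bound (hΩ : IsOpen Ω) (hb : Bornology.IsBounded Ω) (hs : HasSmoothBoundary Ω)
    {x₀ : E n} (hx₀ : x₀ ∈ Ω) :
    ∃ V ∈ 𝓝 x₀, ∃ C, 0 ≤ C ∧ ∀ (u : E n → ℝ) (v : Fin n → E n → ℝ) (w : Fin n → Fin n → E n → ℝ),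
      IsDirichletH2 Ω u v w → ∀ j k,
      ∫ x in V, w j k x ^ 2 ≤ C * ∫ x, (∑ k, v k x ^ 2 + (∑ k, w k k x) ^ 2) := by
  obtain ⟨χ, hχ, V, hVo, hxV, -, hχV⟩ := exists_isTest_eventually_one (hΩ.mem_nhds hx₀)
  -- the vector fields `χ eⱼ`
  set a : Fin n → Fin n → E n → ℝ := fun j l x => χ x * if l = j then 1 else 0 with ha_def
  have ha : ∀ j l, IsTest Set.univ (a j l) := fun j l =>
    (hχ.mono (Set.subset_univ _)).mul_right contDiff_const
  choose C hC0 hC using fun j => exists_tangential_bound hΩ hb hs (ha j)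
  refine ⟨V, hVo.mem_nhds hxV, ∑ j, C j, Finset.sum_nonneg fun j _ => hC0 j,
    fun u v w h j k => ?_⟩
  have hpa : ∀ j l i x, pd i (a j l) x = pd i χ x * if l = j then 1 else 0 := fun j l i x => by
    simp only [ha_def]
    rw [pd_mul_const hχ.smooth]
  have h1 := hC j u v w h (fun i => by
    have h2 := (h.partialV j i).smul (h.locV j) (h.locW j i) hχ.smooth (V := Set.univ)
      (Set.inter_subset_right.trans hχ.subset)
    have e1 : (fun x => ∑ l, a j l x * v l x) = fun x => χ x • v j x := by
      funext x; simp [ha_def]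
    have e2 : (fun x => ∑ l, (pd i (a j l) x * v l x + a j l x * w l i x))
        = fun x => pd i χ x • v j x + χ x • w j i x := by
      funext x; simp only [hpa]; simp [ha_def, Finset.sum_add_distrib]
    rw [e1, e2]; exact h2) k
  have e3 : ∀ x, ∑ l, a j l x * w l k x = χ x * w j k x := fun x => by simp [ha_def]
  simp only [e3] at h1
  have hi : Integrable fun x => (χ x * w j k x) ^ 2 := (hχ.memLp_smul (h.memW j k)).integrable_sq
  calc ∫ x in V, w j k x ^ 2 = ∫ x in V, (χ x * w j k x) ^ 2 :=
        setIntegral_congr_fun hVo.measurableSet fun x hx => by simp [hχV x hx]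
    _ ≤ ∫ x, (χ x * w j k x) ^ 2 :=
        setIntegral_le_integral hi (Eventually.of_forall fun x => sq_nonneg _)
    _ ≤ C j * ∫ x, (∑ k, v k x ^ 2 + (∑ k, w k k x) ^ 2) := h1
    _ ≤ _ := mul_le_mul_of_nonneg_right
        (Finset.single_le_sum (fun j _ => hC0 j) (Finset.mem_univ j))
        (integral_nonneg fun x => by positivity)

/-- The tangential parts of a symmetric matrix `W`, together with its trace, determine `W`:
`N` is the normal direction and `|N|² ≥ c²`. -/
lemma sq_le_of_tangential {N : Fin n → ℝ} {W : Fin n → Fin n → ℝ} {M c P : ℝ} {l : Fin n}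
    (hsymm : ∀ i j, W i j = W j i) (hN : ∀ i, |N i| ≤ M) (hc : 0 < c) (hcl : c ≤ |N l|)
    (hA : ∀ p q k, |N q * W p k - N p * W q k| ≤ P) (hf : |∑ k, W k k| ≤ P) (j k : Fin n) :
    |W j k| ≤ (c ^ 2)⁻¹ * (M * (2 * n + M) * P) := by
  have hM : 0 ≤ M := (abs_nonneg _).trans (hN l)
  set S := ∑ i, N i ^ 2 with hS
  have hcS : c ^ 2 ≤ S := by
    have h1 : N l ^ 2 ≤ S :=
      Finset.single_le_sum (f := fun i => N i ^ 2) (fun _ _ => sq_nonneg _) (Finset.mem_univ l)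
    rw [← sq_abs] at h1
    exact (pow_le_pow_left₀ hc.le hcl 2).trans h1
  have hSpos : 0 < S := lt_of_lt_of_le (by positivity) hcS
  -- `|N|² W j k` in terms of tangential components and the trace, by the symmetry of `W`
  have key : S * W j k = ∑ i, N i * (N i * W j k - N j * W i k)
      + N j * (∑ i, (N i * W k i - N k * W i i) + N k * ∑ i, W i i) := by
    rw [Finset.sum_sub_distrib, ← Finset.mul_sum, sub_add_cancel, Finset.mul_sum,
      ← Finset.sum_add_distrib, hS, Finset.sum_mul]
    refine Finset.sum_congr rfl fun i _ => ?_
    rw [hsymm k i]; ring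
  have b1 : |∑ i, N i * (N i * W j k - N j * W i k)| ≤ n * (M * P) := by
    refine (Finset.abs_sum_le_sum_abs _ _).trans ((Finset.sum_le_sum fun i _ => ?_).trans
      (le_of_eq (a := ∑ _i : Fin n, M * P) (by simp)))
    rw [abs_mul]
    exact mul_le_mul (hN i) (hA j i k) (abs_nonneg _) hM
  have b2 : |∑ i, (N i * W k i - N k * W i i) + N k * ∑ i, W i i| ≤ n * P + M * P := by
    refine (abs_add_le _ _).trans (add_le_add ?_ ?_)
    · exact (Finset.abs_sum_le_sum_abs _ _).trans ((Finset.sum_le_sum fun i _ => hA k i i).trans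
        (le_of_eq (a := ∑ _i : Fin n, P) (by simp)))
    · rw [abs_mul]
      exact mul_le_mul (hN k) hf (abs_nonneg _) hM
  have b3 : S * |W j k| ≤ M * (2 * n + M) * P := by
    rw [← abs_of_pos hSpos, ← abs_mul, key]
    refine (abs_add_le _ _).trans ?_
    rw [abs_mul (N j)]
    have b4 := mul_le_mul (hN j) b2 (abs_nonneg _) hM
    nlinarith
  rw [inv_mul_eq_div, le_div_iff₀ (by positivity), mul_comm]
  exact (mul_le_mul_of_nonneg_right hcS (abs_nonneg _)).trans b3

/-- Near a boundary point the second derivatives are bounded by the tangential ones and the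
Laplacian. -/
lemma exists_boundary_bound (hΩ : IsOpen Ω) (hb : Bornology.IsBounded Ω) (hs : HasSmoothBoundary Ω)
    {x₀ : E n} (hx₀ : x₀ ∈ frontier Ω) :
    ∃ V ∈ 𝓝 x₀, ∃ C, 0 ≤ C ∧ ∀ (u : E n → ℝ) (v : Fin n → E n → ℝ) (w : Fin n → Fin n → E n → ℝ),
      IsDirichletH2 Ω u v w → ∀ j k,
      ∫ x in V, w j k x ^ 2 ≤ C * ∫ x, (∑ k, v k x ^ 2 + (∑ k, w k k x) ^ 2) := by
  obtain ⟨ρ, hloc⟩ := hs x₀ hx₀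
  have hρ := hloc.1
  obtain ⟨U, hU, hUo, hext⟩ := exists_tangential_extension hloc
  obtain ⟨r, l, s, c, hr, hc0, hs1, -, hc⟩ := exists_good_ball hloc
  obtain ⟨χ, hχ, V, hVo, hxV, hVU, hχV⟩ :=
    exists_isTest_eventually_one (inter_mem hU (Metric.ball_mem_nhds x₀ hr))
  have hχu : IsTest Set.univ χ := hχ.mono (Set.subset_univ _)
  -- the vector fields `χ (∂qρ eₚ - ∂ₚρ e_q)`, which are tangential to the level sets of `ρ`
  set a : Fin n → Fin n → Fin n → E n → ℝ := fun p q l x =>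
    χ x * (pd q ρ x * (if l = p then 1 else 0) - pd p ρ x * (if l = q then 1 else 0)) with ha_def
  have hbs : ∀ p q l : Fin n, ContDiff ℝ ∞ fun x : E n =>
      pd q ρ x * (if l = p then (1 : ℝ) else 0) - pd p ρ x * (if l = q then 1 else 0) :=
    fun p q l => ((contDiff_pd hρ q).mul contDiff_const).sub ((contDiff_pd hρ p).mul contDiff_const)
  have ha : ∀ p q l, IsTest Set.univ (a p q l) := fun p q l => hχu.mul_right (hbs p q l)
  choose C hC0 hC using fun p q => exists_tangential_bound hΩ hb hs (ha p q)
  obtain ⟨M, hM0, hM⟩ : ∃ M, 0 ≤ M ∧ ∀ i, ∀ x ∈ tsupport χ, |pd i ρ x| ≤ M := by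
    have : ∀ i, ∃ M, ∀ x ∈ tsupport χ, ‖pd i ρ x‖ ≤ M := fun i =>
      IsCompact.exists_bound_of_continuousOn hχ.compact (contDiff_pd hρ i).continuous.continuousOn
    choose M hM using this
    exact ⟨∑ i, |M i|, by positivity, fun i x hx => ((hM i x hx).trans (le_abs_self _)).trans
      (Finset.single_le_sum (f := fun i => |M i|) (fun _ _ => abs_nonneg _) (Finset.mem_univ i))⟩
  set C' := (c ^ 2)⁻¹ * (M * (2 * n + M)) with hC'
  have hCs : 0 ≤ ∑ τ : Fin n × Fin n × Fin n, C τ.1 τ.2.1 := Finset.sum_nonneg fun τ _ => hC0 _ _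
  refine ⟨V, hVo.mem_nhds hxV, C' ^ 2 * ((∑ τ : Fin n × Fin n × Fin n, C τ.1 τ.2.1) + 1), by positivity,
    fun u v w h j k => ?_⟩
  set L : E n → ℝ := fun x => ∑ k, v k x ^ 2 + (∑ k, w k k x) ^ 2 with hL
  have hLi : Integrable L := h.integrable_lower
  have hL0 : ∀ x, 0 ≤ L x := fun x => by simp only [hL]; positivity
  have hLI : 0 ≤ ∫ x, L x := integral_nonneg hL0
  -- the tangential derivatives of the gradient
  set A : Fin n → Fin n → Fin n → E n → ℝ := fun p q k x =>
    χ x * (pd q ρ x * w p k x - pd p ρ x * w q k x) with hA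
  have hAbound : ∀ p q k, ∫ x, A p q k x ^ 2 ≤ C p q * ∫ x, L x := by
    intro p q k
    have h1 := hC p q u v w h (fun i => by
      have lsm : ∀ {b f : E n → ℝ}, ContDiff ℝ ∞ b → LocallyIntegrable f →
          LocallyIntegrable fun x => b x * f x := fun hb hf => by
        rw [← locallyIntegrableOn_univ] at hf ⊢
        exact hf.continuousOn_smul isOpen_univ.isLocallyClosed hb.continuous.continuousOn
      have h2 := (hext u v w h p q i).smul
        ((lsm (contDiff_pd hρ q) (h.locV p)).sub (lsm (contDiff_pd hρ p) (h.locV q)))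
        (((lsm (contDiff_pd (contDiff_pd hρ q) i) (h.locV p)).add
          (lsm (contDiff_pd hρ q) (h.locW p i))).sub
          ((lsm (contDiff_pd (contDiff_pd hρ p) i) (h.locV q)).add
          (lsm (contDiff_pd hρ p) (h.locW q i)))) hχ.smooth (V := Set.univ)
        (Set.inter_subset_right.trans (hχ.subset.trans Set.inter_subset_left))
      have e1 : (fun x => ∑ l, a p q l x * v l x)
          = fun x => χ x • (pd q ρ x * v p x - pd p ρ x * v q x) := by
        funext x
        simp only [ha_def, mul_sub, sub_mul, Finset.sum_sub_distrib, smul_eq_mul]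
        simp [mul_assoc]
      have hpa : ∀ l x, pd i (a p q l) x
          = pd i χ x * (pd q ρ x * (if l = p then 1 else 0) - pd p ρ x * (if l = q then 1 else 0))
            + χ x * (pd i (pd q ρ) x * (if l = p then 1 else 0)
              - pd i (pd p ρ) x * (if l = q then 1 else 0)) := fun l x => by
        simp only [ha_def]
        rw [pd_mul hχ.smooth (hbs p q l)]
        rw [pd_sub ((contDiff_pd hρ q).mul contDiff_const) ((contDiff_pd hρ p).mul contDiff_const),
          pd_mul_const (contDiff_pd hρ q), pd_mul_const (contDiff_pd hρ p)]
      have e2 : (fun x => ∑ l, (pd i (a p q l) x * v l x + a p q l x * w l i x))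
          = fun x => pd i χ x • (pd q ρ x * v p x - pd p ρ x * v q x)
            + χ x • (pd i (pd q ρ) x * v p x + pd q ρ x * w p i x
              - (pd i (pd p ρ) x * v q x + pd p ρ x * w q i x)) := by
        funext x
        simp only [hpa]
        simp only [ha_def, mul_sub, sub_mul, add_mul, Finset.sum_sub_distrib,
          Finset.sum_add_distrib, smul_eq_mul]
        simp only [mul_ite, ite_mul, mul_one, mul_zero, zero_mul, Finset.sum_ite_eq',
          Finset.mem_univ, if_true]
        ring
      rw [e1, e2]; exact h2) k
    have e3 : ∀ x, ∑ l, a p q l x * w l k x = A p q k x := fun x => by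
      simp only [ha_def, hA, mul_sub, sub_mul, Finset.sum_sub_distrib]
      simp only [mul_ite, ite_mul, mul_one, mul_zero, zero_mul, Finset.sum_ite_eq',
        Finset.mem_univ, if_true]
      ring
    simpa only [e3] using h1
  have hAi : ∀ p q k, Integrable fun x => A p q k x ^ 2 := fun p q k => by
    have h2 : ∀ p q : Fin n, MemLp (fun x => (χ x * pd q ρ x) * w p k x) 2 := fun p q =>
      (hχu.mul_right (contDiff_pd hρ q)).memLp_smul (h.memW p k)
    have h3 : A p q k = fun x => (χ x * pd q ρ x) * w p k x - (χ x * pd p ρ x) * w q k x := by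
      funext x; simp only [hA]; ring
    rw [h3]
    exact ((h2 p q).sub (h2 q p)).integrable_sq
  have hAsum : Integrable fun x => ∑ τ : Fin n × Fin n × Fin n, A τ.1 τ.2.1 τ.2.2 x ^ 2 :=
    integrable_finsetSum _ fun τ _ => hAi τ.1 τ.2.1 τ.2.2
  set P : E n → ℝ := fun x =>
    ∑ τ : Fin n × Fin n × Fin n, A τ.1 τ.2.1 τ.2.2 x ^ 2 + (∑ k, w k k x) ^ 2 with hP
  have hPi : Integrable P := hAsum.add h.memLap.integrable_sq
  have hA0 : ∀ x, 0 ≤ ∑ τ : Fin n × Fin n × Fin n, A τ.1 τ.2.1 τ.2.2 x ^ 2 := fun x => by positivity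
  have hP0 : ∀ x, 0 ≤ P x := fun x => add_nonneg (hA0 x) (sq_nonneg _)
  -- the remaining second derivative is recovered algebraically from the Laplacian
  have hpt : ∀ᵐ x ∂(volume.restrict V), w j k x ^ 2 ≤ C' ^ 2 * P x := by
    have hsy : ∀ᵐ x ∂(volume.restrict V), ∀ i j, w i j x = w j i x :=
      ae_restrict_of_ae (ae_all_iff.2 fun i => ae_all_iff.2 fun j => h.symm hΩ i j)
    filter_upwards [ae_restrict_mem hVo.measurableSet, hsy] with x hx hsx
    have hxt : x ∈ tsupport χ := subset_tsupport _ (by simp [hχV x hx])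
    have hcl : c ≤ |pd l ρ x| := by
      have h4 := hc x (hVU hx).2
      have h5 : |s| = 1 := by rcases hs1 with h | h <;> simp [h]
      calc c ≤ |s * pd l ρ x| := h4.trans (le_abs_self _)
        _ = _ := by rw [abs_mul, h5, one_mul]
    have h6 := sq_le_of_tangential (N := fun i => pd i ρ x) (W := fun i j => w i j x) (l := l)
      (P := √(P x)) hsx (fun i => hM i x hxt) hc0 hcl (fun p q k => by
        refine Real.abs_le_sqrt ?_
        have h7 : (pd q ρ x * w p k x - pd p ρ x * w q k x) ^ 2 = A p q k x ^ 2 := by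
          simp [hA, hχV x hx]
        rw [h7]
        have g1 := Finset.single_le_sum
          (f := fun τ : Fin n × Fin n × Fin n => A τ.1 τ.2.1 τ.2.2 x ^ 2)
          (fun _ _ => sq_nonneg _) (Finset.mem_univ (p, q, k))
        exact g1.trans (le_add_of_nonneg_right (sq_nonneg _)))
      (Real.abs_le_sqrt (le_add_of_nonneg_left (hA0 x))) j k
    have h8 := pow_le_pow_left₀ (abs_nonneg _) h6 2
    rw [sq_abs] at h8
    refine h8.trans (le_of_eq ?_)
    rw [← mul_assoc, mul_pow, Real.sq_sqrt (hP0 x)]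
  calc ∫ x in V, w j k x ^ 2 ≤ ∫ x in V, C' ^ 2 * P x :=
        integral_mono_ae (h.memW j k).integrable_sq.integrableOn (hPi.const_mul _).integrableOn hpt
    _ ≤ ∫ x, C' ^ 2 * P x := setIntegral_le_integral (hPi.const_mul _)
        (Eventually.of_forall fun x => mul_nonneg (sq_nonneg _) (hP0 x))
    _ = C' ^ 2 * (∑ τ : Fin n × Fin n × Fin n, (∫ x, A τ.1 τ.2.1 τ.2.2 x ^ 2)
          + ∫ x, (∑ k, w k k x) ^ 2) := by
        rw [integral_const_mul, integral_add hAsum h.memLap.integrable_sq,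
          integral_finsetSum _ fun τ _ => hAi τ.1 τ.2.1 τ.2.2]
    _ ≤ C' ^ 2 * (∑ τ : Fin n × Fin n × Fin n, (C τ.1 τ.2.1 * ∫ x, L x) + ∫ x, L x) := by
        refine mul_le_mul_of_nonneg_left (add_le_add ?_ ?_) (sq_nonneg _)
        · exact Finset.sum_le_sum fun τ _ => hAbound τ.1 τ.2.1 τ.2.2
        · exact integral_mono h.memLap.integrable_sq hLi fun x =>
            le_add_of_nonneg_left (by positivity)
    _ = _ := by
        rw [← Finset.sum_mul]
        ring

/-- The a priori estimate: in `H²(Ω) ∩ H¹₀(Ω)` the `H²` norm is bounded by the `L²` norm of the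
Laplacian. -/
theorem exists_apriori_bound [NeZero n] (hΩ : IsOpen Ω) (hb : Bornology.IsBounded Ω)
    (hs : HasSmoothBoundary Ω) :
    ∃ C, 0 ≤ C ∧ ∀ (u : E n → ℝ) (v : Fin n → E n → ℝ) (w : Fin n → Fin n → E n → ℝ),
      IsDirichletH2 Ω u v w →
      (∫ x, u x ^ 2) + ∑ i, (∫ x, v i x ^ 2) + ∑ i, ∑ j, (∫ x, w i j x ^ 2)
        ≤ C * ∫ x, (∑ k, w k k x) ^ 2 := by
  have hloc : ∀ x ∈ closure Ω, ∃ V ∈ 𝓝 x, ∃ C, 0 ≤ C ∧ ∀ (u : E n → ℝ) (v : Fin n → E n → ℝ)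
      (w : Fin n → Fin n → E n → ℝ), IsDirichletH2 Ω u v w → ∀ j k,
      ∫ x in V, w j k x ^ 2 ≤ C * ∫ x, (∑ k, v k x ^ 2 + (∑ k, w k k x) ^ 2) := by
    intro x hx
    by_cases hxΩ : x ∈ Ω
    · exact exists_interior_bound hΩ hb hs hxΩ
    · exact exists_boundary_bound hΩ hb hs (by rw [hΩ.frontier_eq]; exact ⟨hx, hxΩ⟩)
  choose! V hV C hC0 hC using hloc
  obtain ⟨t, htΩ, ht⟩ := hb.isCompact_closure.elim_nhds_subcover (fun x => interior (V x))
    fun x hx => interior_mem_nhds.2 (hV x hx)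
  obtain ⟨R, hR, hΩR⟩ : ∃ R > 0, ∀ x ∈ Ω, ‖x‖ ≤ R := hb.exists_pos_norm_le
  set Cp := (3 * R) ^ 2 with hCp
  set Ct := ∑ x ∈ t, C x with hCt
  have hCt0 : 0 ≤ Ct := Finset.sum_nonneg fun x hx => hC0 x (htΩ x hx)
  refine ⟨Cp * Cp + Cp + n * (n * (Ct * (Cp + 1))), by positivity, fun u v w h => ?_⟩
  set F := ∫ x, (∑ k, w k k x) ^ 2 with hF
  set S := ∑ i, ∫ x, v i x ^ 2 with hS
  have hF0 : 0 ≤ F := integral_nonneg fun x => sq_nonneg _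
  have hv0 : ∀ i, 0 ≤ ∫ x, v i x ^ 2 := fun i => integral_nonneg fun x => sq_nonneg _
  have hS0 : 0 ≤ S := Finset.sum_nonneg fun i _ => hv0 i
  have hu0 : 0 ≤ ∫ x, u x ^ 2 := integral_nonneg fun x => sq_nonneg _
  -- Poincaré
  have hpo : ∫ x, u x ^ 2 ≤ Cp * S := by
    refine (poincare hR h.memU (h.memV 0) (h.partialU 0) fun x hx => h.zeroU x fun hxΩ =>
      absurd (hΩR x hxΩ) (not_le.2 hx)).trans ?_
    exact mul_le_mul_of_nonneg_left (Finset.single_le_sum (f := fun i => ∫ x, v i x ^ 2)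
      (fun i _ => hv0 i) (Finset.mem_univ 0)) (by positivity)
  -- the energy identity `∫ |∇u|² = -∫ u Δu`
  have hen := integral_eq_zero_of_test hΩ hb hs (q₀ := fun x => ∑ k, w k k x) (q := v)
    h.memLap h.memV (fun φ hφ => by
      have h1 : ∀ i, ∫ x, (w i i x * φ x + v i x * pd i φ x) = 0 := fun i => by
        have h2 := h.partialV i i φ hφ
        have i1 := hφ.integrable (h.locW i i)
        have i2 := (hφ.pd i).integrable (h.locV i)
        simp only [smul_eq_mul, mul_comm (φ _), mul_comm (pd i φ _)] at h2 i1 i2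
        rw [integral_add i1 i2, h2, add_neg_cancel]
      have h3 : ∀ i, Integrable fun x => w i i x * φ x + v i x * pd i φ x := fun i => by
        have i1 := hφ.integrable (h.locW i i)
        have i2 := (hφ.pd i).integrable (h.locV i)
        simp only [smul_eq_mul, mul_comm (φ _), mul_comm (pd i φ _)] at i1 i2
        exact i1.add i2
      simp only [Finset.sum_mul, ← Finset.sum_add_distrib]
      rw [integral_finsetSum _ fun i _ => h3 i]
      exact Finset.sum_eq_zero fun i _ => h1 i)
    h.memU h.memV h.partialU h.zeroU
  rw [integral_add (integrable_mul_of_memLp h.memLap h.memU) (integrable_finsetSum _ fun i _ =>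
    integrable_mul_of_memLp (h.memV i) (h.memV i)), integral_finsetSum _ fun i _ =>
    integrable_mul_of_memLp (h.memV i) (h.memV i)] at hen
  simp only [← sq] at hen
  have hcs := abs_integral_mul_le h.memLap h.memU
  -- Cauchy-Schwarz and the Poincaré inequality absorb one factor `√S`
  have hSF : S ≤ Cp * F := by
    have h4 : S ≤ √F * √(Cp * S) := by
      have h5 := neg_abs_le (∫ x, (∑ k, w k k x) * u x)
      have h6 : √F * √(∫ x, u x ^ 2) ≤ √F * √(Cp * S) :=
        mul_le_mul_of_nonneg_left (Real.sqrt_le_sqrt hpo) (Real.sqrt_nonneg _)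
      linarith
    rw [← Real.sqrt_mul hF0] at h4
    rcases hS0.eq_or_lt with h7 | h7
    · rw [← h7]; positivity
    · have h8 := Real.le_sqrt' h7 |>.1 h4
      have h9 : S * S ≤ (Cp * F) * S := by nlinarith
      exact le_of_mul_le_mul_right h9 h7
  -- the local bounds for the second derivatives are summed over a finite cover of `closure Ω`
  have hw : ∀ j k, ∫ x, w j k x ^ 2 ≤ Ct * (S + F) := by
    intro j k
    have hL : ∫ x, (∑ k, v k x ^ 2 + (∑ k, w k k x) ^ 2) = S + F := by
      rw [integral_add (integrable_finsetSum _ fun k _ => (h.memV k).integrable_sq)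
        h.memLap.integrable_sq, integral_finsetSum _ fun k _ => (h.memV k).integrable_sq]
    have hint := (h.memW j k).integrable_sq
    have hind : ∀ x ∈ t, Integrable ((interior (V x)).indicator fun y => w j k y ^ 2) :=
      fun x _ => hint.indicator isOpen_interior.measurableSet
    calc ∫ x, w j k x ^ 2
        ≤ ∫ y, ∑ x ∈ t, (interior (V x)).indicator (fun y => w j k y ^ 2) y := by
          refine integral_mono hint (integrable_finsetSum _ hind) fun y => ?_
          have hnn : ∀ x ∈ t, 0 ≤ (interior (V x)).indicator (fun y => w j k y ^ 2) y :=
            fun x _ => Set.indicator_nonneg (fun _ _ => sq_nonneg _) _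
          by_cases hy : y ∈ Ω
          · obtain ⟨x, hx, hyx⟩ := Set.mem_iUnion₂.1 (ht (subset_closure hy))
            have h10 := Finset.single_le_sum hnn hx
            rwa [Set.indicator_of_mem hyx] at h10
          · rw [h.zeroW j k y hy, zero_pow two_ne_zero]
            exact Finset.sum_nonneg hnn
      _ = ∑ x ∈ t, ∫ y in interior (V x), w j k y ^ 2 := by
          rw [integral_finsetSum _ hind]
          exact Finset.sum_congr rfl fun x _ => integral_indicator isOpen_interior.measurableSet
      _ ≤ ∑ x ∈ t, C x * (S + F) := Finset.sum_le_sum fun x hx => by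
          rw [← hL]
          refine le_trans ?_ (hC x (htΩ x hx) u v w h j k)
          exact setIntegral_mono_set hint.integrableOn
            (Eventually.of_forall fun _ => sq_nonneg _) interior_subset.eventuallyLE
      _ = Ct * (S + F) := by rw [← Finset.sum_mul]
  have hw2 : ∑ i, ∑ j, ∫ x, w i j x ^ 2 ≤ n * (n * (Ct * (Cp + 1))) * F := by
    calc ∑ i, ∑ j, ∫ x, w i j x ^ 2 ≤ ∑ _i : Fin n, ∑ _j : Fin n, Ct * (Cp + 1) * F :=
          Finset.sum_le_sum fun i _ => Finset.sum_le_sum fun j _ => (hw i j).trans (by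
            rw [mul_assoc]
            exact mul_le_mul_of_nonneg_left (by linarith) hCt0)
      _ = _ := by
          simp only [Finset.sum_const, Finset.card_univ, Fintype.card_fin, nsmul_eq_mul]; ring
  have hCp0 : 0 ≤ Cp := by positivity
  nlinarith [mul_le_mul_of_nonneg_left hSF hCp0]

end APriori


/-! ### Slicing along a coordinate direction -/

section Slicing

variable {m : ℕ}

/-- The point of `ℝᵐ⁺¹` with `l`-th coordinate `t` and remaining coordinates `x`. -/
def insertCoord (l : Fin (m + 1)) (t : ℝ) (x : E m) : E (m + 1) :=
  WithLp.toLp 2 (l.insertNth (α := fun _ => ℝ) t fun j => x j)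

/-- The projection of `ℝᵐ⁺¹` to `ℝᵐ` which forgets the `l`-th coordinate. -/
def removeCoord (l : Fin (m + 1)) (y : E (m + 1)) : E m :=
  WithLp.toLp 2 fun j => y (l.succAbove j)

@[simp] lemma insertCoord_same (l : Fin (m + 1)) (t : ℝ) (x : E m) : insertCoord l t x l = t := by
  simp [insertCoord]

@[simp] lemma removeCoord_insertCoord (l : Fin (m + 1)) (t : ℝ) (x : E m) :
    removeCoord l (insertCoord l t x) = x := by
  ext j
  simp [insertCoord, removeCoord]

@[simp] lemma insertCoord_removeCoord (l : Fin (m + 1)) (y : E (m + 1)) :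
    insertCoord l (y l) (removeCoord l y) = y := by
  ext j
  refine l.succAboveCases ?_ (fun j => ?_) j <;> simp [insertCoord, removeCoord]

lemma insertCoord_sub (l : Fin (m + 1)) (t t' : ℝ) (x x' : E m) :
    insertCoord l t x - insertCoord l t' x' = insertCoord l (t - t') (x - x') := by
  ext j
  refine l.succAboveCases ?_ (fun j => ?_) j <;> simp [insertCoord]

lemma insertCoord_add_smul (l : Fin (m + 1)) (t τ : ℝ) (x : E m) :
    insertCoord l t x + τ • e l = insertCoord l (t + τ) x := by
  ext j
  refine l.succAboveCases ?_ (fun j => ?_) j <;> simp [insertCoord]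

lemma norm_insertCoord_sq (l : Fin (m + 1)) (t : ℝ) (x : E m) :
    ‖insertCoord l t x‖ ^ 2 = t ^ 2 + ‖x‖ ^ 2 := by
  rw [EuclideanSpace.norm_sq_eq, EuclideanSpace.norm_sq_eq, Fin.sum_univ_succAbove _ l]
  simp [insertCoord]

lemma norm_insertCoord_le (l : Fin (m + 1)) (t : ℝ) (x : E m) :
    ‖insertCoord l t x‖ ≤ |t| + ‖x‖ := by
  refine abs_le_of_sq_le_sq' ?_ (by positivity) |>.2
  rw [norm_insertCoord_sq, ← sq_abs t]
  nlinarith [abs_nonneg t, norm_nonneg x, mul_nonneg (abs_nonneg t) (norm_nonneg x)]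

lemma norm_le_norm_insertCoord (l : Fin (m + 1)) (t : ℝ) (x : E m) :
    ‖x‖ ≤ ‖insertCoord l t x‖ := by
  refine abs_le_of_sq_le_sq' ?_ (norm_nonneg _) |>.2
  rw [norm_insertCoord_sq]
  nlinarith [sq_nonneg t]

lemma removeCoord_sub (l : Fin (m + 1)) (y y' : E (m + 1)) :
    removeCoord l y - removeCoord l y' = removeCoord l (y - y') := by
  ext j; simp [removeCoord]

lemma lipschitzWith_removeCoord (l : Fin (m + 1)) : LipschitzWith 1 (removeCoord l) := by
  refine LipschitzWith.of_dist_le_mul fun y y' => ?_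
  rw [dist_eq_norm, dist_eq_norm, removeCoord_sub, NNReal.coe_one, one_mul]
  conv_rhs => rw [← insertCoord_removeCoord l (y - y')]
  exact norm_le_norm_insertCoord _ _ _

lemma continuous_insertCoord (l : Fin (m + 1)) : Continuous fun p : E m × ℝ => insertCoord l p.2 p.1 := by
  refine (PiLp.continuous_toLp 2 _).comp (continuous_pi fun j => ?_)
  refine l.succAboveCases ?_ (fun j => ?_) j
  · simpa using continuous_snd
  · simp only [Fin.insertNth_apply_succAbove]
    exact (PiLp.continuous_apply 2 _ j).comp continuous_fst

/-- Fubini coordinates: `ℝᵐ⁺¹ = ℝᵐ × ℝ`, the last factor being the `l`-th coordinate. -/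
lemma exists_slicing (l : Fin (m + 1)) :
    ∃ f : E (m + 1) ≃ᵐ E m × ℝ, MeasurePreserving f volume (volume.prod volume) ∧
      ∀ x t, f.symm (x, t) = insertCoord l t x := by
  have h1 := EuclideanSpace.volume_preserving_symm_measurableEquiv_toLp (Fin (m + 1))
  have h2 := volume_preserving_piFinSuccAbove (fun _ : Fin (m + 1) => ℝ) l
  have h3 : MeasurePreserving (MeasurableEquiv.prodComm : ℝ × (Fin m → ℝ) ≃ᵐ (Fin m → ℝ) × ℝ)
      (volume.prod volume) (volume.prod volume) := Measure.measurePreserving_swap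
  have h4 : MeasurePreserving (Prod.map (MeasurableEquiv.toLp 2 (Fin m → ℝ)) (MeasurableEquiv.refl ℝ))
      (volume.prod volume) (volume.prod volume) :=
    (EuclideanSpace.volume_preserving_symm_measurableEquiv_toLp (Fin m)).symm.prod
      (MeasurePreserving.id volume)
  refine ⟨(((MeasurableEquiv.toLp 2 (Fin (m + 1) → ℝ)).symm.trans
    (MeasurableEquiv.piFinSuccAbove (fun _ => ℝ) l)).trans MeasurableEquiv.prodComm).trans
    ((MeasurableEquiv.toLp 2 (Fin m → ℝ)).prodCongr (MeasurableEquiv.refl ℝ)), ?_, ?_⟩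
  · exact ((h4.comp h3).comp h2).comp h1
  · intro x t
    rfl

/-- Iterated integration with the integral over the `l`-th coordinate inside. -/
lemma integral_slices (l : Fin (m + 1)) {F : E (m + 1) → ℝ} (hF : Integrable F) :
    ∫ y, F y = ∫ x : E m, ∫ t : ℝ, F (insertCoord l t x) := by
  obtain ⟨f, hf, hfs⟩ := exists_slicing l
  have h1 := (hf.symm f).integral_comp' (f := f.symm) F
  have h2 : Integrable (fun p => F (f.symm p)) (volume.prod volume) :=
    (hf.symm f).integrable_comp_of_integrable hF
  rw [← h1, integral_prod _ h2]
  simp only [hfs]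

/-- Graphs over `ℝᵐ` are null sets. -/
lemma volume_graph_eq_zero (l : Fin (m + 1)) {S : Set (E (m + 1))} (hS : MeasurableSet S)
    {γ : E m → ℝ} (h : ∀ y ∈ S, y l = γ (removeCoord l y)) : volume S = 0 := by
  obtain ⟨f, hf, hfs⟩ := exists_slicing l
  rw [← (hf.symm f).measure_preimage hS.nullMeasurableSet,
    Measure.measure_prod_null (f.symm.measurable hS)]
  refine Eventually.of_forall fun x => ?_
  refine measure_mono_null (t := {γ x}) (fun t ht => ?_) (by simp)
  have h1 : f.symm (x, t) ∈ S := ht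
  rw [hfs] at h1
  simpa using h _ h1

end Slicing

/-! ### Level sets as Lipschitz graphs -/

section Graph

variable {m : ℕ}

/-- A level set of a function which is strictly increasing in the `l`-th coordinate is a Lipschitz
graph over the other coordinates. -/
lemma exists_graph {ρ : E (m + 1) → ℝ} (hρ : ContDiff ℝ ∞ ρ) {x₀ : E (m + 1)} {r c : ℝ}
    {l : Fin (m + 1)} (hr : 0 < r) (hc0 : 0 < c) (h0 : ρ x₀ = 0)
    (hc : ∀ x ∈ Metric.ball x₀ r, c ≤ pd l ρ x) :
    ∃ (τ δ : ℝ) (γ : E m → ℝ) (L : NNReal), 0 < τ ∧ 0 < δ ∧ LipschitzWith L γ ∧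
      (∀ y : E (m + 1), |y l - x₀ l| < τ → removeCoord l y ∈ Metric.ball (removeCoord l x₀) δ →
        y ∈ Metric.ball x₀ r) ∧
      ∀ x ∈ Metric.ball (removeCoord l x₀) δ, |γ x - x₀ l| < τ ∧ ∀ t, |t - x₀ l| < τ →
        (ρ (insertCoord l t x) < 0 ↔ t < γ x) ∧ (ρ (insertCoord l t x) = 0 ↔ t = γ x) := by
  set B := Metric.ball x₀ (r / 2) with hB
  have hBr : B ⊆ Metric.ball x₀ r := Metric.ball_subset_ball (by linarith)
  obtain ⟨M, hM⟩ : ∃ M, ∀ x ∈ Metric.closedBall x₀ (r / 2), ‖fderiv ℝ ρ x‖ ≤ M :=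
    IsCompact.exists_bound_of_continuousOn (isCompact_closedBall _ _)
      (hρ.continuous_fderiv (by simp)).continuousOn
  have hM0 : 0 ≤ M := (norm_nonneg _).trans (hM x₀ (Metric.mem_closedBall_self (by positivity)))
  set τ := r / 4 with hτ
  have hτ0 : 0 < τ := by positivity
  -- `δ` is so small that a horizontal shift by `δ` changes `ρ` by less than the vertical shift
  -- `τ / 2` does
  set δ := min (r / 8) (c * (τ / 2) / (M + 1)) with hδ
  have hδ0 : 0 < δ := by positivity
  set x₀' := removeCoord l x₀ with hx₀'
  have hbox : ∀ t x, |t - x₀ l| ≤ τ → x ∈ Metric.ball x₀' δ → insertCoord l t x ∈ B := by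
    intro t x ht hx
    rw [hB, mem_ball_iff_norm]
    conv_lhs => rw [← insertCoord_removeCoord l x₀]
    rw [insertCoord_sub]
    refine (norm_insertCoord_le _ _ _).trans_lt ?_
    rw [mem_ball_iff_norm] at hx
    have := min_le_left (r / 8) (c * (τ / 2) / (M + 1))
    linarith
  -- monotonicity in the `l`-th coordinate and Lipschitz continuity in the others
  have hmono : ∀ t t' x, |t - x₀ l| ≤ τ → |t' - x₀ l| ≤ τ → x ∈ Metric.ball x₀' δ → t ≤ t' →
      ρ (insertCoord l t x) + c * (t' - t) ≤ ρ (insertCoord l t' x) := by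
    intro t t' x ht ht' hx htt
    have h1 := le_increment (s := 1) (τ := t' - t) hρ (by linarith)
      (fun x hx => by rw [one_mul]; exact hc x hx) (hBr (hbox t x ht hx))
      (by rw [one_mul, insertCoord_add_smul]; simpa using hBr (hbox t' x ht' hx))
    rw [one_mul, insertCoord_add_smul, add_sub_cancel] at h1
    exact h1
  have hlip : ∀ t x x', |t - x₀ l| ≤ τ → x ∈ Metric.ball x₀' δ → x' ∈ Metric.ball x₀' δ →
      |ρ (insertCoord l t x) - ρ (insertCoord l t x')| ≤ M * ‖x - x'‖ := by
    intro t x x' ht hx hx'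
    have h1 := Convex.norm_image_sub_le_of_norm_fderiv_le (𝕜 := ℝ) (f := ρ) (C := M) (s := B)
      (fun x _ => hρ.differentiable (by simp) x)
      (fun x hx => hM x (Metric.ball_subset_closedBall hx)) (convex_ball _ _)
      (hbox t x' ht hx') (hbox t x ht hx)
    rw [insertCoord_sub, sub_self] at h1
    have h2 := norm_insertCoord_le l 0 (x - x')
    rw [abs_zero, zero_add] at h2
    exact h1.trans (mul_le_mul_of_nonneg_left h2 hM0)
  -- `ρ` changes sign on each vertical segment, so the intermediate value theorem gives the height
  have hends : ∀ x ∈ Metric.ball x₀' δ, ρ (insertCoord l (x₀ l - τ / 2) x) < 0 ∧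
      0 < ρ (insertCoord l (x₀ l + τ / 2) x) := by
    intro x hx
    have hx0 : x₀' ∈ Metric.ball x₀' δ := Metric.mem_ball_self hδ0
    have a1 : |x₀ l - τ / 2 - x₀ l| ≤ τ := by rw [abs_le]; constructor <;> linarith
    have a2 : |x₀ l + τ / 2 - x₀ l| ≤ τ := by rw [abs_le]; constructor <;> linarith
    have a0 : |x₀ l - x₀ l| ≤ τ := by simpa using hτ0.le
    have h1 := hmono _ _ x₀' a1 a0 hx0 (by linarith)
    have h2 := hmono _ _ x₀' a0 a2 hx0 (by linarith)
    rw [insertCoord_removeCoord, h0] at h1 h2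
    have h3 := (abs_le.1 (hlip _ x x₀' a1 hx hx0))
    have h4 := (abs_le.1 (hlip _ x x₀' a2 hx hx0))
    have h5 : M * ‖x - x₀'‖ < c * (τ / 2) := by
      rw [mem_ball_iff_norm] at hx
      have h6 : ‖x - x₀'‖ < c * (τ / 2) / (M + 1) := hx.trans_le (min_le_right _ _)
      rw [lt_div_iff₀ (by linarith)] at h6
      nlinarith [norm_nonneg (x - x₀')]
    constructor <;> linarith [h3.1, h3.2, h4.1, h4.2]
  have hex : ∀ x ∈ Metric.ball x₀' δ, ∃ t, |t - x₀ l| < τ ∧ ρ (insertCoord l t x) = 0 := by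
    intro x hx
    have hcont : ContinuousOn (fun t => ρ (insertCoord l t x)) (Set.Icc (x₀ l - τ / 2) (x₀ l + τ / 2)) :=
      (hρ.continuous.comp ((continuous_insertCoord l).comp
        (continuous_const.prodMk continuous_id))).continuousOn
    obtain ⟨t, ht, hρt⟩ := intermediate_value_Icc (by linarith) hcont
      ⟨(hends x hx).1.le, (hends x hx).2.le⟩
    exact ⟨t, by rw [abs_lt]; constructor <;> linarith [ht.1, ht.2], hρt⟩
  choose! γ₀ hγ₀ hργ₀ using hex
  -- the Lipschitz constant is the ratio of the horizontal to the vertical slope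
  have hLip0 : LipschitzOnWith ⟨M / c, by positivity⟩ γ₀ (Metric.ball x₀' δ) := by
    refine LipschitzOnWith.of_dist_le_mul fun x hx x' hx' => ?_
    rw [Real.dist_eq, dist_eq_norm]
    change |γ₀ x - γ₀ x'| ≤ M / c * ‖x - x'‖
    rw [div_mul_eq_mul_div, le_div_iff₀ hc0]
    have h1 := abs_le.1 (hlip (γ₀ x) x x' (hγ₀ x hx).le hx hx')
    rw [hργ₀ x hx] at h1
    have h2 : |γ₀ x - γ₀ x'| * c ≤ |ρ (insertCoord l (γ₀ x) x')| := by
      rcases le_total (γ₀ x) (γ₀ x') with h | h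
      · have h3 := hmono _ _ x' (hγ₀ x hx).le (hγ₀ x' hx').le hx' h
        rw [hργ₀ x' hx'] at h3
        rw [abs_of_nonpos (by linarith)]
        exact le_trans (by linarith) (neg_le_abs _)
      · have h3 := hmono _ _ x' (hγ₀ x' hx').le (hγ₀ x hx).le hx' h
        rw [hργ₀ x' hx'] at h3
        rw [abs_of_nonneg (by linarith)]
        exact le_trans (by linarith) (le_abs_self _)
    refine h2.trans (abs_le.2 ⟨by linarith [h1.2], by linarith [h1.1]⟩)
  obtain ⟨γ, hγL, hγe⟩ := hLip0.extend_real
  refine ⟨τ, δ, γ, _, hτ0, hδ0, hγL, fun y hy hy' => ?_, fun x hx => ?_⟩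
  · have := hbox (y l) _ hy.le hy'
    rw [insertCoord_removeCoord] at this
    exact hBr this
  · rw [← hγe hx]
    refine ⟨hγ₀ x hx, fun t ht => ?_⟩
    have hγx := hγ₀ x hx
    have h0x := hργ₀ x hx
    rcases lt_trichotomy t (γ₀ x) with h | h | h
    · have h3 := hmono _ _ x ht.le hγx.le hx h.le
      have h4 : 0 < c * (γ₀ x - t) := mul_pos hc0 (by linarith)
      exact ⟨⟨fun _ => h, fun _ => by linarith⟩, ⟨fun h' => by linarith, fun h' => by linarith⟩⟩
    · subst h
      simp [h0x]
    · have h3 := hmono _ _ x hγx.le ht.le hx h.le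
      have h4 : 0 < c * (t - γ₀ x) := mul_pos hc0 (by linarith)
      exact ⟨⟨fun _ => by linarith, fun _ => by linarith⟩,
        ⟨fun h' => by linarith, fun h' => by linarith⟩⟩

end Graph


/-! ### The divergence theorem near a boundary point -/

section Green

variable {m : ℕ}

/-- Lipschitz images under the normalized Hausdorff measure. -/
lemma LipschitzWith.euclideanHausdorffMeasure_image_le {a b : ℕ} {K : NNReal} {f : E a → E b}
    (hf : LipschitzWith K f) (d : ℕ) (s : Set (E a)) :
    (μHE[d] : Measure (E b)) (f '' s) ≤ (K : ℝ≥0∞) ^ d * (μHE[d] : Measure (E a)) s := by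
  rw [Measure.euclideanHausdorffMeasure_def, Measure.euclideanHausdorffMeasure_def]
  have h := hf.hausdorffMeasure_image_le (Nat.cast_nonneg d) s
  rw [ENNReal.rpow_natCast] at h
  rw [Measure.smul_apply, Measure.smul_apply, ENNReal.smul_def, ENNReal.smul_def, smul_eq_mul,
    smul_eq_mul, mul_left_comm]
  exact mul_le_mul_right h _

/-- Integration by parts against a smooth function. -/
lemma integral_mul_pd {n : ℕ} {U : Set (E n)} {η θ : E n → ℝ} (hη : ContDiff ℝ ∞ η)
    (hθ : IsTest U θ) (i : Fin n) : ∫ x, η x * pd i θ x = -∫ x, pd i η x * θ x := by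
  have hi : ∀ {a b : E n → ℝ}, ContDiff ℝ ∞ a → IsTest U b → Integrable fun x => a x * b x :=
    fun ha hb => (hb.mul_left ha).continuous.integrable_of_hasCompactSupport (hb.mul_left ha).compact
  exact integral_mul_fderiv_eq_neg_fderiv_mul_of_integrable (hi (contDiff_pd hη i) hθ)
    (hi hη (hθ.pd i)) (hi hη hθ) (fun x _ => hη.differentiable (by simp) x)
    (fun x _ => hθ.smooth.differentiable (by simp) x)

/-- Vector fields tangential to the level sets of `ρ` have no flux through `{ρ = 0}`. -/
lemma setIntegral_tangential {n : ℕ} {U : Set (E n)} {ρ ψ : E n → ℝ} (hρ : ContDiff ℝ ∞ ρ)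
    (hψ : IsTest U ψ) (i l : Fin n) :
    ∫ x in {x | ρ x < 0}, pd i (fun y => ψ y * pd l ρ y) x
      = ∫ x in {x | ρ x < 0}, pd l (fun y => ψ y * pd i ρ y) x := by
  have ht : ∀ j, IsTest U (fun y => ψ y * pd j ρ y) := fun j => hψ.mul_right (contDiff_pd hρ j)
  have hint : ∀ i j, Integrable (pd i (fun y => ψ y * pd j ρ y)) := fun i j =>
    ((ht j).pd i).continuous.integrable_of_hasCompactSupport ((ht j).pd i).compact
  have hmeas : MeasurableSet {x | ρ x < 0} := (isOpen_lt hρ.continuous continuous_const).measurableSet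
  rw [← sub_eq_zero, ← integral_sub (hint i l).integrableOn (hint l i).integrableOn,
    ← integral_indicator hmeas]
  set F : E n → ℝ := fun x => pd i (fun y => ψ y * pd l ρ y) x - pd l (fun y => ψ y * pd i ρ y) x
    with hF
  have hFi : Integrable F := (hint i l).sub (hint l i)
  obtain ⟨B, D, -, -, -, hD⟩ := exists_pd_cutoff hρ
  -- both terms give `∫ ψ D ∂ᵢρ ∂ₗρ`, since the gradient of the cut-off is parallel to `∇ρ`
  have hz : ∀ k, ∫ x, cutoff ρ k x * F x = 0 := by
    intro k
    have hη := contDiff_cutoff hρ k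
    have hi : ∀ a b, Integrable fun x => cutoff ρ k x * pd a (fun y => ψ y * pd b ρ y) x :=
      fun a b => (((ht b).pd a).mul_left hη).continuous.integrable_of_hasCompactSupport
        (((ht b).pd a).mul_left hη).compact
    simp only [hF, mul_sub]
    rw [integral_sub (hi i l) (hi l i), integral_mul_pd hη (ht l), integral_mul_pd hη (ht i),
      sub_eq_zero]
    congr 1
    refine integral_congr_ae (Eventually.of_forall fun x => ?_)
    simp only [hD]; ring
  have hlim : Tendsto (fun k => ∫ x, cutoff ρ k x * F x) atTop
      (𝓝 (∫ x, {x | ρ x < 0}.indicator F x)) := by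
    refine tendsto_integral_of_dominated_convergence _ (fun k =>
      (contDiff_cutoff hρ k).continuous.aestronglyMeasurable.mul hFi.1) hFi.norm
      (fun k => Eventually.of_forall fun x => ?_) (Eventually.of_forall fun x => ?_)
    · rw [norm_mul]
      exact mul_le_of_le_one_left (norm_nonneg _) (abs_cutoff_le k x)
    · by_cases hx : ρ x < 0
      · rw [Set.indicator_of_mem (show x ∈ {x | ρ x < 0} from hx)]
        simpa using (tendsto_cutoff_of_neg hx).mul_const (F x)
      · rw [Set.indicator_of_notMem (show x ∉ {x | ρ x < 0} from hx)]
        simp only [cutoff_eq_zero (not_lt.1 hx), zero_mul]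
        exact tendsto_const_nhds
  simp only [hz] at hlim
  exact (tendsto_nhds_unique hlim tendsto_const_nhds)

/-- Near a point of `{ρ = 0}` the surface measure is comparable to a measure `μ` for which the
divergence theorem in `{ρ < 0}` holds with the normal field `∇ρ / ∂ₗρ`: the image of Lebesgue
measure on `ℝᵐ` under a parametrization of `{ρ = 0}` as a graph. -/
lemma exists_graph_measure {ρ : E (m + 1) → ℝ} (hρ : ContDiff ℝ ∞ ρ) {x₀ : E (m + 1)} {r c : ℝ}
    {l : Fin (m + 1)} (hr : 0 < r) (hc0 : 0 < c) (h0 : ρ x₀ = 0)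
    (hc : ∀ x ∈ Metric.ball x₀ r, c ≤ pd l ρ x) :
    ∃ (U : Set (E (m + 1))) (μ : Measure (E (m + 1))) (K : NNReal), x₀ ∈ U ∧ IsOpen U ∧
      U ⊆ Metric.ball x₀ r ∧ IsFiniteMeasure μ ∧
      μ ≤ (μHE[m] : Measure (E (m + 1))).restrict ({x | ρ x = 0} ∩ U) ∧
      (μHE[m] : Measure (E (m + 1))).restrict ({x | ρ x = 0} ∩ U) ≤ (K : ℝ≥0∞) • μ ∧
      volume ({x | ρ x = 0} ∩ U) = 0 ∧
      ∀ θ, IsTest U θ → ∀ i, ∫ x in {x | ρ x < 0}, pd i θ x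
        = ∫ x, pd i ρ x / pd l ρ x * θ x ∂μ := by
  obtain ⟨τ, δ, γ, L, hτ, hδ, hγL, hbox, hγ⟩ := exists_graph hρ hr hc0 h0 hc
  set V := Metric.ball (removeCoord l x₀) δ with hV
  set U : Set (E (m + 1)) := {y | |y l - x₀ l| < τ ∧ removeCoord l y ∈ V} with hU
  have hrc : Continuous (removeCoord l) := (lipschitzWith_removeCoord l).continuous
  have hcl : Continuous fun y : E (m + 1) => y l := PiLp.continuous_apply 2 _ l
  have hUo : IsOpen U := (isOpen_lt ((hcl.sub continuous_const).abs) continuous_const).inter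
    (Metric.isOpen_ball.preimage hrc)
  -- the parametrization of the level set as a graph
  set g : E m → E (m + 1) := fun x => insertCoord l (γ x) x with hg
  have hgc : Continuous g := (continuous_insertCoord l).comp
    (continuous_id.prodMk hγL.continuous)
  have hgL : LipschitzWith (L + 1) g := by
    refine LipschitzWith.of_dist_le_mul fun x x' => ?_
    have h1 := hγL.dist_le_mul x x'
    rw [Real.dist_eq] at h1
    rw [dist_eq_norm, insertCoord_sub]
    refine (norm_insertCoord_le _ _ _).trans ?_
    rw [← dist_eq_norm, NNReal.coe_add, NNReal.coe_one]
    linarith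
  have hgU : ∀ x ∈ V, g x ∈ {x | ρ x = 0} ∩ U := fun x hx => by
    refine ⟨((hγ x hx).2 _ (hγ x hx).1).2.2 rfl, ?_, ?_⟩
    · simpa [hg] using (hγ x hx).1
    · simpa [hg] using hx
  have hUg : ∀ y ∈ {x | ρ x = 0} ∩ U, y l = γ (removeCoord l y) := fun y hy => by
    refine (((hγ _ hy.2.2).2 _ hy.2.1).2.1 ?_)
    rw [insertCoord_removeCoord]; exact hy.1
  have hUg' : ∀ y ∈ {x | ρ x = 0} ∩ U, y = g (removeCoord l y) := fun y hy => by
    rw [hg]; simp only; rw [← hUg y hy, insertCoord_removeCoord]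
  have hSm : MeasurableSet ({x | ρ x = 0} ∩ U) :=
    (isClosed_eq hρ.continuous continuous_const).measurableSet.inter hUo.measurableSet
  set μ : Measure (E (m + 1)) := (volume.restrict V).map g with hμ
  have hμapp : ∀ s, MeasurableSet s → μ s = volume (g ⁻¹' s ∩ V) := fun s hs => by
    rw [hμ, Measure.map_apply hgc.measurable hs, Measure.restrict_apply (hgc.measurable hs)]
  have hxU : x₀ ∈ U := ⟨by simpa using hτ, Metric.mem_ball_self hδ⟩
  have hVfin : IsFiniteMeasure (volume.restrict V) :=
    ⟨by rw [Measure.restrict_apply_univ]; exact measure_ball_lt_top⟩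
  refine ⟨U, μ, (L + 1) ^ m, hxU, hUo, fun y hy => hbox y hy.1 hy.2, inferInstance, ?_, ?_,
    volume_graph_eq_zero l hSm hUg, ?_⟩
  · refine Measure.le_iff.2 fun s hs => ?_
    rw [hμapp s hs, Measure.restrict_apply hs]
    -- the projection, which inverts `g`, has Lipschitz constant one
    have h1 : g ⁻¹' s ∩ V ⊆ removeCoord l '' (s ∩ ({x | ρ x = 0} ∩ U)) := fun x hx =>
      ⟨g x, ⟨hx.1, hgU x hx.2⟩, by simp [hg]⟩
    have h2 := LipschitzWith.euclideanHausdorffMeasure_image_le (lipschitzWith_removeCoord l) m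
      (s ∩ ({x | ρ x = 0} ∩ U))
    rw [EuclideanSpace.euclideanHausdorffMeasure_eq_volume] at h2
    refine (measure_mono h1).trans (h2.trans (le_of_eq ?_))
    simp
  · refine Measure.le_iff.2 fun s hs => ?_
    rw [Measure.smul_apply, hμapp s hs, Measure.restrict_apply hs, smul_eq_mul]
    -- `g` itself has Lipschitz constant `L + 1`
    have h1 : s ∩ ({x | ρ x = 0} ∩ U) ⊆ g '' (g ⁻¹' s ∩ V) := fun y hy =>
      ⟨removeCoord l y, ⟨by rw [Set.mem_preimage, ← hUg' y hy.2]; exact hy.1, hy.2.2.2⟩,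
        (hUg' y hy.2).symm⟩
    have h2 := LipschitzWith.euclideanHausdorffMeasure_image_le hgL m (g ⁻¹' s ∩ V)
    rw [EuclideanSpace.euclideanHausdorffMeasure_eq_volume] at h2
    refine (measure_mono h1).trans (h2.trans (le_of_eq ?_))
    rw [ENNReal.coe_pow]
  · -- the component of the divergence theorem in the direction of the graph
    have hmain : ∀ θ, IsTest U θ → ∫ x in {x | ρ x < 0}, pd l θ x = ∫ x, θ x ∂μ := by
      intro θ hθ
      have hmeas : MeasurableSet {x | ρ x < 0} :=
        (isOpen_lt hρ.continuous continuous_const).measurableSet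
      have hint : Integrable ({x | ρ x < 0}.indicator (pd l θ)) :=
        ((hθ.pd l).continuous.integrable_of_hasCompactSupport (hθ.pd l).compact).indicator hmeas
      rw [← integral_indicator hmeas, integral_slices l hint, hμ,
        integral_map hgc.measurable.aemeasurable hθ.continuous.aestronglyMeasurable,
        ← integral_indicator Metric.isOpen_ball.measurableSet]
      congr 1
      funext x
      have hzero : ∀ t, insertCoord l t x ∉ U → θ (insertCoord l t x) = 0 ∧
          pd l θ (insertCoord l t x) = 0 := fun t ht => ⟨hθ.zero_off ht, (hθ.pd l).zero_off ht⟩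
      by_cases hx : x ∈ V
      · rw [Set.indicator_of_mem hx]
        have hline : ContDiff ℝ ∞ fun t : ℝ => insertCoord l t x := by
          have h2 : (fun t : ℝ => insertCoord l t x) = fun t : ℝ => insertCoord l 0 x + t • e l := by
            funext t; rw [insertCoord_add_smul, zero_add]
          rw [h2]
          exact contDiff_const.add (contDiff_id.smul contDiff_const)
        have hd : ∀ t, HasDerivAt (fun t : ℝ => insertCoord l t x) (e l) t := by
          intro t
          have h2 : (fun t : ℝ => insertCoord l t x) = fun t : ℝ => insertCoord l 0 x + t • e l := by
            funext t; rw [insertCoord_add_smul, zero_add]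
          rw [h2]
          simpa using ((hasDerivAt_id t).smul_const (e l : E (m + 1))).const_add (insertCoord l 0 x)
        have hder : deriv (fun t : ℝ => θ (insertCoord l t x))
            = fun t => pd l θ (insertCoord l t x) := by
          funext t
          exact (((hθ.smooth.differentiable (by simp) _).hasFDerivAt).comp_hasDerivAt t (hd t)).deriv
        have hcs : HasCompactSupport fun t : ℝ => θ (insertCoord l t x) := by
          refine HasCompactSupport.intro (isCompact_Icc (a := x₀ l - τ) (b := x₀ l + τ))
            fun t ht => (hzero t fun htU => ht ?_).1
          have h3 := htU.1
          rw [insertCoord_same, abs_lt] at h3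
          constructor <;> linarith [h3.1, h3.2]
        have hsm : ContDiff ℝ 1 fun t : ℝ => θ (insertCoord l t x) :=
          (hθ.smooth.comp hline).of_le (by simp)
        have h4 := hcs.integral_Iic_deriv_eq hsm (γ x)
        rw [hder, integral_Iic_eq_integral_Iio, ← integral_indicator measurableSet_Iio] at h4
        rw [hg]
        refine Eq.trans (integral_congr_ae (Eventually.of_forall fun t => ?_)) h4
        simp only
        by_cases htU : insertCoord l t x ∈ U
        · have h5 := htU.1
          rw [insertCoord_same] at h5
          have h6 := ((hγ x hx).2 t h5).1
          by_cases h7 : t < γ x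
          · rw [Set.indicator_of_mem (show insertCoord l t x ∈ {x | ρ x < 0} from h6.2 h7),
              Set.indicator_of_mem (show t ∈ Set.Iio (γ x) from h7)]
          · rw [Set.indicator_of_notMem (show insertCoord l t x ∉ {x | ρ x < 0} from
              fun h => h7 (h6.1 h)), Set.indicator_of_notMem (show t ∉ Set.Iio (γ x) from h7)]
        · rw [Set.indicator_apply, Set.indicator_apply, (hzero t htU).2]
          simp
      · rw [Set.indicator_of_notMem hx]
        refine integral_eq_zero_of_ae (Eventually.of_forall fun t => ?_)
        have htU : insertCoord l t x ∉ U := fun h => hx (by simpa using h.2)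
        simp only
        rw [Set.indicator_apply, (hzero t htU).2]
        simp
    intro θ hθ i
    -- the other components: the field `(θ / ∂ₗρ) (∂ₗρ eᵢ - ∂ᵢρ eₗ)` is tangential
    have hpos : ∀ x ∈ U, 0 < pd l ρ x := fun x hx =>
      lt_of_lt_of_le hc0 (hc x (hbox x hx.1 hx.2))
    have hψ : IsTest U (fun x => θ x * (pd l ρ x)⁻¹) := by
      refine ⟨contDiff_iff_contDiffAt.2 fun x => ?_, hθ.compact.mul_right,
        tsupport_mul_subset_left.trans hθ.subset⟩
      by_cases hx : x ∈ U
      · exact hθ.smooth.contDiffAt.mul ((contDiff_pd hρ l).contDiffAt.inv (hpos x hx).ne')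
      · have hx' : x ∉ tsupport θ := fun h => hx (hθ.subset h)
        refine (contDiffAt_const (c := (0 : ℝ))).congr_of_eventuallyEq ?_
        filter_upwards [(isClosed_tsupport θ).isOpen_compl.mem_nhds hx'] with y hy
        rw [image_eq_zero_of_notMem_tsupport hy, zero_mul]
    have h8 := setIntegral_tangential hρ hψ i l
    have h9 : (fun y => θ y * (pd l ρ y)⁻¹ * pd l ρ y) = θ := by
      funext y
      by_cases hy : y ∈ U
      · rw [mul_assoc, inv_mul_cancel₀ (hpos y hy).ne', mul_one]
      · rw [hθ.zero_off hy]; simp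
    rw [h9, hmain _ (hψ.mul_right (contDiff_pd hρ i))] at h8
    rw [h8]
    refine integral_congr_ae (Eventually.of_forall fun x => ?_)
    simp only [div_eq_mul_inv]; ring

end Green


/-! ### Boundary charts -/

section Chart

/-- A neighbourhood `U` in which the divergence theorem holds for `A`, with the part `B` of the
boundary of `A`: the surface measure is comparable to `μ` in `U`, and `N` is a continuous normal
field (not of unit length) which is outward with respect to `A`. -/
structure IsGreenChart {n : ℕ} (A B U : Set (E n)) (μ : Measure (E n)) (N : Fin n → E n → ℝ)
    (K : NNReal) : Prop where
  isOpen : IsOpen U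
  finite : IsFiniteMeasure μ
  cont : ∀ i, ContinuousOn (N i) U
  le_surface : μ ≤ surface B
  surface_le : (surface B).restrict U ≤ (K : ℝ≥0∞) • μ
  green : ∀ θ, IsTest U θ → ∀ i, ∫ x in A, pd i θ x = ∫ x, N i x * θ x ∂μ
  unit : ∃ (k : Fin n) (s : ℝ), (s = 1 ∨ s = -1) ∧ ∀ x ∈ U, N k x = s

lemma setIntegral_congr_of_test {n : ℕ} {A A' U : Set (E n)} {f : E n → ℝ}
    (hA : MeasurableSet A) (hA' : MeasurableSet A') (h : ∀ x ∈ U, x ∈ A ↔ x ∈ A')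
    (hf : ∀ x ∉ U, f x = 0) : ∫ x in A, f x = ∫ x in A', f x := by
  rw [← integral_indicator hA, ← integral_indicator hA']
  refine integral_congr_ae (Eventually.of_forall fun x => ?_)
  change A.indicator f x = A'.indicator f x
  classical
  rw [Set.indicator_apply, Set.indicator_apply]
  by_cases hx : x ∈ U
  · simp only [h x hx]
  · rw [hf x hx, ite_self, ite_self]

lemma IsGreenChart.restrict {n : ℕ} {A A' B U V : Set (E n)} {μ : Measure (E n)}
    {N : Fin n → E n → ℝ} {K : NNReal} (h : IsGreenChart A B U μ N K) (hV : IsOpen V) (hVU : V ⊆ U)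
    (hA : MeasurableSet A) (hA' : MeasurableSet A') (hAA : ∀ x ∈ V, x ∈ A ↔ x ∈ A') :
    IsGreenChart A' B V μ N K where
  isOpen := hV
  finite := h.finite
  cont i := (h.cont i).mono hVU
  le_surface := h.le_surface
  surface_le := (Measure.restrict_mono hVU le_rfl).trans h.surface_le
  green θ hθ i := by
    rw [← h.green θ (hθ.mono hVU) i]
    exact setIntegral_congr_of_test hA' hA (fun x hx => (hAA x hx).symm)
      fun x hx => (hθ.pd i).zero_off hx
  unit := by
    obtain ⟨k, s, hs, hk⟩ := h.unit
    exact ⟨k, s, hs, fun x hx => hk x (hVU hx)⟩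

lemma gradient_apply {n : ℕ} (ρ : E n → ℝ) (x : E n) (i : Fin n) : gradient ρ x i = pd i ρ x := by
  rw [pd, ← gradient_inner_eq, EuclideanSpace.inner_single_right]
  simp

/-- The gradients of two defining functions of a domain at a boundary point are parallel. -/
lemma exists_gradient_eq_smul {n : ℕ} {D : Set (E n)} {x : E n} {ρ₁ ρ₂ : E n → ℝ}
    (h₁ : IsLocalDefiningFunction D x ρ₁) (h₂ : IsLocalDefiningFunction D x ρ₂) :
    ∃ κ : ℝ, κ ≠ 0 ∧ gradient ρ₂ x = κ • gradient ρ₁ x := by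
  set g₁ := gradient ρ₁ x with hg₁
  set g₂ := gradient ρ₂ x with hg₂
  have hder : ∀ {ρ : E n → ℝ}, ContDiff ℝ ∞ ρ → ∀ d : E n,
      HasDerivAt (fun t : ℝ => ρ (x + t • d)) (inner ℝ (gradient ρ x) d) 0 := by
    intro ρ hρ d
    rw [gradient_inner_eq]
    have h3 : HasDerivAt (fun t : ℝ => x + t • d) d 0 := by
      simpa using ((hasDerivAt_id (0 : ℝ)).smul_const d).const_add x
    have h4 : HasFDerivAt ρ (fderiv ℝ ρ x) (x + (0 : ℝ) • d) := by
      simpa using (hρ.differentiable (by simp) x).hasFDerivAt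
    exact h4.comp_hasDerivAt (0 : ℝ) h3
  -- a direction along which `ρ₁` decreases enters the domain, so `ρ₂` cannot increase along it
  have key : ∀ d, inner ℝ g₁ d < 0 → inner ℝ g₂ d ≤ 0 := by
    intro d hd
    by_contra! hpos
    have hline : Tendsto (fun t : ℝ => x + t • d) (𝓝[>] 0) (𝓝 x) := by
      have : Continuous fun t : ℝ => x + t • d := by fun_prop
      simpa using (this.tendsto 0).mono_left nhdsWithin_le_nhds
    have e1 : ∀ᶠ t : ℝ in 𝓝[>] 0, ρ₁ (x + t • d) < 0 := by
      have h5 := (hasDerivAt_iff_tendsto_slope.1 (hder h₁.1 d)).mono_left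
        (nhdsWithin_mono (0 : ℝ) (fun t (ht : 0 < t) => ht.ne'))
      filter_upwards [h5.eventually_lt_const hd, self_mem_nhdsWithin] with t ht htpos
      have htpos' : 0 < t := htpos
      rw [slope_def_field] at ht
      simp only [zero_smul, add_zero, h₁.2.1, sub_zero] at ht
      by_contra! hc
      exact absurd (div_nonneg hc htpos'.le) (not_le.2 ht)
    have e2 : ∀ᶠ t : ℝ in 𝓝[>] 0, 0 < ρ₂ (x + t • d) := by
      have h5 := (hasDerivAt_iff_tendsto_slope.1 (hder h₂.1 d)).mono_left
        (nhdsWithin_mono (0 : ℝ) (fun t (ht : 0 < t) => ht.ne'))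
      filter_upwards [h5.eventually_const_lt hpos, self_mem_nhdsWithin] with t ht htpos
      have htpos' : 0 < t := htpos
      rw [slope_def_field] at ht
      simp only [zero_smul, add_zero, h₂.2.1, sub_zero] at ht
      by_contra! hc
      exact absurd (div_nonpos_of_nonpos_of_nonneg hc htpos'.le) (not_le.2 ht)
    obtain ⟨t, a1, a2, a3, a4⟩ := (e1.and (e2.and ((hline.eventually h₁.2.2.2).and
      (hline.eventually h₂.2.2.2)))).exists
    exact absurd (a4.1 (a3.2 a1)) (not_lt.2 a2.le)
  have hn1 : 0 < ‖g₁‖ ^ 2 := by have := norm_pos_iff.2 h₁.2.2.1; positivity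
  set κ := inner ℝ g₁ g₂ / ‖g₁‖ ^ 2 with hκ
  set α := g₂ - κ • g₁ with hα
  have horth : inner ℝ g₁ α = 0 := by
    rw [hα, inner_sub_right, inner_smul_right, real_inner_self_eq_norm_sq, hκ,
      div_mul_cancel₀ _ hn1.ne', sub_self]
  have hg2 : g₂ = α + κ • g₁ := by rw [hα]; abel
  -- the part `α` of `g₂` orthogonal to `g₁` can be added to `-ε g₁`, hence must vanish
  have hsmall : ∀ ε > 0, ‖α‖ ^ 2 ≤ ε * inner ℝ g₁ g₂ := by
    intro ε hε
    have h6 := key (α - ε • g₁) (by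
      rw [inner_sub_right, horth, inner_smul_right, real_inner_self_eq_norm_sq]
      have := mul_pos hε hn1
      linarith)
    rw [inner_sub_right, inner_smul_right, real_inner_comm g₁ g₂] at h6
    have h7 : inner ℝ g₂ α = ‖α‖ ^ 2 := by
      rw [hg2, inner_add_left, inner_smul_left, horth, real_inner_self_eq_norm_sq]; simp
    rw [h7] at h6
    linarith
  have hα0 : α = 0 := by
    have h8 : ‖α‖ ^ 2 ≤ 0 := by
      refine le_of_forall_pos_le_add fun δ hδ => ?_
      have h9 := hsmall (δ / (|inner ℝ g₁ g₂| + 1)) (by positivity)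
      refine h9.trans ?_
      rw [zero_add, div_mul_eq_mul_div, div_le_iff₀ (by positivity)]
      exact mul_le_mul_of_nonneg_left ((le_abs_self _).trans (by linarith)) hδ.le
    exact norm_eq_zero.1 (pow_eq_zero_iff two_ne_zero |>.1 (le_antisymm h8 (sq_nonneg _)))
  rw [hα0, zero_add] at hg2
  refine ⟨κ, fun h0 => h₂.2.2.1 ?_, hg2⟩
  rw [← hg₂, hg2, h0, zero_smul]

/-- Boundary charts for both sides of a smooth boundary. -/
lemma exists_greenChart {m : ℕ} {D : Set (E (m + 1))} (hD : IsOpen D) {x₀ : E (m + 1)}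
    {ρ : E (m + 1) → ℝ} (hloc : IsLocalDefiningFunction D x₀ ρ) :
    ∃ (U : Set (E (m + 1))) (μ : Measure (E (m + 1))) (N : Fin (m + 1) → E (m + 1) → ℝ)
      (K : NNReal), x₀ ∈ U ∧ IsGreenChart D (frontier D) U μ N K ∧
      IsGreenChart (closure D)ᶜ (frontier D) U μ (fun i x => -N i x) K ∧
      ∀ x ∈ U ∩ frontier D, ∃ a : ℝ, a ≠ 0 ∧ ∀ i, N i x = a * outerNormal D x i := by
  obtain ⟨r, l, s, c, hr, hc0, hs, hdef, hc⟩ := exists_good_ball hloc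
  obtain ⟨hρ, h0, -, -⟩ := hloc
  have hpd : ∀ i x, pd i (fun y => s * ρ y) x = s * pd i ρ x := fun i x => by
    simp only [mul_comm s]; exact pd_mul_const hρ s i x
  obtain ⟨U, μ, K, hxU, hUo, hUr, hfin, hle, hge, hnull, hgreen⟩ :=
    exists_graph_measure (ρ := fun y => s * ρ y) (contDiff_const.mul hρ) (x₀ := x₀) hr hc0 (by simp only [h0, mul_zero])
      (fun x hx => by rw [hpd]; exact hc x hx)
  have hs0 : s ≠ 0 := by rcases hs with h | h <;> rw [h] <;> norm_num
  have hlne : ∀ x ∈ U, pd l ρ x ≠ 0 := fun x hx h => by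
    have := hc x (hUr hx)
    rw [h, mul_zero] at this
    linarith
  have hcl : ∀ x ∈ U, x ∈ closure D ↔ ρ x ≤ 0 := by
    intro x hx
    have hxr := hUr hx
    constructor
    · intro hxD
      have hxc : x ∈ closure (Metric.ball x₀ r ∩ D) := Metric.isOpen_ball.inter_closure ⟨hxr, hxD⟩
      refine closure_minimal (fun w hw => ?_) (isClosed_le hρ.continuous continuous_const) hxc
      exact ((hdef w hw.1).1 hw.2).le
    · intro hle
      have hcont : Continuous fun t : ℝ => x - (s * t) • (e l : E (m + 1)) := by fun_prop
      have htend : Tendsto (fun t : ℝ => x - (s * t) • (e l : E (m + 1))) (𝓝[>] 0) (𝓝 x) := by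
        simpa using (hcont.tendsto 0).mono_left nhdsWithin_le_nhds
      refine mem_closure_of_tendsto htend ?_
      filter_upwards [htend (Metric.isOpen_ball.mem_nhds hxr), self_mem_nhdsWithin] with t ht htpos
      have htpos' : 0 < t := htpos
      have h1 := le_increment hρ htpos'.le hc ht (by simpa using hxr)
      rw [sub_add_cancel] at h1
      refine (hdef _ ht).2 ?_
      have := mul_pos hc0 htpos'
      linarith
  have hfr : {x | s * ρ x = 0} ∩ U = frontier D ∩ U := by
    ext x
    simp only [Set.mem_inter_iff, Set.mem_ofPred_eq, and_congr_left_iff, mul_eq_zero, hs0, false_or,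
      hD.frontier_eq, Set.mem_sdiff]
    intro hx
    rw [hcl x hx, hdef x (hUr hx), not_lt, le_antisymm_iff]
  have hmD := hD.measurableSet
  have hmC : MeasurableSet (closure D)ᶜ := isClosed_closure.measurableSet.compl
  -- the integral of a derivative over the whole space vanishes and the boundary is a null set, so
  -- the two sides of the boundary have opposite fluxes
  have hzero : ∀ θ, IsTest U θ → ∀ i,
      (∫ x in D, pd i θ x) + ∫ x in (closure D)ᶜ, pd i θ x = 0 := by
    intro θ hθ i
    have hint : Integrable (pd i θ) :=
      (hθ.pd i).continuous.integrable_of_hasCompactSupport (hθ.pd i).compact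
    rw [← integral_indicator hmD, ← integral_indicator hmC,
      ← integral_add (hint.indicator hmD) (hint.indicator hmC)]
    have h1 : ∫ x, pd i θ x = 0 := by
      have := integral_mul_pd (η := fun _ => 1) contDiff_const hθ i
      have hpd1 : ∀ x, pd i (fun _ : E (m + 1) => (1 : ℝ)) x = 0 := fun x => by simp [pd]
      simpa [hpd1] using this
    rw [← h1]
    refine integral_congr_ae ?_
    rw [hfr] at hnull
    filter_upwards [measure_eq_zero_iff_ae_notMem.1 hnull] with x hx
    by_cases hxU : x ∈ U
    · have hxf : x ∉ frontier D := fun h => hx ⟨h, hxU⟩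
      by_cases hxD : x ∈ D
      · have : x ∉ (closure D)ᶜ := fun h => h (subset_closure hxD)
        simp [hxD, this]
      · have : x ∈ (closure D)ᶜ := fun h => hxf (by rw [hD.frontier_eq]; exact ⟨h, hxD⟩)
        rw [Set.indicator_of_notMem hxD, Set.indicator_of_mem this, zero_add]
    · have h2 := (hθ.pd i).zero_off hxU
      have h3 : ∀ A : Set (E (m + 1)), A.indicator (pd i θ) x = 0 := fun A => by
        by_cases hA : x ∈ A
        · rw [Set.indicator_of_mem hA, h2]
        · rw [Set.indicator_of_notMem hA]
      simp only [h3, h2, add_zero]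
  have hmS : MeasurableSet {x | s * ρ x < 0} :=
    (isOpen_lt (continuous_const.mul hρ.continuous) continuous_const).measurableSet
  -- `{s ρ < 0}` is `D` for `s = 1` and the complement of its closure for `s = -1`
  have hgD : ∀ θ, IsTest U θ → ∀ i, ∫ x in D, pd i θ x = ∫ x, s * (pd i ρ x / pd l ρ x) * θ x ∂μ := by
    intro θ hθ i
    have h1 := hgreen θ hθ i
    simp only [hpd, mul_div_mul_left _ _ hs0] at h1
    simp only [mul_assoc]
    rw [integral_const_mul, ← h1]
    rcases hs with h | h
    · rw [h, one_mul]
      refine setIntegral_congr_of_test hmD (h ▸ hmS) (fun x hx => ?_)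
        fun x hx => (hθ.pd i).zero_off hx
      rw [hdef x (hUr hx)]; simp
    · have h2 : ∫ x in {x | s * ρ x < 0}, pd i θ x = ∫ x in (closure D)ᶜ, pd i θ x := by
        refine setIntegral_congr_of_test hmS hmC (fun x hx => ?_)
          fun x hx => (hθ.pd i).zero_off hx
        rw [Set.mem_compl_iff, hcl x hx, not_le]
        simp [h]
      rw [h2, h]
      linarith [hzero θ hθ i]
  have hsl : surface (frontier D) = (μHE[m] : Measure (E (m + 1))).restrict (frontier D) := rfl
  have hcontN : ∀ i, ContinuousOn (fun x => s * (pd i ρ x / pd l ρ x)) U := fun i =>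
    continuousOn_const.mul ((contDiff_pd hρ i).continuous.continuousOn.div
      (contDiff_pd hρ l).continuous.continuousOn hlne)
  have hle' : μ ≤ surface (frontier D) := by
    rw [hsl]
    refine hle.trans ?_
    rw [hfr]
    exact Measure.restrict_mono Set.inter_subset_left le_rfl
  have hge' : (surface (frontier D)).restrict U ≤ (K : ℝ≥0∞) • μ := by
    rw [hsl, Measure.restrict_restrict hUo.measurableSet, Set.inter_comm, ← hfr]
    exact hge
  refine ⟨U, μ, fun i x => s * (pd i ρ x / pd l ρ x), K, hxU,
    ⟨hUo, hfin, hcontN, hle', hge', hgD, l, s, hs, fun x hx => ?_⟩,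
    ⟨hUo, hfin, fun i => (hcontN i).neg, hle', hge', fun θ hθ i => ?_, l, -s, ?_, fun x hx => ?_⟩,
    fun x hx => ?_⟩
  · rw [div_self (hlne x hx), mul_one]
  · simp only [neg_mul, integral_neg]
    rw [← hgD θ hθ i]
    linarith [hzero θ hθ i]
  · rcases hs with h | h <;> simp [h]
  · change -(s * (pd l ρ x / pd l ρ x)) = -s
    rw [div_self (hlne x hx), mul_one]
  · have hx0 : ρ x = 0 := by
      have : x ∈ {x | s * ρ x = 0} ∩ U := by rw [hfr]; exact ⟨hx.2, hx.1⟩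
      simpa [hs0] using this.1
    have hlocx : IsLocalDefiningFunction D x ρ := by
      refine ⟨hρ, hx0, fun hg => hlne x hx.1 ?_, ?_⟩
      · rw [← gradient_apply, hg]; rfl
      · filter_upwards [hUo.mem_nhds hx.1] with y hy using hdef y (hUr hy)
    have hex : ∃ ρ : E (m + 1) → ℝ, IsLocalDefiningFunction D x ρ := ⟨ρ, hlocx⟩
    obtain ⟨κ, hκ, hκg⟩ := exists_gradient_eq_smul hex.choose_spec hlocx
    have hgn : ‖gradient hex.choose x‖ ≠ 0 := norm_ne_zero_iff.2 hex.choose_spec.2.2.1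
    refine ⟨s * (pd l ρ x)⁻¹ * κ * ‖gradient hex.choose x‖,
      mul_ne_zero (mul_ne_zero (mul_ne_zero hs0 (inv_ne_zero (hlne x hx.1))) hκ) hgn, fun i => ?_⟩
    have h3 : outerNormal D x = ‖gradient hex.choose x‖⁻¹ • gradient hex.choose x := by
      rw [outerNormal, dif_pos hex]
    have h4 : pd i ρ x = κ * gradient hex.choose x i := by
      rw [← gradient_apply, hκg]; simp
    change s * (pd i ρ x / pd l ρ x) = _
    rw [h3, PiLp.smul_apply, smul_eq_mul, h4]
    field_simp

end Chart


/-! ### Weak derivatives in `L²(Ω)` -/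

section WeakL2

variable {n : ℕ} {Ω : Set (E n)} {i : Fin n} {F : Type*} [NormedAddCommGroup F]
  [NormedSpace ℝ F]

lemma integral_smul_indicator (hΩ : MeasurableSet Ω) (φ : E n → ℝ) (f : E n → F) :
    ∫ x, φ x • Ω.indicator f x = ∫ x in Ω, φ x • f x := by
  rw [← integral_indicator hΩ]
  refine integral_congr_ae (Eventually.of_forall fun x => ?_)
  by_cases hx : x ∈ Ω <;> simp [hx]

lemma memLp_indicator_coe (hΩ : MeasurableSet Ω) (u : L2 Ω) :
    MemLp (Ω.indicator u) 2 volume :=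
  (memLp_indicator_iff_restrict hΩ).2 (Lp.memLp u)

lemma isWeakPartial_iff (hΩ : MeasurableSet Ω) {u v : L2 Ω} :
    IsWeakPartial Ω i u v ↔ WeakPartialOn Ω i (Ω.indicator u) (Ω.indicator v) := by
  have key : ∀ (φ : E n → ℝ) (f : L2 Ω),
      ∫ x, φ x • Ω.indicator f x = ∫ x in Ω, ((φ x : ℝ) : ℂ) * f x := fun φ f =>
    integral_smul_indicator hΩ φ f
  constructor
  · intro h φ hφ
    rw [key, key]
    exact h φ hφ.smooth hφ.compact hφ.subset
  · intro h φ h1 h2 h3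
    have h4 := h φ ⟨h1, h2, h3⟩
    rw [key, key] at h4
    exact h4

lemma IsWeakPartial.unique (hΩ : IsOpen Ω) {u v v' : L2 Ω} (h : IsWeakPartial Ω i u v)
    (h' : IsWeakPartial Ω i u v') : v = v' := by
  have hm := hΩ.measurableSet
  have hloc : ∀ f : L2 Ω, LocallyIntegrable (Ω.indicator f) := fun f =>
    (memLp_indicator_coe hm f).locallyIntegrable (by norm_num)
  have h1 := WeakPartialOn.ae_unique hΩ (hloc v) (hloc v') ((isWeakPartial_iff hm).1 h)
    ((isWeakPartial_iff hm).1 h')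
  refine Lp.ext ?_
  rw [EventuallyEq, ae_restrict_iff' hm]
  filter_upwards [h1] with x hx hxΩ
  simpa [hxΩ] using hx hxΩ

lemma IsWeakPartial.eq (hΩ : IsOpen Ω) {u v : L2 Ω} (h : IsWeakPartial Ω i u v) :
    weakPartial Ω i u = v := by
  have hex : ∃ v : L2 Ω, IsWeakPartial Ω i u v := ⟨v, h⟩
  rw [weakPartial, dif_pos hex]
  exact hex.choose_spec.unique hΩ h

/-- Integration against a fixed square-integrable function is continuous in `L²`. -/
lemma tendsto_integral_smul {μ : Measure (E n)} {h : E n → ℝ} {f : ℕ → E n → F} {g : E n → F}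
    (hh : MemLp h 2 μ) (hf : ∀ k, MemLp (f k) 2 μ) (hg : MemLp g 2 μ)
    (hfg : Tendsto (fun k => eLpNorm (fun x => f k x - g x) 2 μ) atTop (𝓝 0)) :
    Tendsto (fun k => ∫ x, h x • f k x ∂μ) atTop (𝓝 (∫ x, h x • g x ∂μ)) := by
  have hint : ∀ {f : E n → F}, MemLp f 2 μ → Integrable (fun x => h x • f x) μ := fun hf =>
    memLp_one_iff_integrable.1 (MemLp.smul (p := 2) (q := 2) hf hh)
  refine tendsto_integral_of_L1' _ (hint hg).1 (Eventually.of_forall fun k => hint (hf k)) ?_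
  have h1 : Tendsto (fun k => eLpNorm h 2 μ * eLpNorm (fun x => f k x - g x) 2 μ) atTop (𝓝 0) := by
    simpa using ENNReal.Tendsto.const_mul (a := eLpNorm h 2 μ) hfg (Or.inr hh.2.ne)
  refine tendsto_of_tendsto_of_tendsto_of_le_of_le tendsto_const_nhds h1 (fun k => zero_le)
    fun k => ?_
  refine le_trans (le_of_eq ?_) (eLpNorm_smul_le_mul_eLpNorm (p := 2) (q := 2) (r := 1)
    ((hf k).1.sub hg.1) hh.1)
  congr 1
  funext x
  simp [smul_sub]

lemma IsWeakPartial.of_tendsto {u : ℕ → L2 Ω} {v : ℕ → L2 Ω} {u' v' : L2 Ω}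
    (hu : Tendsto u atTop (𝓝 u')) (hv : Tendsto v atTop (𝓝 v'))
    (h : ∀ k, IsWeakPartial Ω i (u k) (v k)) : IsWeakPartial Ω i u' v' := by
  intro φ h1 h2 h3
  have hφ : IsTest Ω φ := ⟨h1, h2, h3⟩
  have key : ∀ {φ : E n → ℝ}, IsTest Ω φ → ∀ {w : ℕ → L2 Ω} {w' : L2 Ω},
      Tendsto w atTop (𝓝 w') → Tendsto (fun k => ∫ x in Ω, ((φ x : ℝ) : ℂ) * w k x) atTop
        (𝓝 (∫ x in Ω, ((φ x : ℝ) : ℂ) * w' x)) := by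
    intro φ hφ w w' hw
    exact tendsto_integral_smul (hφ.continuous.memLp_of_hasCompactSupport hφ.compact)
      (fun k => Lp.memLp (w k)) (Lp.memLp w') ((Lp.tendsto_Lp_iff_tendsto_eLpNorm' w w').1 hw)
  refine tendsto_nhds_unique (key (hφ.pd i) hu) ?_
  exact (key hφ hv).neg.congr fun k => (h k φ h1 h2 h3).symm

end WeakL2

/-! ### The trace inequality -/

section TraceBound

variable {n : ℕ} {A B U : Set (E n)} {μ : Measure (E n)} {N : Fin n → E n → ℝ} {K : NNReal}

/-- The trace inequality in one chart: the divergence theorem is applied to `ζ² |φ|²` in the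
direction in which the normal field is constant. -/
lemma IsGreenChart.lintegral_le (h : IsGreenChart A B U μ N K) {ζ : E n → ℝ} (hζ : IsTest U ζ) :
    ∃ C : ℝ, 0 ≤ C ∧ ∀ φ : E n → ℂ, ContDiff ℝ ∞ φ → HasCompactSupport φ →
      ∫⁻ x, ENNReal.ofReal (ζ x ^ 2 * ‖φ x‖ ^ 2) ∂surface B
        ≤ ENNReal.ofReal (C * ((∫ x in A, ‖φ x‖ ^ 2) + ∑ i, ∫ x in A, ‖pd i φ x‖ ^ 2)) := by
  obtain ⟨k, s, hs, hk⟩ := h.unit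
  have hζ2 : IsTest U (fun x => ζ x * ζ x) := hζ.mul_right hζ.smooth
  obtain ⟨M₀, hM₀⟩ := hζ2.continuous.bounded_above_of_compact_support hζ2.compact
  obtain ⟨M₁, hM₁⟩ := (hζ2.pd k).continuous.bounded_above_of_compact_support (hζ2.pd k).compact
  have hM₀0 : 0 ≤ M₀ := (norm_nonneg _).trans (hM₀ 0)
  have hM₁0 : 0 ≤ M₁ := (norm_nonneg _).trans (hM₁ 0)
  refine ⟨K * (M₁ + M₀), by positivity, fun φ hφ hc => ?_⟩
  have hN : ContDiff ℝ ∞ (fun x => ‖φ x‖ ^ 2) := hφ.norm_sq ℝ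
  have hNd : ∀ x, pd k (fun x => ‖φ x‖ ^ 2) x = 2 * inner ℝ (φ x) (pd k φ x) := by
    intro x
    have := ((hφ.differentiable (by simp) x).hasFDerivAt).norm_sq
    simp only [pd, this.fderiv]
    simp
    ring
  have hθ : IsTest U (fun x => (ζ x * ζ x) * ‖φ x‖ ^ 2) := hζ2.mul_right hN
  have hθ0 : ∀ x, 0 ≤ (ζ x * ζ x) * ‖φ x‖ ^ 2 := fun x =>
    mul_nonneg (mul_self_nonneg _) (sq_nonneg _)
  have hsq : ∀ {ψ : E n → ℂ}, ContDiff ℝ ∞ ψ → HasCompactSupport ψ →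
      Integrable (fun x => ‖ψ x‖ ^ 2) (volume.restrict A) := by
    intro ψ h1 h2
    refine (h1.norm_sq ℝ).continuous.integrable_of_hasCompactSupport ?_
    exact h2.comp_left (g := fun z : ℂ => ‖z‖ ^ 2) (by simp)
  have hφk := hsq (contDiff_pd hφ k) (hc.fderiv_apply (𝕜 := ℝ) (e k))
  have e1 : ∫⁻ x, ENNReal.ofReal (ζ x ^ 2 * ‖φ x‖ ^ 2) ∂surface B
      ≤ K * ∫⁻ x, ENNReal.ofReal (ζ x * ζ x * ‖φ x‖ ^ 2) ∂μ := by
    have e2 : ∀ x, ENNReal.ofReal (ζ x ^ 2 * ‖φ x‖ ^ 2)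
        = U.indicator (fun x => ENNReal.ofReal (ζ x * ζ x * ‖φ x‖ ^ 2)) x := by
      intro x
      by_cases hx : x ∈ U
      · rw [Set.indicator_of_mem hx, sq (ζ x)]
      · rw [Set.indicator_of_notMem hx, hζ.zero_off hx]; simp
    simp only [e2]
    rw [lintegral_indicator h.isOpen.measurableSet]
    refine (lintegral_mono' h.surface_le le_rfl).trans (le_of_eq ?_)
    rw [lintegral_smul_measure, smul_eq_mul]
  refine e1.trans ?_
  have := h.finite
  rw [← ofReal_integral_eq_lintegral_ofReal
    (hθ.continuous.integrable_of_hasCompactSupport hθ.compact) (Eventually.of_forall hθ0)]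
  -- in the direction `k` the normal field is the constant `s = ±1`
  have e3 : ∫ x, ζ x * ζ x * ‖φ x‖ ^ 2 ∂μ
      = s * ∫ x in A, pd k (fun x => ζ x * ζ x * ‖φ x‖ ^ 2) x := by
    rw [h.green _ hθ k, ← integral_const_mul]
    refine integral_congr_ae (Eventually.of_forall fun x => ?_)
    by_cases hx : x ∈ U
    · have : s * s = 1 := by rcases hs with h | h <;> rw [h] <;> norm_num
      simp only [hk x hx, ← mul_assoc, this, one_mul]
    · simp [hζ.zero_off hx]
  have e4 : ∫ x, ζ x * ζ x * ‖φ x‖ ^ 2 ∂μ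
      ≤ ∫ x in A, (M₁ + M₀) * (‖φ x‖ ^ 2 + ‖pd k φ x‖ ^ 2) := by
    rw [e3]
    have hs1 : |s| = 1 := by rcases hs with h | h <;> rw [h] <;> norm_num
    refine (le_abs_self _).trans ?_
    rw [abs_mul, hs1, one_mul]
    refine (abs_integral_le_integral_abs).trans (integral_mono
      ((hθ.pd k).continuous.integrable_of_hasCompactSupport (hθ.pd k).compact).abs
      (((hsq hφ hc).add hφk).const_mul _) fun x => ?_)
    rw [pd_mul hζ2.smooth hN, hNd]
    have a1 := hM₁ x
    have a2 := hM₀ x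
    have a3 := abs_real_inner_le_norm (φ x) (pd k φ x)
    rw [Real.norm_eq_abs] at a1 a2
    have a4 : 2 * (‖φ x‖ * ‖pd k φ x‖) ≤ ‖φ x‖ ^ 2 + ‖pd k φ x‖ ^ 2 := by
      nlinarith [sq_nonneg (‖φ x‖ - ‖pd k φ x‖)]
    calc |pd k (fun x => ζ x * ζ x) x * ‖φ x‖ ^ 2 + ζ x * ζ x * (2 * inner ℝ (φ x) (pd k φ x))|
        ≤ |pd k (fun x => ζ x * ζ x) x| * ‖φ x‖ ^ 2
            + |ζ x * ζ x| * (2 * |inner ℝ (φ x) (pd k φ x)|) := by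
          refine (abs_add_le _ _).trans (le_of_eq ?_)
          rw [abs_mul, abs_mul (ζ x * ζ x), abs_mul (2 : ℝ), abs_of_nonneg (sq_nonneg ‖φ x‖),
            abs_of_nonneg (by norm_num : (0 : ℝ) ≤ 2)]
      _ ≤ M₁ * (‖φ x‖ ^ 2 + ‖pd k φ x‖ ^ 2) + M₀ * (‖φ x‖ ^ 2 + ‖pd k φ x‖ ^ 2) := by
          refine add_le_add (mul_le_mul a1 (by linarith [sq_nonneg ‖pd k φ x‖]) (by positivity)
            hM₁0) (mul_le_mul a2 (by linarith) (by positivity) hM₀0)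
      _ = (M₁ + M₀) * (‖φ x‖ ^ 2 + ‖pd k φ x‖ ^ 2) := by ring
  have e5 : ∫ x in A, ‖pd k φ x‖ ^ 2 ≤ ∑ i, ∫ x in A, ‖pd i φ x‖ ^ 2 :=
    Finset.single_le_sum (f := fun i => ∫ x in A, ‖pd i φ x‖ ^ 2)
      (fun i _ => integral_nonneg fun x => by positivity) (Finset.mem_univ k)
  rw [integral_const_mul, integral_add (hsq hφ hc) hφk] at e4
  rw [← ENNReal.ofReal_coe_nnreal, ← ENNReal.ofReal_mul K.coe_nonneg, mul_assoc]
  refine ENNReal.ofReal_le_ofReal (mul_le_mul_of_nonneg_left (e4.trans ?_) K.coe_nonneg)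
  exact mul_le_mul_of_nonneg_left (by linarith) (by positivity)

lemma eLpNorm_two_sq {F : Type*} [NormedAddCommGroup F] (f : E n → F) (ν : Measure (E n)) :
    eLpNorm f 2 ν ^ 2 = ∫⁻ x, ENNReal.ofReal (‖f x‖ ^ 2) ∂ν := by
  have := eLpNorm_nnreal_pow_eq_lintegral (f := f) (μ := ν) (p := 2) (by norm_num)
  simp only [NNReal.coe_ofNat, ENNReal.coe_ofNat, ENNReal.rpow_ofNat] at this
  rw [this]
  refine lintegral_congr fun x => ?_
  rw [ENNReal.ofReal_pow (norm_nonneg _), ofReal_norm]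

/-- The trace inequality for smooth functions. -/
lemma exists_trace_bound (hB : IsCompact B)
    (hcov : ∀ x ∈ B, ∃ U μ N K, x ∈ U ∧ IsGreenChart A B U μ N K) :
    ∃ C : NNReal, ∀ φ : E n → ℂ, ContDiff ℝ ∞ φ → HasCompactSupport φ →
      eLpNorm φ 2 (surface B) ≤ C * (eLpNorm φ 2 (volume.restrict A)
        + ∑ i, eLpNorm (pd i φ) 2 (volume.restrict A)) := by
  choose! U μ N K hU hchart using hcov
  obtain ⟨s, ζ, hs, hsum⟩ := exists_cutoffs hB (W := U)
    fun x hx => (hchart x hx).isOpen.mem_nhds (hU x hx)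
  have hloc : ∀ x : s, ∃ C : ℝ, 0 ≤ C ∧ ∀ φ : E n → ℂ, ContDiff ℝ ∞ φ → HasCompactSupport φ →
      ∫⁻ y, ENNReal.ofReal (ζ x y ^ 2 * ‖φ y‖ ^ 2) ∂surface B
        ≤ ENNReal.ofReal (C * ((∫ x in A, ‖φ x‖ ^ 2) + ∑ i, ∫ x in A, ‖pd i φ x‖ ^ 2)) := fun x =>
    (hchart x (hs x x.2).1).lintegral_le (hs x x.2).2
  choose C hC0 hC using hloc
  set C' : ℝ := s.card * ∑ x, C x with hC'
  have hC'0 : 0 ≤ C' := mul_nonneg (Nat.cast_nonneg _) (Finset.sum_nonneg fun x _ => hC0 x)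
  refine ⟨(1 + C').toNNReal, fun φ hφ hc => ?_⟩
  set I : ℝ := (∫ x in A, ‖φ x‖ ^ 2) + ∑ i, ∫ x in A, ‖pd i φ x‖ ^ 2 with hI
  have hI0 : 0 ≤ I := add_nonneg (integral_nonneg fun x => by positivity)
    (Finset.sum_nonneg fun i _ => integral_nonneg fun x => by positivity)
  have hsq : ∀ {ψ : E n → ℂ}, ContDiff ℝ ∞ ψ → HasCompactSupport ψ →
      ENNReal.ofReal (∫ x in A, ‖ψ x‖ ^ 2) = eLpNorm ψ 2 (volume.restrict A) ^ 2 := by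
    intro ψ h1 h2
    rw [eLpNorm_two_sq, ofReal_integral_eq_lintegral_ofReal _
      (Eventually.of_forall fun x => by positivity)]
    refine (h1.norm_sq ℝ).continuous.integrable_of_hasCompactSupport ?_
    exact h2.comp_left (g := fun z : ℂ => ‖z‖ ^ 2) (by simp)
  set a := eLpNorm φ 2 (volume.restrict A)
  set b := fun i => eLpNorm (pd i φ) 2 (volume.restrict A)
  have hIab : ENNReal.ofReal I = a ^ 2 + ∑ i, b i ^ 2 := by
    rw [hI, ENNReal.ofReal_add (integral_nonneg fun x => by positivity)
      (Finset.sum_nonneg fun i _ => integral_nonneg fun x => by positivity),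
      ENNReal.ofReal_sum_of_nonneg fun i _ => integral_nonneg fun x => by positivity, hsq hφ hc]
    congr 1
    exact Finset.sum_congr rfl fun i _ => hsq (contDiff_pd hφ i) (hc.fderiv_apply (𝕜 := ℝ) (e i))
  have h1 : eLpNorm φ 2 (surface B) ^ 2 ≤ ENNReal.ofReal (C' * I) := by
    have hae : ∀ᵐ y ∂surface B, ENNReal.ofReal (‖φ y‖ ^ 2)
        ≤ ∑ x : s, (s.card : ℝ≥0∞) * ENNReal.ofReal (ζ x y ^ 2 * ‖φ y‖ ^ 2) := by
      filter_upwards [ae_restrict_mem hB.measurableSet] with y hy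
      -- `1 = (∑ ζ)² ≤ #s ∑ ζ²` on `B`
      have h2 := sq_sum_le_card_mul_sum_sq (s := s) (f := fun x => ζ x y)
      rw [hsum y hy, one_pow] at h2
      rw [← Finset.mul_sum, ← ENNReal.ofReal_sum_of_nonneg fun x _ => by positivity,
        ← Finset.sum_mul, ← ENNReal.ofReal_natCast, ← ENNReal.ofReal_mul (Nat.cast_nonneg _)]
      refine ENNReal.ofReal_le_ofReal ?_
      rw [← mul_assoc, Finset.sum_coe_sort s (fun x => ζ x y ^ 2)]
      exact le_mul_of_one_le_left (by positivity) h2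
    have hmeas : ∀ x ∈ s, Measurable fun y => (s.card : ℝ≥0∞) *
        ENNReal.ofReal (ζ x y ^ 2 * ‖φ y‖ ^ 2) := fun x hx =>
      (((hs x hx).2.continuous.measurable.pow_const 2).mul
        (hφ.continuous.norm.measurable.pow_const 2)).ennreal_ofReal.const_mul _
    rw [eLpNorm_two_sq]
    refine (lintegral_mono_ae hae).trans ?_
    rw [lintegral_finsetSum _ fun (x : s) _ => hmeas x x.2, hC', mul_assoc,
      ENNReal.ofReal_mul (Nat.cast_nonneg _), ENNReal.ofReal_natCast, Finset.sum_mul,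
      ENNReal.ofReal_sum_of_nonneg fun x _ => mul_nonneg (hC0 x) hI0, Finset.mul_sum]
    refine Finset.sum_le_sum fun x _ => ?_
    rw [lintegral_const_mul' _ _ (ENNReal.natCast_ne_top _)]
    gcongr
    exact hC x φ hφ hc
  rw [ENNReal.ofReal_mul hC'0, hIab] at h1
  rw [← ENNReal.pow_le_pow_left_iff two_ne_zero]
  refine h1.trans ?_
  rw [mul_pow]
  have h3 : a ^ 2 + ∑ i, b i ^ 2 ≤ (a + ∑ i, b i) ^ 2 := by
    have h4 : ∑ i, b i ^ 2 ≤ (∑ i, b i) ^ 2 := by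
      rw [sq, Finset.sum_mul]
      refine Finset.sum_le_sum fun i hi => ?_
      rw [sq]
      gcongr
      exact Finset.single_le_sum (fun _ _ => zero_le) hi
    calc a ^ 2 + ∑ i, b i ^ 2 ≤ a ^ 2 + (∑ i, b i) ^ 2 := by gcongr
      _ ≤ a ^ 2 + (∑ i, b i) ^ 2 + 2 * a * ∑ i, b i := le_self_add
      _ = (a + ∑ i, b i) ^ 2 := by ring
  refine mul_le_mul' ?_ h3
  change ENNReal.ofReal C' ≤ ENNReal.ofReal (1 + C') ^ 2
  rw [← ENNReal.ofReal_pow (by linarith)]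
  exact ENNReal.ofReal_le_ofReal (by nlinarith)

end TraceBound

/-! ### Traces of Sobolev functions -/

section Trace

variable {n : ℕ} {A B U : Set (E n)} {μ : Measure (E n)} {N : Fin n → E n → ℝ} {K : NNReal}
  {u : L2 A} {v : Fin n → L2 A} {g : L2Surface B}

lemma tendsto_eLpNorm_clm {ν : Measure (E n)} (L : ℂ →L[ℝ] ℝ) {f : ℕ → E n → ℂ} {f' : E n → ℂ}
    (h : Tendsto (fun k => eLpNorm (fun x => f k x - f' x) 2 ν) atTop (𝓝 0)) :
    Tendsto (fun k => eLpNorm (fun x => L (f k x) - L (f' x)) 2 ν) atTop (𝓝 0) := by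
  have h1 : Tendsto (fun k => ENNReal.ofReal ‖L‖ * eLpNorm (fun x => f k x - f' x) 2 ν) atTop
      (𝓝 0) := by
    simpa using ENNReal.Tendsto.const_mul (a := ENNReal.ofReal ‖L‖) h (Or.inr ENNReal.ofReal_ne_top)
  refine tendsto_of_tendsto_of_tendsto_of_le_of_le tendsto_const_nhds h1 (fun k => zero_le)
    fun k => eLpNorm_le_mul_eLpNorm_of_ae_le_mul (Eventually.of_forall fun x => ?_) 2
  rw [← map_sub]
  exact L.le_opNorm _

/-- Integration by parts against a test function, for a function with a trace and the real part or
the imaginary part `L`. -/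
lemma HasTrace.green (hA : IsOpen A) (h : HasTrace A B u g) (hv : ∀ i, IsWeakPartial A i u (v i))
    (hU : IsGreenChart A B U μ N K) (L : ℂ →L[ℝ] ℝ) {θ : E n → ℝ} (hθ : IsTest U θ) (i : Fin n) :
    (∫ x in A, pd i θ x * L (u x)) + (∫ x in A, θ x * L (v i x))
      = ∫ x, N i x * θ x * L (g x) ∂μ := by
  obtain ⟨v', φ, hv', hφ, h1, h2, h3⟩ := h
  have hvv : v' i = v i := (hv' i).unique hA (hv i)
  have h2i := h2 i
  rw [hvv] at h2i
  have := hU.finite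
  have hNθ : Continuous fun x => N i x * θ x := by
    refine ContinuousOn.continuous_of_tsupport_subset
      ((hU.cont i).mul hθ.continuous.continuousOn) hU.isOpen ?_
    exact tsupport_mul_subset_right.trans hθ.subset
  have hNc : HasCompactSupport fun x => N i x * θ x := hθ.compact.mul_left
  have hL : ∀ {ψ : E n → ℂ} {ν : Measure (E n)}, MemLp ψ 2 ν → MemLp (fun x => L (ψ x)) 2 ν :=
    fun hψ => L.comp_memLp' hψ
  have hψ : ∀ k, ContDiff ℝ ∞ fun x => L (φ k x) := fun k => L.contDiff.comp (hφ k).1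
  have hψd : ∀ k x, pd i (fun x => L (φ k x)) x = L (pd i (φ k) x) := by
    intro k x
    have := L.hasFDerivAt.comp x ((hφ k).1.differentiable (by simp) x).hasFDerivAt
    have h4 : HasFDerivAt (fun x => L (φ k x)) (L.comp (fderiv ℝ (φ k) x)) x := this
    simp only [pd, h4.fderiv]
    rfl
  have hmem : ∀ {f : E n → ℂ}, Continuous f → HasCompactSupport f → MemLp f 2 (volume.restrict A) :=
    fun h h' => h.memLp_of_hasCompactSupport h'
  have t1 := tendsto_integral_smul (h := pd i θ)
    ((hθ.pd i).continuous.memLp_of_hasCompactSupport (hθ.pd i).compact)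
    (fun k => hL (hmem (hφ k).1.continuous (hφ k).2)) (hL (Lp.memLp u)) (tendsto_eLpNorm_clm L h1)
  have t2 := tendsto_integral_smul (h := θ)
    (hθ.continuous.memLp_of_hasCompactSupport hθ.compact)
    (fun k => hL (hmem (contDiff_pd (hφ k).1 i).continuous
      ((hφ k).2.fderiv_apply (𝕜 := ℝ) (e i)))) (hL (Lp.memLp (v i))) (tendsto_eLpNorm_clm L h2i)
  have h3' : Tendsto (fun k => eLpNorm (fun x => φ k x - g x) 2 μ) atTop (𝓝 0) :=
    tendsto_of_tendsto_of_tendsto_of_le_of_le tendsto_const_nhds h3 (fun k => zero_le)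
      fun k => eLpNorm_mono_measure _ hU.le_surface
  have t3 := tendsto_integral_smul (h := fun x => N i x * θ x)
    (hNθ.memLp_of_hasCompactSupport hNc)
    (fun k => hL ((hφ k).1.continuous.memLp_of_hasCompactSupport (hφ k).2))
    (hL ((Lp.memLp g).mono_measure hU.le_surface)) (tendsto_eLpNorm_clm L h3')
  simp only [smul_eq_mul] at t1 t2 t3
  -- the identity holds for the smooth approximations by the divergence theorem in the chart
  refine tendsto_nhds_unique (t1.add t2) (t3.congr fun k => ?_)
  have ht : IsTest U fun x => θ x * L (φ k x) := hθ.mul_right (hψ k)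
  have h5 := hU.green _ ht i
  simp only [pd_mul hθ.smooth (hψ k), hψd] at h5
  simp only [← mul_assoc] at h5
  rw [← h5]
  refine integral_add ?_ ?_
  · exact (((hθ.pd i).mul_right (hψ k)).continuous).integrable_of_hasCompactSupport
      ((hθ.pd i).mul_right (hψ k)).compact
  · have h6 : IsTest U fun x => θ x * L (pd i (φ k) x) :=
      hθ.mul_right (L.contDiff.comp (contDiff_pd (hφ k).1 i))
    exact h6.continuous.integrable_of_hasCompactSupport h6.compact

/-- The bound by which smooth functions have traces on `B`. -/
def HasTraceBound {n : ℕ} (A B : Set (E n)) (C : NNReal) : Prop :=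
  ∀ φ : E n → ℂ, ContDiff ℝ ∞ φ → HasCompactSupport φ →
    eLpNorm φ 2 (surface B) ≤ C * (eLpNorm φ 2 (volume.restrict A)
      + ∑ i, eLpNorm (pd i φ) 2 (volume.restrict A))

lemma HasTrace.norm_le {C : NNReal} (hC : HasTraceBound A B C) (hA : IsOpen A)
    (h : HasTrace A B u g) (hv : ∀ i, IsWeakPartial A i u (v i)) :
    ‖g‖ ≤ C * (‖u‖ + ∑ i, ‖v i‖) := by
  obtain ⟨v', φ, hv', hφ, h1, h2, h3⟩ := h
  have hvv : ∀ i, v' i = v i := fun i => (hv' i).unique hA (hv i)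
  simp only [hvv] at h2
  have hle : ∀ {ν : Measure (E n)} {f : E n → ℂ} (w : Lp ℂ 2 ν), Continuous f →
      eLpNorm f 2 ν ≤ eLpNorm (fun x => f x - w x) 2 ν + ‖w‖ₑ := by
    intro ν f w hf
    rw [Lp.enorm_def]
    refine le_trans (le_of_eq ?_) (eLpNorm_add_le
      (hf.aestronglyMeasurable.sub (Lp.aestronglyMeasurable w)) (Lp.aestronglyMeasurable w)
      (by norm_num))
    congr 1
    funext x
    simp
  have hle' : ∀ k, ‖g‖ₑ ≤ eLpNorm (fun x => φ k x - g x) 2 (surface B)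
      + C * ((eLpNorm (fun x => φ k x - u x) 2 (volume.restrict A) + ‖u‖ₑ)
        + ∑ i, (eLpNorm (fun x => pd i (φ k) x - v i x) 2 (volume.restrict A) + ‖v i‖ₑ)) := by
    intro k
    have e1 : ‖g‖ₑ ≤ eLpNorm (fun x => φ k x - g x) 2 (surface B)
        + eLpNorm (φ k) 2 (surface B) := by
      rw [Lp.enorm_def, add_comm]
      refine le_trans (le_of_eq ?_) (eLpNorm_sub_le (hφ k).1.continuous.aestronglyMeasurable
        ((hφ k).1.continuous.aestronglyMeasurable.sub (Lp.aestronglyMeasurable g)) (by norm_num))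
      congr 1
      funext x
      simp
    refine e1.trans ?_
    gcongr
    refine (hC (φ k) (hφ k).1 (hφ k).2).trans ?_
    gcongr with i _
    · exact hle u (hφ k).1.continuous
    · exact hle (v i) (contDiff_pd (hφ k).1 i).continuous
  have hlim : Tendsto (fun k => eLpNorm (fun x => φ k x - g x) 2 (surface B)
      + C * ((eLpNorm (fun x => φ k x - u x) 2 (volume.restrict A) + ‖u‖ₑ)
        + ∑ i, (eLpNorm (fun x => pd i (φ k) x - v i x) 2 (volume.restrict A) + ‖v i‖ₑ))) atTop
      (𝓝 (0 + C * ((0 + ‖u‖ₑ) + ∑ i, (0 + ‖v i‖ₑ)))) := by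
    refine h3.add (ENNReal.Tendsto.const_mul ?_ (Or.inr ENNReal.coe_ne_top))
    exact (h1.add tendsto_const_nhds).add
      (tendsto_finsetSum _ fun i _ => (h2 i).add tendsto_const_nhds)
  have h4 := ge_of_tendsto' hlim hle'
  simp only [zero_add] at h4
  have h5 : ‖g‖ₑ ≤ ENNReal.ofReal (C * (‖u‖ + ∑ i, ‖v i‖)) := by
    rw [ENNReal.ofReal_mul C.coe_nonneg, ENNReal.ofReal_coe_nnreal,
      ENNReal.ofReal_add (norm_nonneg _) (Finset.sum_nonneg fun i _ => norm_nonneg _),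
      ENNReal.ofReal_sum_of_nonneg fun i _ => norm_nonneg _]
    simpa only [ofReal_norm] using h4
  rw [← ofReal_norm] at h5
  exact (ENNReal.ofReal_le_ofReal_iff (by positivity)).1 h5

/-- The graph of the trace is closed in `H¹ × L²`. -/
lemma HasTrace.of_tendsto {uk : ℕ → L2 A} {vk : ℕ → Fin n → L2 A} {gk : ℕ → L2Surface B}
    (hA : IsOpen A) (h : ∀ k, HasTrace A B (uk k) (gk k))
    (hw : ∀ k i, IsWeakPartial A i (uk k) (vk k i))
    (hu : Tendsto uk atTop (𝓝 u)) (hv : ∀ i, Tendsto (fun k => vk k i) atTop (𝓝 (v i)))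
    (hg : Tendsto gk atTop (𝓝 g)) : HasTrace A B u g := by
  -- for each `k` a smooth function which is `1/(k+1)`-close to the `k`-th triple
  have hex : ∀ k : ℕ, ∃ φ : E n → ℂ, (ContDiff ℝ ∞ φ ∧ HasCompactSupport φ) ∧
      eLpNorm (fun x => φ x - uk k x) 2 (volume.restrict A) ≤ ((k : ℝ≥0∞) + 1)⁻¹ ∧
      (∀ i, eLpNorm (fun x => fderiv ℝ φ x (e i) - vk k i x) 2 (volume.restrict A)
        ≤ ((k : ℝ≥0∞) + 1)⁻¹) ∧
      eLpNorm (fun x => φ x - gk k x) 2 (surface B) ≤ ((k : ℝ≥0∞) + 1)⁻¹ := by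
    intro k
    obtain ⟨v', φ, hv', hφ, h1, h2, h3⟩ := h k
    have hvv : ∀ i, v' i = vk k i := fun i => (hv' i).unique hA (hw k i)
    simp only [hvv] at h2
    have hpos : (0 : ℝ≥0∞) < ((k : ℝ≥0∞) + 1)⁻¹ :=
      ENNReal.inv_pos.2 (by simp)
    obtain ⟨l, ha, hb, hc⟩ := ((h1.eventually_le_const hpos).and
      ((eventually_all.2 fun i => (h2 i).eventually_le_const hpos).and
        (h3.eventually_le_const hpos))).exists
    exact ⟨φ l, hφ l, ha, hb, hc⟩
  choose φ hφ h1 h2 h3 using hex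
  have hk : Tendsto (fun k : ℕ => ((k : ℝ≥0∞) + 1)⁻¹) atTop (𝓝 0) := by
    have := (tendsto_add_atTop_iff_nat 1).2 ENNReal.tendsto_inv_nat_nhds_zero
    simpa using this
  have key : ∀ {ν : Measure (E n)} {f : ℕ → E n → ℂ} {wk : ℕ → Lp ℂ 2 ν} {w : Lp ℂ 2 ν},
      (∀ k, Continuous (f k)) →
      (∀ k, eLpNorm (fun x => f k x - wk k x) 2 ν ≤ ((k : ℝ≥0∞) + 1)⁻¹) →
      Tendsto wk atTop (𝓝 w) → Tendsto (fun k => eLpNorm (fun x => f k x - w x) 2 ν) atTop (𝓝 0) := by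
    intro ν f wk w hf hfw hw
    have h4 := hk.add ((Lp.tendsto_Lp_iff_tendsto_eLpNorm' wk w).1 hw)
    rw [add_zero] at h4
    refine tendsto_of_tendsto_of_tendsto_of_le_of_le tendsto_const_nhds h4 (fun k => zero_le)
      fun k => ?_
    refine le_trans (le_trans (le_of_eq ?_) (eLpNorm_add_le
      ((hf k).aestronglyMeasurable.sub (Lp.aestronglyMeasurable (wk k)))
      ((Lp.aestronglyMeasurable (wk k)).sub (Lp.aestronglyMeasurable w))
      (by norm_num))) (add_le_add_left (hfw k) _)
    congr 1
    funext x
    simp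
  exact ⟨v, φ, fun i => IsWeakPartial.of_tendsto hu (hv i) fun k => hw k i, hφ,
    key (fun k => (hφ k).1.continuous) h1 hu,
    fun i => key (fun k => (contDiff_pd (hφ k).1 i).continuous) (fun k => h2 k i) (hv i),
    key (fun k => (hφ k).1.continuous) h3 hg⟩

/-- Traces of a sequence which converges in `H¹` converge. -/
lemma HasTrace.exists_tendsto {C : NNReal} (hC : HasTraceBound A B C) {uk : ℕ → L2 A}
    {vk : ℕ → Fin n → L2 A} {gk : ℕ → L2Surface B}
    (hA : IsOpen A) (h : ∀ k, HasTrace A B (uk k) (gk k))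
    (hw : ∀ k i, IsWeakPartial A i (uk k) (vk k i))
    (hu : Tendsto uk atTop (𝓝 u)) (hv : ∀ i, Tendsto (fun k => vk k i) atTop (𝓝 (v i))) :
    ∃ g : L2Surface B, Tendsto gk atTop (𝓝 g) := by
  refine cauchySeq_tendsto_of_complete (cauchySeq_iff_tendsto_dist_atTop_0.2 ?_)
  have hcu := cauchySeq_iff_tendsto_dist_atTop_0.1 hu.cauchySeq
  have hcv := fun i => cauchySeq_iff_tendsto_dist_atTop_0.1 (hv i).cauchySeq
  have hlim := (hcu.add (tendsto_finsetSum Finset.univ fun i _ => hcv i)).const_mul (C : ℝ)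
  rw [Finset.sum_const_zero, add_zero, mul_zero] at hlim
  refine squeeze_zero (fun _ => dist_nonneg) (fun p => ?_) hlim
  have h1 : HasTrace A B (uk p.1 - uk p.2) (gk p.1 - gk p.2) := by
    simpa only [sub_eq_add_neg, neg_one_smul] using (h p.1).add ((h p.2).smul (-1))
  have h2 : ∀ i, IsWeakPartial A i (uk p.1 - uk p.2) (vk p.1 i - vk p.2 i) := fun i => by
    simpa only [sub_eq_add_neg, neg_one_smul] using (hw p.1 i).add ((hw p.2 i).smul (-1))
  simpa only [dist_eq_norm] using h1.norm_le hC hA h2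

/-- If `gₖ = ∑ᵢ νᵢ tᵢₖ` with a bounded field `ν`, which need not be measurable, then this persists in
the limit. -/
lemma ae_eq_sum_of_tendsto {ν : Measure (E n)} {N : E n → E n} (hN : ∀ x i, |N x i| ≤ 1)
    {gk : ℕ → Lp ℂ 2 ν} {g : Lp ℂ 2 ν} {tk : ℕ → Fin n → Lp ℂ 2 ν} {t : Fin n → Lp ℂ 2 ν}
    (h : ∀ k, ∀ᵐ x ∂ν, gk k x = ∑ i, ((N x i : ℝ) : ℂ) * tk k i x)
    (hg : Tendsto gk atTop (𝓝 g)) (ht : ∀ i, Tendsto (fun k => tk k i) atTop (𝓝 (t i))) :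
    ∀ᵐ x ∂ν, g x = ∑ i, ((N x i : ℝ) : ℂ) * t i x := by
  -- the error is at most `H k` for every `k`, hence at most the infimum, which is measurable although
  -- the error itself need not be
  set H : ℕ → E n → ℝ := fun k x => ‖gk k x - g x‖ + ∑ i, ‖tk k i x - t i x‖ with hH
  have hHm : ∀ k, AEMeasurable (fun x => ENNReal.ofReal (H k x ^ 2)) ν := by
    intro k
    have hm : ∀ a b : Lp ℂ 2 ν, AEMeasurable (fun x => ‖a x - b x‖) ν := fun a b =>
      ((Lp.aestronglyMeasurable a).sub (Lp.aestronglyMeasurable b)).norm.aemeasurable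
    exact (((hm _ _).add (Finset.aemeasurable_fun_sum _ fun i _ => hm _ _)).pow_const 2).ennreal_ofReal
  have hlim : Tendsto (fun k => eLpNorm (H k) 2 ν) atTop (𝓝 0) := by
    have h1 := ((Lp.tendsto_Lp_iff_tendsto_eLpNorm' gk g).1 hg).add
      (tendsto_finsetSum Finset.univ fun i _ =>
        (Lp.tendsto_Lp_iff_tendsto_eLpNorm' (fun k => tk k i) (t i)).1 (ht i))
    rw [Finset.sum_const_zero, add_zero] at h1
    refine tendsto_of_tendsto_of_tendsto_of_le_of_le tendsto_const_nhds h1 (fun k => zero_le)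
      fun k => ?_
    have hm : ∀ a b : Lp ℂ 2 ν, AEStronglyMeasurable (fun x => ‖a x - b x‖) ν := fun a b =>
      ((Lp.aestronglyMeasurable a).sub (Lp.aestronglyMeasurable b)).norm
    have e1 : H k = (fun x => ‖gk k x - g x‖) + ∑ i, fun x => ‖tk k i x - t i x‖ := by
      funext x
      simp [hH]
    rw [e1]
    refine (eLpNorm_add_le (hm _ _) (Finset.aestronglyMeasurable_sum _ fun i _ => hm _ _)
      (by norm_num)).trans (add_le_add (le_of_eq (eLpNorm_norm _)) ?_)
    refine (eLpNorm_sum_le (fun i _ => hm _ _) (by norm_num)).trans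
      (Finset.sum_le_sum fun i _ => le_of_eq (eLpNorm_norm _))
  have hinf : ∫⁻ x, ⨅ k, ENNReal.ofReal (H k x ^ 2) ∂ν = 0 := by
    have h2 : Tendsto (fun k => eLpNorm (H k) 2 ν ^ 2) atTop (𝓝 0) := by
      simpa [Function.comp_def] using ((ENNReal.continuous_pow 2).tendsto 0).comp hlim
    refine le_antisymm (ge_of_tendsto' h2 fun k => ?_) zero_le
    rw [eLpNorm_two_sq]
    refine lintegral_mono fun x => (iInf_le _ k).trans (le_of_eq ?_)
    rw [Real.norm_eq_abs, sq_abs]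
  rw [lintegral_eq_zero_iff' (AEMeasurable.iInf hHm)] at hinf
  filter_upwards [hinf, ae_all_iff.2 h] with x hx hgx
  rw [← sub_eq_zero, ← norm_eq_zero]
  have hle : ∀ k, ENNReal.ofReal (‖g x - ∑ i, ((N x i : ℝ) : ℂ) * t i x‖ ^ 2)
      ≤ ENNReal.ofReal (H k x ^ 2) := by
    intro k
    refine ENNReal.ofReal_le_ofReal (pow_le_pow_left₀ (norm_nonneg _) ?_ 2)
    have e1 : g x - ∑ i, ((N x i : ℝ) : ℂ) * t i x
        = -(gk k x - g x) + ∑ i, ((N x i : ℝ) : ℂ) * (tk k i x - t i x) := by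
      simp only [mul_sub, Finset.sum_sub_distrib]
      rw [← hgx k]
      ring
    rw [e1]
    refine (norm_add_le _ _).trans (add_le_add (le_of_eq (norm_neg _))
      ((norm_sum_le _ _).trans (Finset.sum_le_sum fun i _ => ?_)))
    rw [norm_mul, Complex.norm_real]
    exact mul_le_of_le_one_left (norm_nonneg _) (hN x i)
  have h3 : ENNReal.ofReal (‖g x - ∑ i, ((N x i : ℝ) : ℂ) * t i x‖ ^ 2) ≤ 0 :=
    (le_iInf hle).trans (le_of_eq hx)
  have h4 := ENNReal.ofReal_eq_zero.1 (le_antisymm h3 zero_le)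
  exact pow_eq_zero_iff two_ne_zero |>.1 (le_antisymm h4 (sq_nonneg _))

lemma abs_outerNormal_le (D : Set (E n)) (x : E n) (i : Fin n) : |outerNormal D x i| ≤ 1 := by
  refine (PiLp.norm_apply_le (outerNormal D x) i).trans ?_
  rw [outerNormal]
  split_ifs with h
  · rw [norm_smul, norm_inv, norm_norm]
    exact inv_mul_le_one
  · simp

end Trace

/-! ### Gluing across an interface -/

section Glue

variable {n : ℕ} {A A' B U : Set (E n)} {μ : Measure (E n)} {N : Fin n → E n → ℝ} {K K' : NNReal}

/-- The real function which equals `L ∘ f` in `A` and `L ∘ g` in `A'` and vanishes elsewhere, where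
`L` takes the real or the imaginary part. -/
noncomputable def glue {n : ℕ} {A A' : Set (E n)} (L : ℂ →L[ℝ] ℝ) (f : L2 A) (g : L2 A') (x : E n) : ℝ :=
  A.indicator (fun x => L (f x)) x + A'.indicator (fun x => L (g x)) x

lemma glue_comm (L : ℂ →L[ℝ] ℝ) (f : L2 A) (g : L2 A') : glue L f g = glue L g f := by
  funext x
  exact add_comm _ _

lemma memLp_clm (hA : MeasurableSet A) (L : ℂ →L[ℝ] ℝ) (f : L2 A) :
    MemLp (A.indicator fun x => L (f x)) 2 volume :=
  (memLp_indicator_iff_restrict hA).2 (L.comp_memLp' (Lp.memLp f))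

lemma memLp_glue (hA : MeasurableSet A) (hA' : MeasurableSet A') (L : ℂ →L[ℝ] ℝ) (f : L2 A)
    (g : L2 A') : MemLp (glue L f g) 2 volume :=
  (memLp_clm hA L f).add (memLp_clm hA' L g)

lemma integral_mul_glue (hA : MeasurableSet A) (hA' : MeasurableSet A') (L : ℂ →L[ℝ] ℝ) (f : L2 A)
    (g : L2 A') {φ : E n → ℝ} (hφ : IsTest Set.univ φ) :
    ∫ x, φ x • glue L f g x = (∫ x in A, φ x * L (f x)) + ∫ x in A', φ x * L (g x) := by
  have h1 := hφ.integrable ((memLp_clm hA L f).locallyIntegrable (by norm_num))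
  have h2 := hφ.integrable ((memLp_clm hA' L g).locallyIntegrable (by norm_num))
  simp only [glue, smul_add]
  rw [integral_add h1 h2, integral_smul_indicator hA, integral_smul_indicator hA']
  rfl

lemma IsWeakPartial.integral_clm {i : Fin n} {u v : L2 A} (h : IsWeakPartial A i u v)
    (L : ℂ →L[ℝ] ℝ) {φ : E n → ℝ} (hφ : IsTest A φ) :
    ∫ x in A, pd i φ x * L (u x) = -∫ x in A, φ x * L (v x) := by
  have h1 := congrArg L (h φ hφ.smooth hφ.compact hφ.subset)
  have hφi := hφ.pd i
  rw [map_neg, ← L.integral_comp_comm (integrable_test hφi.continuous hφi.compact u),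
    ← L.integral_comp_comm (integrable_test hφ.continuous hφ.compact v)] at h1
  simpa only [← Complex.real_smul, map_smul, smul_eq_mul] using h1

/-- Inside one of the two open sets, weak derivatives of glued functions are glued weak derivatives. -/
lemma weakPartialOn_glue_left (hA : IsOpen A) (hA' : MeasurableSet A') (hd : Disjoint A A')
    {i : Fin n} {u v : L2 A} {u' v' : L2 A'} (h : IsWeakPartial A i u v) (L : ℂ →L[ℝ] ℝ) :
    WeakPartialOn A i (glue L u u') (glue L v v') := by
  intro φ hφ
  have hz : ∀ {ψ : E n → ℝ}, IsTest A ψ → ∀ f : L2 A', ∫ x in A', ψ x * L (f x) = 0 := by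
    intro ψ hψ f
    refine setIntegral_eq_zero_of_forall_eq_zero fun x hx => ?_
    rw [hψ.zero_off (Set.disjoint_right.1 hd hx), zero_mul]
  rw [integral_mul_glue hA.measurableSet hA' L u u' ((hφ.pd i).mono (Set.subset_univ _)),
    integral_mul_glue hA.measurableSet hA' L v v' (hφ.mono (Set.subset_univ _)), hz (hφ.pd i),
    hz hφ, add_zero, add_zero, h.integral_clm L hφ]

/-- A function with equal traces from both sides of an interface has no singular derivative on it. -/
lemma weakPartialOn_glue_interface (hA : IsOpen A) (hA' : IsOpen A')
    (hU : IsGreenChart A B U μ N K) (hU' : IsGreenChart A' B U μ (fun i x => -N i x) K')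
    {u : L2 A} {u' : L2 A'} {v : Fin n → L2 A} {v' : Fin n → L2 A'} {g g' : L2Surface B}
    (hv : ∀ i, IsWeakPartial A i u (v i)) (hv' : ∀ i, IsWeakPartial A' i u' (v' i))
    (hg : HasTrace A B u g) (hg' : HasTrace A' B u' g')
    (hgg : ∀ᵐ x ∂μ, x ∈ U → g x = g' x) (L : ℂ →L[ℝ] ℝ) (i : Fin n) :
    WeakPartialOn U i (glue L u u') (glue L (v i) (v' i)) := by
  intro φ hφ
  rw [integral_mul_glue hA.measurableSet hA'.measurableSet L u u'
      ((hφ.pd i).mono (Set.subset_univ _)),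
    integral_mul_glue hA.measurableSet hA'.measurableSet L (v i) (v' i)
      (hφ.mono (Set.subset_univ _))]
  have h1 := hg.green hA hv hU L hφ i
  have h2 := hg'.green hA' hv' hU' L hφ i
  have h3 : ∫ x, N i x * φ x * L (g x) ∂μ = -∫ x, -N i x * φ x * L (g' x) ∂μ := by
    rw [← integral_neg]
    refine integral_congr_ae ?_
    filter_upwards [hgg] with x hx
    by_cases hxU : x ∈ U
    · rw [hx hxU]; ring
    · simp [hφ.zero_off hxU]
  linarith

/-- A function with vanishing trace has no singular derivative when it is extended by zero. -/
lemma weakPartialOn_glue_outer (hA : IsOpen A) (hA' : IsOpen A')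
    (hU : IsGreenChart A' B U μ N K) (hd : Disjoint U A)
    {u : L2 A} {u' : L2 A'} {v : Fin n → L2 A} {v' : Fin n → L2 A'}
    (hv' : ∀ i, IsWeakPartial A' i u' (v' i))
    (hg' : HasTrace A' B u' 0) (L : ℂ →L[ℝ] ℝ) (i : Fin n) :
    WeakPartialOn U i (glue L u u') (glue L (v i) (v' i)) := by
  intro φ hφ
  have hz : ∀ {ψ : E n → ℝ}, IsTest U ψ → ∀ f : L2 A, ∫ x in A, ψ x * L (f x) = 0 := by
    intro ψ hψ f
    refine setIntegral_eq_zero_of_forall_eq_zero fun x hx => ?_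
    rw [hψ.zero_off (Set.disjoint_right.1 hd hx), zero_mul]
  rw [integral_mul_glue hA.measurableSet hA'.measurableSet L u u'
      ((hφ.pd i).mono (Set.subset_univ _)),
    integral_mul_glue hA.measurableSet hA'.measurableSet L (v i) (v' i)
      (hφ.mono (Set.subset_univ _)), hz (hφ.pd i), hz hφ]
  have h1 := hg'.green hA' hv' hU L hφ i
  have h2 : ∫ x, N i x * φ x * L ((0 : L2Surface B) x) ∂μ = 0 := by
    refine integral_eq_zero_of_ae ?_
    filter_upwards [(Measure.absolutelyContinuous_of_le hU.le_surface).ae_le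
      (Lp.coeFn_zero ℂ 2 (surface B))] with x hx
    rw [hx]
    simp
  linarith

lemma IsWeakPartial.symm (hA : IsOpen A) {u : L2 A} {v : Fin n → L2 A}
    {w : Fin n → Fin n → L2 A} (hv : ∀ i, IsWeakPartial A i u (v i))
    (hw : ∀ i j, IsWeakPartial A j (v i) (w i j)) (i j : Fin n) : w i j = w j i := by
  have hm := hA.measurableSet
  have hloc : ∀ f : L2 A, LocallyIntegrable (A.indicator f) := fun f =>
    (memLp_indicator_coe hm f).locallyIntegrable (by norm_num)
  have h1 := WeakPartialOn.symm hA (hloc (w i j)) (hloc (w j i)) ((isWeakPartial_iff hm).1 (hv i))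
    ((isWeakPartial_iff hm).1 (hv j)) ((isWeakPartial_iff hm).1 (hw i j))
    ((isWeakPartial_iff hm).1 (hw j i))
  refine Lp.ext ?_
  rw [EventuallyEq, ae_restrict_iff' hm]
  filter_upwards [h1] with x hx hxA
  simpa [hxA] using hx hxA

/-- The jump of the gradient across an interface is normal to it, since second derivatives commute. -/
lemma jump_normal (hA : IsOpen A) (hA' : IsOpen A')
    (hU : IsGreenChart A B U μ N K) (hU' : IsGreenChart A' B U μ (fun i x => -N i x) K')
    {u : L2 A} {u' : L2 A'} {v : Fin n → L2 A} {v' : Fin n → L2 A'} {w : Fin n → Fin n → L2 A}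
    {w' : Fin n → Fin n → L2 A'} {g : L2Surface B} {t t' : Fin n → L2Surface B}
    (hv : ∀ i, IsWeakPartial A i u (v i)) (hv' : ∀ i, IsWeakPartial A' i u' (v' i))
    (hw : ∀ i j, IsWeakPartial A j (v i) (w i j)) (hw' : ∀ i j, IsWeakPartial A' j (v' i) (w' i j))
    (hg : HasTrace A B u g) (hg' : HasTrace A' B u' g)
    (ht : ∀ i, HasTrace A B (v i) (t i)) (ht' : ∀ i, HasTrace A' B (v' i) (t' i))
    (L : ℂ →L[ℝ] ℝ) (i j : Fin n) :
    ∀ᵐ x ∂μ, x ∈ U → N j x * (L (t i x) - L (t' i x)) = N i x * (L (t j x) - L (t' j x)) := by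
  have := hU.finite
  have hint : ∀ f : L2Surface B, Integrable (fun x => L (f x)) μ := fun f =>
    (L.comp_memLp' ((Lp.memLp f).mono_measure hU.le_surface)).integrable (by norm_num)
  have hloc : ∀ i j, LocallyIntegrableOn (fun x => N j x * (L (t i x) - L (t' i x))) U μ :=
    fun i j => LocallyIntegrableOn.continuousOn_mul
      (((hint (t i)).sub (hint (t' i))).locallyIntegrable.locallyIntegrableOn U) (hU.cont j)
      hU.isOpen.isLocallyClosed
  -- both sides of the identity `∂ⱼ∂ᵢ u = ∂ᵢ∂ⱼ u` are expressed by the jumps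
  have key : ∀ φ, IsTest U φ → ∀ i j, (∫ x, pd j φ x • glue L (v i) (v' i) x)
      + ∫ x, φ x • glue L (w i j) (w' i j) x
        = ∫ x, φ x * (N j x * (L (t i x) - L (t' i x))) ∂μ := by
    intro φ hφ i j
    rw [integral_mul_glue hA.measurableSet hA'.measurableSet L (v i) (v' i)
        ((hφ.pd j).mono (Set.subset_univ _)),
      integral_mul_glue hA.measurableSet hA'.measurableSet L (w i j) (w' i j)
        (hφ.mono (Set.subset_univ _))]
    have h1 := (ht i).green hA (hw i) hU L hφ j
    have h2 := (ht' i).green hA' (hw' i) hU' L hφ j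
    have hNφ : ∀ f : L2Surface B, Integrable (fun x => N j x * φ x * L (f x)) μ := by
      intro f
      have hc : Continuous fun x => N j x * φ x :=
        ContinuousOn.continuous_of_tsupport_subset ((hU.cont j).mul hφ.continuous.continuousOn)
          hU.isOpen (tsupport_mul_subset_right.trans hφ.subset)
      have hcc : HasCompactSupport fun x => N j x * φ x := hφ.compact.mul_left
      exact (hint f).locallyIntegrable.integrable_smul_left_of_hasCompactSupport hc hcc
    have h3 : ∫ x, φ x * (N j x * (L (t i x) - L (t' i x))) ∂μ
        = (∫ x, N j x * φ x * L (t i x) ∂μ) + ∫ x, -N j x * φ x * L (t' i x) ∂μ := by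
      have h4 : Integrable (fun x => -N j x * φ x * L (t' i x)) μ := by
        refine (hNφ (t' i)).neg.congr (Eventually.of_forall fun x => ?_)
        simp
      rw [← integral_add (hNφ (t i)) h4]
      refine integral_congr_ae (Eventually.of_forall fun x => ?_)
      ring
    rw [h3, ← h1, ← h2]
    ring
  have hgU := weakPartialOn_glue_interface hA hA' hU hU' hv hv' hg hg'
    (Eventually.of_forall fun x _ => rfl) L
  have h0 := hU.isOpen.ae_eq_zero_of_integral_contDiff_smul_eq_zero (μ := μ)
    ((hloc i j).sub (hloc j i)) fun φ h1 h2 h3 => by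
      have hφ : IsTest U φ := ⟨h1, h2, h3⟩
      have k1 := key φ hφ i j
      have k2 := key φ hφ j i
      have e1 : glue L (w i j) (w' i j) = glue L (w j i) (w' j i) := by
        rw [IsWeakPartial.symm hA hv hw, IsWeakPartial.symm hA' hv' hw']
      have e2 := hgU i _ (hφ.pd j)
      have e3 := hgU j _ (hφ.pd i)
      simp only [pd_comm hφ.smooth i j] at e2
      rw [e1] at k1
      have hi : ∀ i j, Integrable (fun x => φ x * (N j x * (L (t i x) - L (t' i x)))) μ := by
        intro i j
        have hc : Continuous fun x => φ x * N j x :=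
          ContinuousOn.continuous_of_tsupport_subset (hφ.continuous.continuousOn.mul (hU.cont j))
            hU.isOpen (tsupport_mul_subset_left.trans hφ.subset)
        have hcc : HasCompactSupport fun x => φ x * N j x := hφ.compact.mul_right
        simpa only [smul_eq_mul, mul_assoc, Pi.sub_apply] using
          ((hint (t i)).sub (hint (t' i))).locallyIntegrable.integrable_smul_left_of_hasCompactSupport
            hc hcc
      simp only [Pi.sub_apply, smul_eq_mul, mul_sub (φ _)]
      rw [integral_sub (hi i j) (hi j i)]
      linarith
  filter_upwards [h0] with x hx hxU
  exact sub_eq_zero.1 (hx hxU)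

/-- If the normal derivatives agree as well, the gradient does not jump. -/
lemma traces_eq (hA : IsOpen A) (hA' : IsOpen A') (hB : MeasurableSet B)
    (hU : IsGreenChart A B U μ N K) (hU' : IsGreenChart A' B U μ (fun i x => -N i x) K')
    {ν : E n → E n} (hN : ∀ x ∈ U ∩ B, ∃ a : ℝ, a ≠ 0 ∧ ∀ i, N i x = a * ν x i)
    {u : L2 A} {u' : L2 A'} {v : Fin n → L2 A} {v' : Fin n → L2 A'} {w : Fin n → Fin n → L2 A}
    {w' : Fin n → Fin n → L2 A'} {g : L2Surface B} {t t' : Fin n → L2Surface B}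
    (hv : ∀ i, IsWeakPartial A i u (v i)) (hv' : ∀ i, IsWeakPartial A' i u' (v' i))
    (hw : ∀ i j, IsWeakPartial A j (v i) (w i j)) (hw' : ∀ i j, IsWeakPartial A' j (v' i) (w' i j))
    (hg : HasTrace A B u g) (hg' : HasTrace A' B u' g)
    (ht : ∀ i, HasTrace A B (v i) (t i)) (ht' : ∀ i, HasTrace A' B (v' i) (t' i))
    (htt : ∀ᵐ x ∂surface B, ∑ i, ((ν x i : ℝ) : ℂ) * t i x = ∑ i, ((ν x i : ℝ) : ℂ) * t' i x) :
    ∀ᵐ x ∂μ, x ∈ U → ∀ i, t i x = t' i x := by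
  obtain ⟨k, s, hs, hk⟩ := hU.unit
  have hac := Measure.absolutelyContinuous_of_le hU.le_surface
  have hBμ : ∀ᵐ x ∂μ, x ∈ B := hac.ae_le (ae_restrict_mem hB)
  have hL : ∀ L : ℂ →L[ℝ] ℝ, ∀ᵐ x ∂μ, x ∈ U → ∀ i, L (t i x) = L (t' i x) := by
    intro L
    have hj := ae_all_iff.2 fun i => ae_all_iff.2 fun j =>
      jump_normal hA hA' hU hU' hv hv' hw hw' hg hg' ht ht' L i j
    filter_upwards [hj, hac.ae_le htt, hBμ] with x hx hxs hxB hxU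
    obtain ⟨a, ha, hNa⟩ := hN x ⟨hxU, hxB⟩
    have h1 : ∑ i, N i x * (L (t i x) - L (t' i x)) = 0 := by
      have h2 := congrArg L hxs
      simp only [map_sum, ← Complex.real_smul, map_smul, smul_eq_mul] at h2
      simp only [hNa, mul_assoc, mul_sub, Finset.sum_sub_distrib, ← Finset.mul_sum]
      rw [h2, sub_self]
    have hs2 : s * s = 1 := by rcases hs with h | h <;> rw [h] <;> norm_num
    have hNk : N k x = s := hk x hxU
    -- for the jump `d`: `Nₖ dᵢ = Nᵢ dₖ` and `∑ Nᵢ dᵢ = 0` give `|N|² dₖ = 0`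
    have h3 : (∑ i, N i x * N i x) * (L (t k x) - L (t' k x)) = 0 := by
      have h4 : s * ∑ i, N i x * (L (t i x) - L (t' i x)) = 0 := by rw [h1, mul_zero]
      rw [← h4, Finset.sum_mul, Finset.mul_sum]
      refine Finset.sum_congr rfl fun i _ => ?_
      rw [mul_assoc, ← hx i k hxU, hNk]
      ring
    have h5 : (0 : ℝ) < ∑ i, N i x * N i x := by
      refine Finset.sum_pos' (fun i _ => mul_self_nonneg _) ⟨k, Finset.mem_univ k, ?_⟩
      rw [hNk, hs2]
      exact one_pos
    have h6 := (mul_eq_zero.1 h3).resolve_left h5.ne'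
    intro i
    have h7 := hx i k hxU
    rw [h6, mul_zero, hNk] at h7
    have hs0 : s ≠ 0 := fun h => by rw [h] at hs2; norm_num at hs2
    exact sub_eq_zero.1 ((mul_eq_zero.1 h7).resolve_left hs0)
  filter_upwards [hL Complex.reCLM, hL Complex.imCLM] with x h1 h2 hxU i
  exact Complex.ext (h1 hxU i) (h2 hxU i)

lemma norm_sq_eq_integral (f : L2 A) : ‖f‖ ^ 2 = ∫ x in A, ‖f x‖ ^ 2 := by
  have h1 := eLpNorm_two_sq f (volume.restrict A)
  rw [← Lp.enorm_def, ← ofReal_norm, ← ENNReal.ofReal_pow (norm_nonneg _),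
    ← ofReal_integral_eq_lintegral_ofReal ((memLp_two_iff_integrable_sq_norm
      (Lp.aestronglyMeasurable f)).1 (Lp.memLp f)) (Eventually.of_forall fun x => by positivity)] at h1
  exact (ENNReal.ofReal_eq_ofReal_iff (by positivity)
    (integral_nonneg fun x => by positivity)).1 h1

lemma integral_glue_sq (hA : MeasurableSet A) (hA' : MeasurableSet A') (hd : Disjoint A A')
    (f : L2 A) (g : L2 A') :
    (∫ x, glue Complex.reCLM f g x ^ 2) + (∫ x, glue Complex.imCLM f g x ^ 2)
      = ‖f‖ ^ 2 + ‖g‖ ^ 2 := by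
  have hsq : ∀ {f : E n → ℝ}, MemLp f 2 volume → Integrable (fun x => f x ^ 2) volume :=
    fun hf => hf.integrable_sq
  have hn : ∀ {A : Set (E n)} (f : L2 A), Integrable (fun x => ‖f x‖ ^ 2) (volume.restrict A) :=
    fun f => (memLp_two_iff_integrable_sq_norm (Lp.aestronglyMeasurable f)).1 (Lp.memLp f)
  rw [← integral_add (hsq (memLp_glue hA hA' _ f g)) (hsq (memLp_glue hA hA' _ f g)),
    norm_sq_eq_integral, norm_sq_eq_integral, ← integral_indicator hA, ← integral_indicator hA',
    ← integral_add ((integrable_indicator_iff hA).2 (hn f)) ((integrable_indicator_iff hA').2 (hn g))]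
  refine integral_congr_ae (Eventually.of_forall fun x => ?_)
  have key : ∀ z : ℂ, z.re ^ 2 + z.im ^ 2 = ‖z‖ ^ 2 := fun z => by
    rw [Complex.sq_norm, Complex.normSq_apply]
    ring
  by_cases hx : x ∈ A
  · have hx' : x ∉ A' := Set.disjoint_left.1 hd hx
    simp [glue, hx, hx', key]
  · by_cases hx' : x ∈ A' <;> simp [glue, hx, hx', key]

end Glue

/-! ### The transmission problem -/

section Transmission

variable {m : ℕ} {Ω Ω₁ : Set (E (m + 1))}

lemma MemH2.isWeakPartial {n : ℕ} {A : Set (E n)} (hA : IsOpen A) {u : L2 A} (h : MemH2 A u)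
    (i : Fin n) : IsWeakPartial A i u (weakPartial A i u) := by
  obtain ⟨v, hv, -⟩ := h i
  rwa [hv.eq hA]

lemma MemH2.isWeakPartial₂ {n : ℕ} {A : Set (E n)} (hA : IsOpen A) {u : L2 A} (h : MemH2 A u)
    (i j : Fin n) :
    IsWeakPartial A j (weakPartial A i u) (weakPartial A j (weakPartial A i u)) := by
  obtain ⟨v, hv, hw⟩ := h i
  obtain ⟨w, hw⟩ := hw j
  rw [hv.eq hA, hw.eq hA]
  exact hw

/-- The geometric assumptions: a smooth bounded open set and a smooth open subset at a positive
distance from the boundary. -/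
structure IsTransmissionDomain {n : ℕ} (Ω Ω₁ : Set (E n)) : Prop where
  isOpen : IsOpen Ω
  bounded : Bornology.IsBounded Ω
  smooth : HasSmoothBoundary Ω
  isOpen₁ : IsOpen Ω₁
  smooth₁ : HasSmoothBoundary Ω₁
  closure_subset : closure Ω₁ ⊆ Ω

namespace IsTransmissionDomain

lemma isOpen₂ {n : ℕ} {Ω Ω₁ : Set (E n)} (h : IsTransmissionDomain Ω Ω₁) :
    IsOpen (outerDomain Ω Ω₁) :=
  h.isOpen.sdiff isClosed_closure

lemma disjoint {n : ℕ} (Ω Ω₁ : Set (E n)) : Disjoint Ω₁ (outerDomain Ω Ω₁) :=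
  Set.disjoint_left.2 fun _ hx hx' => hx'.2 (subset_closure hx)

lemma isCompact_frontier {n : ℕ} {Ω Ω₁ : Set (E n)} (h : IsTransmissionDomain Ω Ω₁) :
    IsCompact (frontier Ω₁) :=
  Metric.isCompact_of_isClosed_isBounded isClosed_frontier
    (h.bounded.subset (frontier_subset_closure.trans h.closure_subset))

/-- Charts at the interface: the two sides share the measure and have opposite normal fields. -/
lemma exists_interface_chart (h : IsTransmissionDomain Ω Ω₁) {x : E (m + 1)}
    (hx : x ∈ frontier Ω₁) :
    ∃ (U : Set (E (m + 1))) (μ : Measure (E (m + 1))) (N : Fin (m + 1) → E (m + 1) → ℝ)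
      (K : NNReal), x ∈ U ∧ IsGreenChart Ω₁ (frontier Ω₁) U μ N K ∧
      IsGreenChart (outerDomain Ω Ω₁) (frontier Ω₁) U μ (fun i x => -N i x) K ∧
      ∀ x ∈ U ∩ frontier Ω₁, ∃ a : ℝ, a ≠ 0 ∧ ∀ i, N i x = a * outerNormal Ω₁ x i := by
  obtain ⟨ρ, hρ⟩ := h.smooth₁ x hx
  obtain ⟨U, μ, N, K, hxU, hU, hU', hN⟩ := exists_greenChart h.isOpen₁ hρ
  have hV : IsOpen (U ∩ Ω) := hU.isOpen.inter h.isOpen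
  refine ⟨U ∩ Ω, μ, N, K, ⟨hxU, h.closure_subset (frontier_subset_closure hx)⟩,
    hU.restrict hV Set.inter_subset_left h.isOpen₁.measurableSet h.isOpen₁.measurableSet
      fun _ _ => Iff.rfl,
    hU'.restrict hV Set.inter_subset_left isClosed_closure.measurableSet.compl
      h.isOpen₂.measurableSet fun y hy => ?_, fun y hy => hN y ⟨hy.1.1, hy.2⟩⟩
  exact ⟨fun h1 => ⟨hy.2, h1⟩, fun h1 => h1.2⟩

/-- Charts at the outer boundary, which do not meet the inner domain. -/
lemma exists_outer_chart (h : IsTransmissionDomain Ω Ω₁) {x : E (m + 1)} (hx : x ∈ frontier Ω) :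
    ∃ (U : Set (E (m + 1))) (μ : Measure (E (m + 1))) (N : Fin (m + 1) → E (m + 1) → ℝ)
      (K : NNReal), x ∈ U ∧ IsGreenChart (outerDomain Ω Ω₁) (frontier Ω) U μ N K ∧
      Disjoint U Ω₁ := by
  obtain ⟨ρ, hρ⟩ := h.smooth x hx
  obtain ⟨U, μ, N, K, hxU, hU, -, -⟩ := exists_greenChart h.isOpen hρ
  have hV : IsOpen (U ∩ (closure Ω₁)ᶜ) := hU.isOpen.inter isClosed_closure.isOpen_compl
  rw [h.isOpen.frontier_eq] at hx
  refine ⟨U ∩ (closure Ω₁)ᶜ, μ, N, K, ⟨hxU, fun h1 => hx.2 (h.closure_subset h1)⟩,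
    hU.restrict hV Set.inter_subset_left h.isOpen.measurableSet h.isOpen₂.measurableSet
      fun y hy => ⟨fun h1 => ⟨h1, hy.2⟩, fun h1 => h1.1⟩, ?_⟩
  exact Set.disjoint_left.2 fun y hy hy' => hy.2 (subset_closure hy')

lemma exists_trace_bound₁ (h : IsTransmissionDomain Ω Ω₁) :
    ∃ C, HasTraceBound Ω₁ (frontier Ω₁) C := by
  refine exists_trace_bound h.isCompact_frontier fun x hx => ?_
  obtain ⟨U, μ, N, K, hxU, hU, -⟩ := h.exists_interface_chart hx
  exact ⟨U, μ, N, K, hxU, hU⟩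

lemma exists_trace_bound₂ (h : IsTransmissionDomain Ω Ω₁) :
    ∃ C, HasTraceBound (outerDomain Ω Ω₁) (frontier Ω₁) C := by
  refine exists_trace_bound h.isCompact_frontier fun x hx => ?_
  obtain ⟨U, μ, N, K, hxU, -, hU, -⟩ := h.exists_interface_chart hx
  exact ⟨U, μ, _, K, hxU, hU⟩

/-- The two parts of an element of the transmission space fit together to a function in
`H²(Ω) ∩ H¹₀(Ω)`. -/
lemma isDirichletH2_glue (h : IsTransmissionDomain Ω Ω₁) (u : X Ω Ω₁) (L : ℂ →L[ℝ] ℝ) :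
    IsDirichletH2 Ω (glue L u.1.1 u.1.2)
      (fun i => glue L (weakPartial Ω₁ i u.1.1) (weakPartial (outerDomain Ω Ω₁) i u.1.2))
      (fun i j => glue L (weakPartial Ω₁ j (weakPartial Ω₁ i u.1.1))
        (weakPartial (outerDomain Ω Ω₁) j (weakPartial (outerDomain Ω Ω₁) i u.1.2))) := by
  obtain ⟨⟨u₁, u₂⟩, hu₁, hu₂, htr, ⟨g, hg₁, hg₂⟩, ⟨q, ⟨v, t, hv, ht, hq⟩, ⟨v', t', hv', ht', hq'⟩⟩⟩ := u
  simp only at hu₁ hu₂ htr hg₁ hg₂ hv ht hv' ht' ⊢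
  have hm₁ := h.isOpen₁.measurableSet
  have hm₂ := h.isOpen₂.measurableSet
  have hvv : ∀ i, v i = weakPartial Ω₁ i u₁ := fun i => ((hv i).eq h.isOpen₁).symm
  have hvv' : ∀ i, v' i = weakPartial (outerDomain Ω Ω₁) i u₂ := fun i =>
    ((hv' i).eq h.isOpen₂).symm
  simp only [hvv, hvv'] at hv ht hv' ht'
  have hw := hu₁.isWeakPartial₂ h.isOpen₁
  have hw' := hu₂.isWeakPartial₂ h.isOpen₂
  have hzero : ∀ (f : L2 Ω₁) (g : L2 (outerDomain Ω Ω₁)), ∀ x ∉ Ω, glue L f g x = 0 := by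
    intro f g x hx
    have h1 : x ∉ Ω₁ := fun h1 => hx (h.closure_subset (subset_closure h1))
    have h2 : x ∉ outerDomain Ω Ω₁ := fun h2 => hx h2.1
    simp only [glue, Set.indicator_of_notMem h1, Set.indicator_of_notMem h2, add_zero]
  have hloc : ∀ (f : L2 Ω₁) (g : L2 (outerDomain Ω Ω₁)), LocallyIntegrable (glue L f g) :=
    fun f g => (memLp_glue hm₁ hm₂ L f g).locallyIntegrable (by norm_num)
  refine ⟨memLp_glue hm₁ hm₂ L _ _, fun i => memLp_glue hm₁ hm₂ L _ _,
    fun i j => memLp_glue hm₁ hm₂ L _ _, hzero _ _, fun i => hzero _ _, fun i j => hzero _ _,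
    fun i => ?_, fun i j => ?_⟩
  · -- locally at points of `Ω₁`, of the interface, of the outer domain, of the outer boundary, and outside
    refine WeakPartialOn.of_local (hloc _ _) (hloc _ _) fun x _ => ?_
    by_cases hx₁ : x ∈ Ω₁
    · exact ⟨Ω₁, h.isOpen₁.mem_nhds hx₁,
        weakPartialOn_glue_left h.isOpen₁ hm₂ (disjoint Ω Ω₁) (hv i) L⟩
    by_cases hxc : x ∈ closure Ω₁
    · obtain ⟨U, μ, N, K, hxU, hU, hU', -⟩ := h.exists_interface_chart (x := x)
        (by rw [h.isOpen₁.frontier_eq]; exact ⟨hxc, hx₁⟩)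
      exact ⟨U, hU.isOpen.mem_nhds hxU, weakPartialOn_glue_interface h.isOpen₁ h.isOpen₂ hU hU' hv
        hv' hg₁ hg₂ (Eventually.of_forall fun _ _ => rfl) L i⟩
    by_cases hxΩ : x ∈ Ω
    · refine ⟨outerDomain Ω Ω₁, h.isOpen₂.mem_nhds ⟨hxΩ, hxc⟩, ?_⟩
      rw [glue_comm, glue_comm L (weakPartial Ω₁ i u₁)]
      exact weakPartialOn_glue_left h.isOpen₂ hm₁ (disjoint Ω Ω₁).symm (hv' i) L
    by_cases hxc' : x ∈ closure Ω
    · obtain ⟨U, μ, N, K, hxU, hU, hd⟩ := h.exists_outer_chart (x := x)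
        (by rw [h.isOpen.frontier_eq]; exact ⟨hxc', hxΩ⟩)
      exact ⟨U, hU.isOpen.mem_nhds hxU,
        weakPartialOn_glue_outer h.isOpen₁ h.isOpen₂ hU hd (u := u₁)
          (v := fun i => weakPartial Ω₁ i u₁) hv' htr L i⟩
    · refine ⟨(closure Ω)ᶜ, isClosed_closure.isOpen_compl.mem_nhds hxc', fun φ hφ => ?_⟩
      have hz : ∀ {ψ : E (m + 1) → ℝ}, IsTest (closure Ω)ᶜ ψ →
          ∀ (f : L2 Ω₁) (g : L2 (outerDomain Ω Ω₁)), ∫ x, ψ x • glue L f g x = 0 := by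
        intro ψ hψ f g
        refine integral_eq_zero_of_ae (Eventually.of_forall fun x => ?_)
        by_cases hx : x ∈ Ω
        · simp [hψ.zero_off fun h1 => h1 (subset_closure hx)]
        · simp [hzero f g x hx]
      rw [hz (hφ.pd i), hz hφ, neg_zero]
  · -- the second derivatives are only needed in `Ω`, so the outer boundary plays no role here
    refine WeakPartialOn.of_local (hloc _ _) (hloc _ _) fun x hxΩ => ?_
    by_cases hx₁ : x ∈ Ω₁
    · exact ⟨Ω₁, h.isOpen₁.mem_nhds hx₁,
        weakPartialOn_glue_left h.isOpen₁ hm₂ (disjoint Ω Ω₁) (hw i j) L⟩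
    by_cases hxc : x ∈ closure Ω₁
    · obtain ⟨U, μ, N, K, hxU, hU, hU', hN⟩ := h.exists_interface_chart (x := x)
        (by rw [h.isOpen₁.frontier_eq]; exact ⟨hxc, hx₁⟩)
      have htt := traces_eq h.isOpen₁ h.isOpen₂ isClosed_frontier.measurableSet hU hU' hN hv hv'
        hw hw' hg₁ hg₂ ht ht' (by filter_upwards [hq, hq'] with x h1 h2; rw [← h1, ← h2])
      exact ⟨U, hU.isOpen.mem_nhds hxU, weakPartialOn_glue_interface h.isOpen₁ h.isOpen₂ hU hU'
        (hw i) (hw' i) (ht i) (ht' i) (by filter_upwards [htt] with x hx hxU using hx hxU i) L j⟩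
    · refine ⟨outerDomain Ω Ω₁, h.isOpen₂.mem_nhds ⟨hxΩ, hxc⟩, ?_⟩
      rw [glue_comm, glue_comm L (weakPartial Ω₁ j _)]
      exact weakPartialOn_glue_left h.isOpen₂ hm₁ (disjoint Ω Ω₁).symm (hw' i j) L

end IsTransmissionDomain

lemma coeFn_laplacian {n : ℕ} {A : Set (E n)} (u : L2 A) :
    ∀ᵐ x ∂volume.restrict A, laplacian A u x = ∑ k, weakPartial A k (weakPartial A k u) x := by
  filter_upwards [Lp.coeFn_finsetSum Finset.univ fun k => weakPartial A k (weakPartial A k u)]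
    with x hx
  rw [laplacian, hx, Finset.sum_apply]

lemma glue_laplacian {n : ℕ} {A A' : Set (E n)} (hA : MeasurableSet A) (hA' : MeasurableSet A')
    (L : ℂ →L[ℝ] ℝ) (u : L2 A) (u' : L2 A') :
    ∀ᵐ x, ∑ k, glue L (weakPartial A k (weakPartial A k u)) (weakPartial A' k (weakPartial A' k u')) x
      = glue L (laplacian A u) (laplacian A' u') x := by
  filter_upwards [(ae_restrict_iff' hA).1 (coeFn_laplacian u),
    (ae_restrict_iff' hA').1 (coeFn_laplacian u')] with x h1 h2
  simp only [glue, Finset.sum_add_distrib]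
  congr 1
  · by_cases hx : x ∈ A
    · simp only [Set.indicator_of_mem hx, h1 hx, map_sum]
    · simp only [Set.indicator_of_notMem hx, Finset.sum_const_zero]
  · by_cases hx : x ∈ A'
    · simp only [Set.indicator_of_mem hx, h2 hx, map_sum]
    · simp only [Set.indicator_of_notMem hx, Finset.sum_const_zero]

lemma h2Norm_sq {n : ℕ} (A : Set (E n)) (u : L2 A) :
    h2Norm A u ^ 2 = ‖u‖ ^ 2 + ∑ i, ‖weakPartial A i u‖ ^ 2
      + ∑ i, ∑ j, ‖weakPartial A j (weakPartial A i u)‖ ^ 2 :=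
  Real.sq_sqrt (by positivity)

/-- On the transmission space the `H²` norm is bounded by the `L²` norm of the Laplacian. -/
lemma IsTransmissionDomain.exists_laplacian_bound (h : IsTransmissionDomain Ω Ω₁) :
    ∃ C : ℝ, 0 ≤ C ∧ ∀ u : X Ω Ω₁, h2Norm Ω₁ u.1.1 ^ 2 + h2Norm (outerDomain Ω Ω₁) u.1.2 ^ 2
      ≤ C * (‖laplacian Ω₁ u.1.1‖ ^ 2 + ‖laplacian (outerDomain Ω Ω₁) u.1.2‖ ^ 2) := by
  obtain ⟨C, hC0, hC⟩ := exists_apriori_bound h.isOpen h.bounded h.smooth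
  refine ⟨C, hC0, fun u => ?_⟩
  have hm₁ := h.isOpen₁.measurableSet
  have hm₂ := h.isOpen₂.measurableSet
  have key : ∀ (f : L2 Ω₁) (g : L2 (outerDomain Ω Ω₁)), _ := fun f g =>
    integral_glue_sq hm₁ hm₂ (disjoint Ω Ω₁) f g
  have hΔ : ∀ L : ℂ →L[ℝ] ℝ, ∫ x, (∑ k, glue L (weakPartial Ω₁ k (weakPartial Ω₁ k u.1.1))
      (weakPartial (outerDomain Ω Ω₁) k (weakPartial (outerDomain Ω Ω₁) k u.1.2)) x) ^ 2
      = ∫ x, glue L (laplacian Ω₁ u.1.1) (laplacian (outerDomain Ω Ω₁) u.1.2) x ^ 2 := by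
    intro L
    refine integral_congr_ae ?_
    filter_upwards [glue_laplacian hm₁ hm₂ L u.1.1 u.1.2] with x hx
    rw [hx]
  have h1 := hC _ _ _ (h.isDirichletH2_glue u Complex.reCLM)
  have h2 := hC _ _ _ (h.isDirichletH2_glue u Complex.imCLM)
  rw [hΔ] at h1 h2
  rw [h2Norm_sq, h2Norm_sq, ← key]
  have e0 := key u.1.1 u.1.2
  have e1 := Finset.sum_congr (s₁ := Finset.univ) rfl fun i _ =>
    key (weakPartial Ω₁ i u.1.1) (weakPartial (outerDomain Ω Ω₁) i u.1.2)
  have e2 := Finset.sum_congr (s₁ := Finset.univ) rfl fun i _ =>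
    Finset.sum_congr (s₁ := Finset.univ) rfl fun j _ =>
    key (weakPartial Ω₁ j (weakPartial Ω₁ i u.1.1))
      (weakPartial (outerDomain Ω Ω₁) j (weakPartial (outerDomain Ω Ω₁) i u.1.2))
  simp only [Finset.sum_add_distrib] at e1 e2
  linarith

end Transmission

/-! ### Inner products pulled back along an injective linear map -/

section Core

variable {V Z : Type*} [AddCommGroup V] [Module ℂ V] [NormedAddCommGroup Z] [InnerProductSpace ℂ Z]

/-- The inner product `⟨T u, T v⟩` for an injective linear map `T`. -/
@[reducible] noncomputable def pullbackCore (T : V →ₗ[ℂ] Z) (hT : Function.Injective T) :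
    InnerProductSpace.Core ℂ V where
  inner u v := inner ℂ (T u) (T v)
  conj_inner_symm u v := inner_conj_symm _ _
  re_inner_nonneg u := inner_self_nonneg
  add_left u v w := by rw [map_add, inner_add_left]
  smul_left u v r := by rw [map_smul, inner_smul_left]
  definite u hu := by
    rw [inner_self_eq_zero] at hu
    exact hT (hu.trans (map_zero T).symm)

lemma normOf_pullbackCore (T : V →ₗ[ℂ] Z) (hT : Function.Injective T) (u : V) :
    normOf (pullbackCore T hT) u = ‖T u‖ := by
  rw [norm_eq_sqrt_re_inner (𝕜 := ℂ)]
  rfl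

/-- The uniform structure which an inner product defines. -/
@[reducible] noncomputable def uniformityOf (I : InnerProductSpace.Core ℂ V) : UniformSpace V :=
  I.toNormedAddCommGroup.toPseudoMetricSpace.toUniformSpace

lemma hasBasis_uniformityOf (I : InnerProductSpace.Core ℂ V) :
    (@uniformity V (uniformityOf I)).HasBasis (fun ε : ℝ => 0 < ε)
      fun ε => {p | normOf I (p.1 - p.2) < ε} := by
  let := I.toNormedAddCommGroup
  have h := Metric.uniformity_basis_dist (α := V)
  simp only [dist_eq_norm] at h
  exact h

/-- A pulled back inner product is complete if the range of the map is closed. -/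
lemma isHilbert_pullbackCore [CompleteSpace Z] (T : V →ₗ[ℂ] Z) (hT : Function.Injective T)
    (hc : IsClosed (Set.range T)) : IsHilbert (pullbackCore T hT) := by
  have hu : @IsUniformInducing V Z (uniformityOf (pullbackCore T hT)) _ T := by
    rw [@isUniformInducing_iff]
    have h1 := Metric.uniformity_basis_dist (α := Z).comap fun x : V × V => (T x.1, T x.2)
    refine h1.eq_of_same_basis ?_
    convert hasBasis_uniformityOf (pullbackCore T hT) using 3 with ε
    simp only [Set.preimage_ofPred_eq, dist_eq_norm, ← map_sub, normOf_pullbackCore]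
  exact @IsUniformInducing.completeSpace V Z (uniformityOf (pullbackCore T hT)) _ T hu hc.isComplete

lemma uniformityOf_le {I J : InnerProductSpace.Core ℂ V} {M : ℝ} (hM : 0 < M)
    (h : ∀ u, normOf J u ≤ M * normOf I u) : uniformityOf I ≤ uniformityOf J := by
  refine ((hasBasis_uniformityOf I).le_basis_iff (hasBasis_uniformityOf J)).2 fun ε hε => ?_
  refine ⟨ε / M, div_pos hε hM, fun p hp => ?_⟩
  refine (h _).trans_lt ?_
  rw [← lt_div_iff₀' hM]
  exact hp

/-- Equivalent norms define the same uniform structure, hence the same topology and the same notion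
of completeness. -/
lemma uniformityOf_eq {I J : InnerProductSpace.Core ℂ V} {m M : ℝ} (hm : 0 < m) (hM : 0 < M)
    (h₁ : ∀ u, m * normOf I u ≤ normOf J u) (h₂ : ∀ u, normOf J u ≤ M * normOf I u) :
    uniformityOf I = uniformityOf J :=
  le_antisymm (uniformityOf_le hM h₂) (uniformityOf_le (inv_pos.2 hm) fun u => by
    rw [inv_mul_eq_div, le_div_iff₀' hm]
    exact h₁ u)

end Core

/-! ### The Hilbert space of `2`-jets -/

section Jet

variable {n : ℕ} {A B : Set (E n)}

/-- Multi-indices of order at most two: `∅`, `i` and `(i, j)`. -/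
abbrev JetIndex (n : ℕ) : Type := Unit ⊕ Fin n ⊕ Fin n × Fin n

/-- The Hilbert space which contains all `(u, ∂ᵢ u, ∂ⱼ∂ᵢ u)`. -/
abbrev JetSpace {n : ℕ} (A : Set (E n)) : Type := PiLp 2 fun _ : JetIndex n => L2 A

/-- The family of a function and its weak derivatives of order at most two. -/
noncomputable def jet (A : Set (E n)) (u : L2 A) : JetSpace A :=
  WithLp.toLp 2 (Sum.elim (fun _ => u)
    (Sum.elim (fun i => weakPartial A i u) fun p => weakPartial A p.2 (weakPartial A p.1 u)))

lemma jet_add (hA : IsOpen A) {u u' : L2 A} (h : MemH2 A u) (h' : MemH2 A u') :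
    jet A (u + u') = jet A u + jet A u' := by
  have h1 : ∀ i, weakPartial A i (u + u') = weakPartial A i u + weakPartial A i u' := fun i =>
    ((h.isWeakPartial hA i).add (h'.isWeakPartial hA i)).eq hA
  ext1 (_ | i | p)
  · rfl
  · exact h1 i
  · change weakPartial A p.2 (weakPartial A p.1 (u + u')) = _
    rw [h1]
    exact ((h.isWeakPartial₂ hA p.1 p.2).add (h'.isWeakPartial₂ hA p.1 p.2)).eq hA

lemma jet_smul (hA : IsOpen A) {u : L2 A} (c : ℂ) (h : MemH2 A u) :
    jet A (c • u) = c • jet A u := by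
  have h1 : ∀ i, weakPartial A i (c • u) = c • weakPartial A i u := fun i =>
    ((h.isWeakPartial hA i).smul c).eq hA
  ext1 (_ | i | p)
  · rfl
  · exact h1 i
  · change weakPartial A p.2 (weakPartial A p.1 (c • u)) = _
    rw [h1]
    exact ((h.isWeakPartial₂ hA p.1 p.2).smul c).eq hA

lemma inner_jet (u v : L2 A) : inner ℂ (jet A u) (jet A v) = h2Inner A u v := by
  rw [PiLp.inner_apply, Fintype.sum_sum_type, Fintype.sum_sum_type, Fintype.sum_prod_type,
    h2Inner, ← add_assoc]
  simp [jet]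

lemma norm_jet (u : L2 A) : ‖jet A u‖ = h2Norm A u := by
  rw [PiLp.norm_eq_of_L2, Fintype.sum_sum_type, Fintype.sum_sum_type, Fintype.sum_prod_type,
    h2Norm, ← add_assoc]
  simp [jet]

/-- The Laplacian is the trace of the second derivatives. -/
noncomputable def jetLaplacian (A : Set (E n)) : JetSpace A →ₗ[ℂ] L2 A where
  toFun z := ∑ i, z (Sum.inr (Sum.inr (i, i)))
  map_add' z z' := by simp [Finset.sum_add_distrib]
  map_smul' c z := by simp [Finset.smul_sum]

lemma jetLaplacian_jet (u : L2 A) : jetLaplacian A (jet A u) = laplacian A u := rfl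

lemma norm_jetLaplacian_sq_le (z : JetSpace A) : ‖jetLaplacian A z‖ ^ 2 ≤ n * ‖z‖ ^ 2 := by
  have h1 : ‖jetLaplacian A z‖ ≤ ∑ i, ‖z (Sum.inr (Sum.inr (i, i)))‖ :=
    norm_sum_le Finset.univ fun i => z (Sum.inr (Sum.inr (i, i)))
  have h2 := sq_sum_le_card_mul_sum_sq (s := Finset.univ)
    (f := fun i : Fin n => ‖z (Sum.inr (Sum.inr (i, i)))‖)
  rw [Finset.card_univ, Fintype.card_fin] at h2
  refine ((pow_le_pow_left₀ (norm_nonneg _) h1 2).trans h2).trans ?_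
  refine mul_le_mul_of_nonneg_left ?_ (Nat.cast_nonneg n)
  rw [PiLp.norm_sq_eq_of_L2, Fintype.sum_sum_type, Fintype.sum_sum_type, Fintype.sum_prod_type]
  have h3 : ∑ i, ‖z (Sum.inr (Sum.inr (i, i)))‖ ^ 2
      ≤ ∑ i, ∑ j, ‖z (Sum.inr (Sum.inr (i, j)))‖ ^ 2 := by
    refine Finset.sum_le_sum fun i _ => ?_
    exact Finset.single_le_sum (f := fun j => ‖z (Sum.inr (Sum.inr (i, j)))‖ ^ 2)
      (fun j _ => by positivity) (Finset.mem_univ i)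
  have h4 : (0 : ℝ) ≤ ∑ x : Unit, ‖z (Sum.inl x)‖ ^ 2 := by positivity
  have h5 : (0 : ℝ) ≤ ∑ x : Fin n, ‖z (Sum.inr (Sum.inl x))‖ ^ 2 := by positivity
  linarith

/-- Convergence of jets: the limit is the jet of an element of `H²`. -/
lemma exists_jet_eq (hA : IsOpen A) {uk : ℕ → L2 A} {z : JetSpace A} (hk : ∀ k, MemH2 A (uk k))
    (hz : Tendsto (fun k => jet A (uk k)) atTop (𝓝 z)) :
    ∃ u, MemH2 A u ∧ jet A u = z ∧ Tendsto uk atTop (𝓝 u) ∧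
      (∀ i, Tendsto (fun k => weakPartial A i (uk k)) atTop (𝓝 (weakPartial A i u))) ∧
      ∀ i j, Tendsto (fun k => weakPartial A j (weakPartial A i (uk k))) atTop
        (𝓝 (weakPartial A j (weakPartial A i u))) := by
  have hc : ∀ a : JetIndex n, Tendsto (fun k => jet A (uk k) a) atTop (𝓝 (z a)) := fun a =>
    ((show Continuous fun z : JetSpace A => z a by fun_prop).tendsto z).comp hz
  have h0 : Tendsto uk atTop (𝓝 (z (Sum.inl ()))) := hc (Sum.inl ())
  have h1 : ∀ i, Tendsto (fun k => weakPartial A i (uk k)) atTop (𝓝 (z (Sum.inr (Sum.inl i)))) :=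
    fun i => hc (Sum.inr (Sum.inl i))
  have h2 : ∀ i j, Tendsto (fun k => weakPartial A j (weakPartial A i (uk k))) atTop
      (𝓝 (z (Sum.inr (Sum.inr (i, j))))) := fun i j => hc (Sum.inr (Sum.inr (i, j)))
  have hw1 : ∀ i, IsWeakPartial A i (z (Sum.inl ())) (z (Sum.inr (Sum.inl i))) := fun i =>
    IsWeakPartial.of_tendsto h0 (h1 i) fun k => (hk k).isWeakPartial hA i
  have hw2 : ∀ i j, IsWeakPartial A j (z (Sum.inr (Sum.inl i))) (z (Sum.inr (Sum.inr (i, j)))) :=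
    fun i j => IsWeakPartial.of_tendsto (h1 i) (h2 i j) fun k => (hk k).isWeakPartial₂ hA i j
  refine ⟨z (Sum.inl ()), fun i => ⟨_, hw1 i, fun j => ⟨_, hw2 i j⟩⟩, ?_, h0, fun i => ?_,
    fun i j => ?_⟩
  · ext1 (_ | i | p)
    · rfl
    · exact (hw1 i).eq hA
    · change weakPartial A p.2 (weakPartial A p.1 _) = _
      rw [(hw1 p.1).eq hA, (hw2 p.1 p.2).eq hA]
  · rw [(hw1 i).eq hA]
    exact h1 i
  · rw [(hw1 i).eq hA, (hw2 i j).eq hA]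
    exact h2 i j

lemma norm_le_of_ae_eq_sum {ν : Measure (E n)} {N : E n → E n} (hN : ∀ x i, |N x i| ≤ 1)
    {g : Lp ℂ 2 ν} {t : Fin n → Lp ℂ 2 ν}
    (h : ∀ᵐ x ∂ν, g x = ∑ i, ((N x i : ℝ) : ℂ) * t i x) : ‖g‖ ≤ ∑ i, ‖t i‖ := by
  have h1 : ‖g‖ₑ ≤ ∑ i, ‖t i‖ₑ := by
    simp only [Lp.enorm_def]
    have h2 : eLpNorm g 2 ν ≤ eLpNorm (∑ i, fun x => ‖t i x‖) 2 ν := by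
      refine eLpNorm_mono_ae_real ?_
      filter_upwards [h] with x hx
      rw [hx, Finset.sum_apply]
      refine (norm_sum_le _ _).trans (Finset.sum_le_sum fun i _ => ?_)
      rw [norm_mul, Complex.norm_real]
      exact mul_le_of_le_one_left (norm_nonneg _) (hN x i)
    refine h2.trans ((eLpNorm_sum_le (fun i _ => (Lp.aestronglyMeasurable (t i)).norm)
      (by norm_num)).trans (Finset.sum_le_sum fun i _ => le_of_eq (eLpNorm_norm _)))
  simp only [← ofReal_norm] at h1
  rw [← ENNReal.ofReal_sum_of_nonneg fun i _ => norm_nonneg _] at h1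
  exact (ENNReal.ofReal_le_ofReal_iff (Finset.sum_nonneg fun i _ => norm_nonneg _)).1 h1

/-- Normal derivatives of a sequence which converges in `H²` converge. -/
lemma HasNormalDerivative.exists_tendsto {C : NNReal} (hC : HasTraceBound A B C) (hA : IsOpen A)
    {ν : E n → E n} (hν : ∀ x i, |ν x i| ≤ 1) {uk : ℕ → L2 A} {u : L2 A}
    {gk : ℕ → L2Surface B} (hk : ∀ k, MemH2 A (uk k))
    (h : ∀ k, HasNormalDerivative A B ν (uk k) (gk k)) (hu : MemH2 A u)
    (h1 : ∀ i, Tendsto (fun k => weakPartial A i (uk k)) atTop (𝓝 (weakPartial A i u)))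
    (h2 : ∀ i j, Tendsto (fun k => weakPartial A j (weakPartial A i (uk k))) atTop
        (𝓝 (weakPartial A j (weakPartial A i u)))) :
    ∃ g, Tendsto gk atTop (𝓝 g) ∧ HasNormalDerivative A B ν u g := by
  choose v t hv ht hg using h
  have hvv : ∀ k i, v k i = weakPartial A i (uk k) := fun k i => ((hv k i).eq hA).symm
  simp only [hvv] at ht
  have hw := fun k i j => (hk k).isWeakPartial₂ hA i j
  choose t' ht' using fun i => HasTrace.exists_tendsto hC hA (fun k => ht k i)
    (fun k j => hw k i j) (h1 i) (h2 i)
  have hcauchy : CauchySeq gk := by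
    refine cauchySeq_iff_tendsto_dist_atTop_0.2 ?_
    have hlim := tendsto_finsetSum Finset.univ fun i _ =>
      cauchySeq_iff_tendsto_dist_atTop_0.1 (ht' i).cauchySeq
    rw [Finset.sum_const_zero] at hlim
    refine squeeze_zero (fun _ => dist_nonneg) (fun p => ?_) hlim
    simp only [dist_eq_norm]
    refine norm_le_of_ae_eq_sum hν ?_
    filter_upwards [hg p.1, hg p.2, Lp.coeFn_sub (gk p.1) (gk p.2),
      ae_all_iff.2 fun i => Lp.coeFn_sub (t p.1 i) (t p.2 i)] with x e1 e2 e3 e4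
    simp only [e3, e4, Pi.sub_apply, mul_sub, Finset.sum_sub_distrib, e1, e2]
  obtain ⟨g, hg'⟩ := cauchySeq_tendsto_of_complete hcauchy
  exact ⟨g, hg', fun i => weakPartial A i u, t', hu.isWeakPartial hA,
    fun i => HasTrace.of_tendsto hA (fun k => ht k i) (fun k j => hw k i j) (h1 i) (h2 i) (ht' i),
    ae_eq_sum_of_tendsto hν hg hg' ht'⟩

end Jet

/-! ### The two Hilbert space structures -/

section Structures

variable {n : ℕ} {Ω Ω₁ : Set (E n)}

/-- The pair of jets of an element of the transmission space. -/
noncomputable def transmissionJet (h : IsTransmissionDomain Ω Ω₁) :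
    X Ω Ω₁ →ₗ[ℂ] WithLp 2 (JetSpace Ω₁ × JetSpace (outerDomain Ω Ω₁)) where
  toFun u := WithLp.toLp 2 (jet Ω₁ u.1.1, jet (outerDomain Ω Ω₁) u.1.2)
  map_add' u v := by
    change WithLp.toLp 2 (jet Ω₁ (u.1.1 + v.1.1), jet (outerDomain Ω Ω₁) (u.1.2 + v.1.2)) = _
    rw [jet_add h.isOpen₁ u.2.1 v.2.1, jet_add h.isOpen₂ u.2.2.1 v.2.2.1]
    rfl
  map_smul' c u := by
    change WithLp.toLp 2 (jet Ω₁ (c • u.1.1), jet (outerDomain Ω Ω₁) (c • u.1.2)) = _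
    rw [jet_smul h.isOpen₁ c u.2.1, jet_smul h.isOpen₂ c u.2.2.1]
    rfl

lemma transmissionJet_injective (h : IsTransmissionDomain Ω Ω₁) :
    Function.Injective (transmissionJet h) := by
  intro u v huv
  have h1 := congrArg (fun z => z.fst (Sum.inl ())) huv
  have h2 := congrArg (fun z => z.snd (Sum.inl ())) huv
  exact Subtype.ext (Prod.ext h1 h2)

lemma inner_transmissionJet (h : IsTransmissionDomain Ω Ω₁) (u v : X Ω Ω₁) :
    inner ℂ (transmissionJet h u) (transmissionJet h v) = innerTwo Ω Ω₁ u v := by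
  rw [WithLp.prod_inner_apply, innerTwo, ← inner_jet, ← inner_jet]
  rfl

lemma norm_transmissionJet (h : IsTransmissionDomain Ω Ω₁) (u : X Ω Ω₁) :
    ‖transmissionJet h u‖ = normTwo Ω Ω₁ u := by
  rw [WithLp.prod_norm_eq_of_L2, normTwo, ← norm_jet, ← norm_jet]
  rfl

/-- The operator `G` with its range in an unweighted product: the square roots of the weights of the
space `H` are absorbed into the operator. -/
noncomputable def weightedLaplacian (h : IsTransmissionDomain Ω Ω₁) (c₁ c₂ : ℝ) :
    X Ω Ω₁ →ₗ[ℂ] WithLp 2 (L2 Ω₁ × L2 (outerDomain Ω Ω₁)) where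
  toFun u := WithLp.toLp 2 ((√c₁⁻¹ : ℂ) • (G Ω Ω₁ c₁ c₂ u).1, (√c₂⁻¹ : ℂ) • (G Ω Ω₁ c₁ c₂ u).2)
  map_add' u v := by
    have h1 : laplacian Ω₁ (u.1.1 + v.1.1) = laplacian Ω₁ u.1.1 + laplacian Ω₁ v.1.1 := by
      rw [← jetLaplacian_jet, jet_add h.isOpen₁ u.2.1 v.2.1, map_add]
      rfl
    have h2 : laplacian (outerDomain Ω Ω₁) (u.1.2 + v.1.2)
        = laplacian (outerDomain Ω Ω₁) u.1.2 + laplacian (outerDomain Ω Ω₁) v.1.2 := by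
      rw [← jetLaplacian_jet, jet_add h.isOpen₂ u.2.2.1 v.2.2.1, map_add]
      rfl
    simp only [G, Submodule.coe_add, Prod.fst_add, Prod.snd_add, h1, h2, smul_add, neg_add_rev]
    rw [← WithLp.toLp_add, Prod.mk_add_mk, add_comm, add_comm (_ • _ : L2 (outerDomain Ω Ω₁))]
  map_smul' c u := by
    have h1 : laplacian Ω₁ (c • u.1.1) = c • laplacian Ω₁ u.1.1 := by
      rw [← jetLaplacian_jet, jet_smul h.isOpen₁ c u.2.1, map_smul]
      rfl
    have h2 : laplacian (outerDomain Ω Ω₁) (c • u.1.2)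
        = c • laplacian (outerDomain Ω Ω₁) u.1.2 := by
      rw [← jetLaplacian_jet, jet_smul h.isOpen₂ c u.2.2.1, map_smul]
      rfl
    simp only [G, Submodule.coe_smul, Prod.smul_fst, Prod.smul_snd, h1, h2, smul_neg,
      smul_comm _ c, RingHom.id_apply]
    rw [← WithLp.toLp_smul, Prod.smul_mk, smul_neg, smul_neg]

variable {c₁ c₂ : ℝ}

lemma inner_weightedLaplacian (h : IsTransmissionDomain Ω Ω₁) (hc₁ : 0 < c₁) (hc₂ : 0 < c₂)
    (u v : X Ω Ω₁) :
    inner ℂ (weightedLaplacian h c₁ c₂ u) (weightedLaplacian h c₁ c₂ v)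
      = innerX Ω Ω₁ c₁ c₂ u v := by
  have key : ∀ {c : ℝ}, 0 < c → (√c⁻¹ : ℂ) * (√c⁻¹ : ℂ) = ((c⁻¹ : ℝ) : ℂ) := fun hc => by
    rw [← Complex.ofReal_mul, Real.mul_self_sqrt (inv_pos.2 hc).le]
  rw [WithLp.prod_inner_apply, innerX, hInner, ← key hc₁, ← key hc₂]
  simp only [weightedLaplacian, LinearMap.coe_mk, AddHom.coe_mk, inner_smul_left, inner_smul_right,
    Complex.conj_ofReal, mul_assoc]

lemma norm_weightedLaplacian (h : IsTransmissionDomain Ω Ω₁) (hc₁ : 0 < c₁) (hc₂ : 0 < c₂)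
    (u : X Ω Ω₁) : ‖weightedLaplacian h c₁ c₂ u‖ = normX Ω Ω₁ c₁ c₂ u := by
  have key : ∀ {c : ℝ}, 0 < c → ‖(√c⁻¹ : ℂ)‖ ^ 2 = c⁻¹ := fun hc => by
    rw [Complex.norm_real, Real.norm_eq_abs, sq_abs, Real.sq_sqrt (inv_pos.2 hc).le]
  rw [WithLp.prod_norm_eq_of_L2, normX, hNorm, ← key hc₁, ← key hc₂, ← mul_pow, ← mul_pow,
    ← norm_smul, ← norm_smul]
  rfl

lemma normX_sq (hc₁ : 0 < c₁) (hc₂ : 0 < c₂) (u : X Ω Ω₁) : normX Ω Ω₁ c₁ c₂ u ^ 2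
    = c₁ * ‖laplacian Ω₁ u.1.1‖ ^ 2 + c₂ * ‖laplacian (outerDomain Ω Ω₁) u.1.2‖ ^ 2 := by
  rw [normX, hNorm, Real.sq_sqrt (by positivity)]
  simp only [G, norm_neg, norm_smul, Complex.norm_real, Real.norm_eq_abs, mul_pow, sq_abs]
  field_simp

lemma normTwo_sq (u : X Ω Ω₁) : normTwo Ω Ω₁ u ^ 2
    = h2Norm Ω₁ u.1.1 ^ 2 + h2Norm (outerDomain Ω Ω₁) u.1.2 ^ 2 :=
  Real.sq_sqrt (by positivity)

lemma exists_normX_le (hc₁ : 0 < c₁) (hc₂ : 0 < c₂) :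
    ∃ M, 0 < M ∧ ∀ u : X Ω Ω₁, normX Ω Ω₁ c₁ c₂ u ≤ M * normTwo Ω Ω₁ u := by
  have hpos : (0 : ℝ) < (c₁ + c₂) * (n + 1) := by positivity
  refine ⟨√((c₁ + c₂) * (n + 1)), Real.sqrt_pos.2 hpos, fun u => ?_⟩
  refine le_of_sq_le_sq ?_ (mul_nonneg (Real.sqrt_nonneg _) (Real.sqrt_nonneg _))
  rw [mul_pow, Real.sq_sqrt hpos.le, normX_sq hc₁ hc₂, normTwo_sq, ← norm_jet, ← norm_jet,
    ← jetLaplacian_jet, ← jetLaplacian_jet]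
  have h1 := norm_jetLaplacian_sq_le (jet Ω₁ u.1.1)
  have h2 := norm_jetLaplacian_sq_le (jet (outerDomain Ω Ω₁) u.1.2)
  have key : ∀ {c a b : ℝ}, 0 ≤ c → c ≤ c₁ + c₂ → 0 ≤ b → a ≤ n * b →
      c * a ≤ (c₁ + c₂) * (n + 1) * b := by
    intro c a b hc hcc hb hab
    calc c * a ≤ c * ((n + 1) * b) := mul_le_mul_of_nonneg_left (by linarith) hc
      _ ≤ (c₁ + c₂) * ((n + 1) * b) := mul_le_mul_of_nonneg_right hcc (by positivity)
      _ = (c₁ + c₂) * (n + 1) * b := by ring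
  rw [mul_add]
  exact add_le_add (key hc₁.le (by linarith) (by positivity) h1)
    (key hc₂.le (by linarith) (by positivity) h2)

end Structures

section Complete

variable {m : ℕ} {Ω Ω₁ : Set (E (m + 1))} {c₁ c₂ : ℝ}

/-- The nontrivial half of the equivalence of norms, from the a priori estimate. -/
lemma exists_le_normX (h : IsTransmissionDomain Ω Ω₁) (hc₁ : 0 < c₁) (hc₂ : 0 < c₂) :
    ∃ a, 0 < a ∧ ∀ u : X Ω Ω₁, a * normTwo Ω Ω₁ u ≤ normX Ω Ω₁ c₁ c₂ u := by
  obtain ⟨C, hC0, hC⟩ := h.exists_laplacian_bound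
  have hpos : 0 < C * (c₁⁻¹ + c₂⁻¹) + 1 := by positivity
  -- adding `1` keeps the constant positive even if `C = 0`
  refine ⟨(√(C * (c₁⁻¹ + c₂⁻¹) + 1))⁻¹, inv_pos.2 (Real.sqrt_pos.2 hpos), fun u => ?_⟩
  rw [inv_mul_le_iff₀ (Real.sqrt_pos.2 hpos)]
  refine le_of_sq_le_sq ?_ (mul_nonneg (Real.sqrt_nonneg _) (Real.sqrt_nonneg _))
  rw [mul_pow, Real.sq_sqrt hpos.le, normTwo_sq, normX_sq hc₁ hc₂]
  refine (hC u).trans ?_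
  set a := ‖laplacian Ω₁ u.1.1‖ ^ 2
  set b := ‖laplacian (outerDomain Ω Ω₁) u.1.2‖ ^ 2
  have ha : 0 ≤ a := by positivity
  have hb : 0 ≤ b := by positivity
  have h1 : a + b ≤ (c₁⁻¹ + c₂⁻¹) * (c₁ * a + c₂ * b) := by
    have e1 : (c₁⁻¹ + c₂⁻¹) * (c₁ * a + c₂ * b) = a + b + (c₁⁻¹ * c₂ * b + c₂⁻¹ * c₁ * a) := by
      field_simp
      ring
    rw [e1]
    exact le_add_of_nonneg_right (by positivity)
  have h2 : 0 ≤ c₁ * a + c₂ * b := by positivity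
  nlinarith [mul_le_mul_of_nonneg_left h1 hC0]

lemma weightedLaplacian_injective (h : IsTransmissionDomain Ω Ω₁) (hc₁ : 0 < c₁) (hc₂ : 0 < c₂) :
    Function.Injective (weightedLaplacian h c₁ c₂) := by
  obtain ⟨a, ha, hle⟩ := exists_le_normX h hc₁ hc₂
  refine (injective_iff_map_eq_zero _).2 fun u hu => ?_
  have h1 := hle u
  rw [← norm_weightedLaplacian h hc₁ hc₂, hu, norm_zero, ← norm_transmissionJet h] at h1
  have h2 : ‖transmissionJet h u‖ ≤ 0 := by
    by_contra! h3
    exact absurd h1 (not_le.2 (mul_pos ha h3))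
  exact (injective_iff_map_eq_zero _).1 (transmissionJet_injective h) u (norm_le_zero_iff.1 h2)

/-- The boundary and transmission conditions survive limits in `H²`, by the trace inequality. -/
lemma isClosed_range_transmissionJet (h : IsTransmissionDomain Ω Ω₁) :
    IsClosed (Set.range (transmissionJet h)) := by
  refine IsSeqClosed.isClosed fun x z hx hz => ?_
  choose u hu using hx
  obtain rfl : (fun k => transmissionJet h (u k)) = x := funext hu
  have hz₁ : Tendsto (fun k => jet Ω₁ (u k).1.1) atTop (𝓝 z.fst) :=
    ((show Continuous fun z : WithLp 2 (JetSpace Ω₁ × JetSpace (outerDomain Ω Ω₁)) => z.fst by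
      fun_prop).tendsto z).comp hz
  have hz₂ : Tendsto (fun k => jet (outerDomain Ω Ω₁) (u k).1.2) atTop (𝓝 z.snd) :=
    ((show Continuous fun z : WithLp 2 (JetSpace Ω₁ × JetSpace (outerDomain Ω Ω₁)) => z.snd by
      fun_prop).tendsto z).comp hz
  obtain ⟨u₁, hu₁, hj₁, h0, h1, h2⟩ := exists_jet_eq h.isOpen₁ (fun k => (u k).2.1) hz₁
  obtain ⟨u₂, hu₂, hj₂, h0', h1', h2'⟩ := exists_jet_eq h.isOpen₂ (fun k => (u k).2.2.1) hz₂
  obtain ⟨C, hC⟩ := h.exists_trace_bound₁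
  obtain ⟨C', hC'⟩ := h.exists_trace_bound₂
  have hw : ∀ k i, IsWeakPartial Ω₁ i (u k).1.1 (weakPartial Ω₁ i (u k).1.1) := fun k i =>
    (u k).2.1.isWeakPartial h.isOpen₁ i
  have hw' : ∀ k i, IsWeakPartial (outerDomain Ω Ω₁) i (u k).1.2
      (weakPartial (outerDomain Ω Ω₁) i (u k).1.2) := fun k i =>
    (u k).2.2.1.isWeakPartial h.isOpen₂ i
  have hzero : HasTrace (outerDomain Ω Ω₁) (frontier Ω) u₂ 0 :=
    HasTrace.of_tendsto h.isOpen₂ (fun k => (u k).2.2.2.1) hw' h0' h1' tendsto_const_nhds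
  choose g hg hg' using fun k => (u k).2.2.2.2.1
  choose q hq hq' using fun k => (u k).2.2.2.2.2
  obtain ⟨g₀, hg₀⟩ := HasTrace.exists_tendsto hC h.isOpen₁ hg hw h0 h1
  obtain ⟨q₀, hq₀, hn⟩ := HasNormalDerivative.exists_tendsto hC h.isOpen₁ (abs_outerNormal_le Ω₁)
    (fun k => (u k).2.1) hq hu₁ h1 h2
  obtain ⟨q₀', hq₀', hn'⟩ := HasNormalDerivative.exists_tendsto hC' h.isOpen₂
    (abs_outerNormal_le Ω₁) (fun k => (u k).2.2.1) hq' hu₂ h1' h2'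
  -- both normal derivatives have the same limit, being limits of the same sequence
  obtain rfl := tendsto_nhds_unique hq₀ hq₀'
  refine ⟨⟨(u₁, u₂), hu₁, hu₂, hzero,
    ⟨g₀, HasTrace.of_tendsto h.isOpen₁ hg hw h0 h1 hg₀,
      HasTrace.of_tendsto h.isOpen₂ hg' hw' h0' h1' hg₀⟩, ⟨q₀, hn, hn'⟩⟩, ?_⟩
  change WithLp.toLp 2 (jet Ω₁ u₁, jet (outerDomain Ω Ω₁) u₂) = z
  rw [hj₁, hj₂]
  rfl

end Complete

end Plate

theorem mainTheorem5 (n : ℕ) (hn : 2 ≤ n) (Ω Ω₁ : Set (Plate.E n))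
    (hΩ_open : IsOpen Ω) (hΩ_bdd : Bornology.IsBounded Ω) (hΩ_conn : IsConnected Ω)
    (hΩ_smooth : Plate.HasSmoothBoundary Ω)
    (hΩ₁_open : IsOpen Ω₁) (hΩ₁_bdd : Bornology.IsBounded Ω₁) (hΩ₁_conn : IsConnected Ω₁)
    (hΩ₁_smooth : Plate.HasSmoothBoundary Ω₁)
    (hsub : Ω₁ ⊆ Ω) (hdisj : Disjoint (frontier Ω₁) (frontier Ω))
    (hΩ₂_conn : IsConnected (Plate.outerDomain Ω Ω₁))
    (c₁ c₂ : ℝ) (hc₁ : 0 < c₁) (hc₂ : 0 < c₂) :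
    ∃ I₂ IX : InnerProductSpace.Core ℂ (Plate.X Ω Ω₁),
      -- the two inner products and their norms are the intended ones
      (∀ u v, I₂.inner u v = Plate.innerTwo Ω Ω₁ u v) ∧
      (∀ u, Plate.normOf I₂ u = Plate.normTwo Ω Ω₁ u) ∧
      (∀ u v, IX.inner u v = Plate.innerX Ω Ω₁ c₁ c₂ u v) ∧
      (∀ u, Plate.normOf IX u = Plate.normX Ω Ω₁ c₁ c₂ u) ∧
      -- both make the space a Hilbert space, with the same topology
      Plate.IsHilbert I₂ ∧ Plate.IsHilbert IX ∧
      Plate.topologyOf I₂ = Plate.topologyOf IX ∧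
      -- the two norms are equivalent
      ∃ m M : ℝ, 0 < m ∧ 0 < M ∧ ∀ u : Plate.X Ω Ω₁,
        m * Plate.normTwo Ω Ω₁ u ≤ Plate.normX Ω Ω₁ c₁ c₂ u ∧
        Plate.normX Ω Ω₁ c₁ c₂ u ≤ M * Plate.normTwo Ω Ω₁ u := by
  obtain ⟨m, rfl⟩ : ∃ m, n = m + 1 := ⟨n - 1, by omega⟩
  -- a point of `closure Ω₁` outside `Ω` would lie on both boundaries
  have hcl : closure Ω₁ ⊆ Ω := by
    intro x hx
    by_cases hx₁ : x ∈ Ω₁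
    · exact hsub hx₁
    by_contra hxΩ
    have h₁ : x ∈ frontier Ω₁ := by
      rw [hΩ₁_open.frontier_eq]
      exact ⟨hx, hx₁⟩
    refine Set.disjoint_left.1 hdisj h₁ ?_
    rw [hΩ_open.frontier_eq]
    exact ⟨closure_mono hsub hx, hxΩ⟩
  have h : Plate.IsTransmissionDomain Ω Ω₁ :=
    ⟨hΩ_open, hΩ_bdd, hΩ_smooth, hΩ₁_open, hΩ₁_smooth, hcl⟩
  have hinj := Plate.transmissionJet_injective h
  have hinj' := Plate.weightedLaplacian_injective h hc₁ hc₂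
  obtain ⟨a, ha, hle⟩ := Plate.exists_le_normX h hc₁ hc₂
  obtain ⟨M, hM, hge⟩ := Plate.exists_normX_le (Ω := Ω) (Ω₁ := Ω₁) hc₁ hc₂
  have hn₂ : ∀ u, Plate.normOf (Plate.pullbackCore (Plate.transmissionJet h) hinj) u
      = Plate.normTwo Ω Ω₁ u := fun u => by
    rw [Plate.normOf_pullbackCore, Plate.norm_transmissionJet]
  have hnX : ∀ u, Plate.normOf (Plate.pullbackCore (Plate.weightedLaplacian h c₁ c₂) hinj') u
      = Plate.normX Ω Ω₁ c₁ c₂ u := fun u => by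
    rw [Plate.normOf_pullbackCore, Plate.norm_weightedLaplacian h hc₁ hc₂]
  have hunif := Plate.uniformityOf_eq (I := Plate.pullbackCore (Plate.transmissionJet h) hinj)
    (J := Plate.pullbackCore (Plate.weightedLaplacian h c₁ c₂) hinj') ha hM (fun u => by rw [hn₂, hnX]; exact hle u)
    (fun u => by rw [hn₂, hnX]; exact hge u)
  have hH := Plate.isHilbert_pullbackCore (Plate.transmissionJet h) hinj
    (Plate.isClosed_range_transmissionJet h)
  refine ⟨Plate.pullbackCore (Plate.transmissionJet h) hinj,
    Plate.pullbackCore (Plate.weightedLaplacian h c₁ c₂) hinj',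
    fun u v => Plate.inner_transmissionJet h u v, hn₂,
    fun u v => Plate.inner_weightedLaplacian h hc₁ hc₂ u v, hnX, hH, ?_, ?_,
    a, M, ha, hM, fun u => ⟨hle u, hge u⟩⟩
  · -- completeness for the second norm comes from the equality of the uniform structures
    change @CompleteSpace _ (Plate.uniformityOf _)
    rw [← hunif]
    exact hH
  · exact congrArg (fun 𝒰 => @UniformSpace.toTopologicalSpace _ 𝒰) hunif
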